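/- Let $S$ and $A$ be Borel spaces (state and action space). For $x\in S$ let $A(x)\subseteq A$ be the measurable set of admissible actions, where $K=\{(x,a): a\in A(x)\}$ is measurable in $S\times A$ and contains the graph of a measurable map $S\to A$. Let $q(dy|x,a)$, $(x,a)\in K$, be a signed kernel of transition rates: $q(\Gamma|x,a)\ge 0$ for measurable $\Gamma\not\ni x$, $q(S|x,a)=0$, and $\bar q_x=\sup_{a\in A(x)}q_x(a)<\infty$ with $q_x(a)=-q(\{x\}|x,a)$. Let $c_0$ be a measurable real cost rate on $K$, $\alpha$ the discount factor, and $\gamma$ a probability measure on $S$ (the initial distribution). Let $\Omega$ be the space of sequences $(x_0,\theta_1,x_1,\theta_2,\dots)$ with $x_m\in S$, $\theta_m\in(0,\infty)$, or with these properties up to some index and equal to $(\infty,x_\infty)$ from there on, where $x_\infty\notin S$ is an isolated point. Put $T_m=\theta_1+\dots+\theta_m$, $T_\infty=\lim_m T_m$, $\xi_t=x_m$ for $T_m\le t<T_{m+1}$ and $\xi_t=x_\infty$ for $t\ge T_\infty$; $\xi_{t-}=x_m$ for $T_m<t\le T_{m+1}$, $\xi_{0-}=x_0$, and $\xi_{t-}=x_\infty$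 for $t\ge T_\infty$. A (randomized history-dependent) policy $\pi(da|\omega,t)$ is a transition probability on $A\cup\{a_\infty\}$ that is predictable with respect to the filtration $\mathcal F_t=\sigma(\{T_m\le s,\,x_m\in\Gamma\}: s\le t,\,m\ge0,\,\Gamma\in\mathcal B(S))$ and concentrated on $A(\xi_{t-})$, where $A(x_\infty)=\{a_\infty\}$. A measurable $\varphi:S\to A$ with $\varphi(x)\in A(x)$ gives the deterministic stationary policy with $\pi(\cdot|\omega,t)=\delta_{\varphi(\xi_{t-})}$ (and $\varphi(x_\infty)=a_\infty$). Under $\pi$, $P^\pi_\gamma$ is the probability measure on $\Omega$ such that $x_0$ has law $\gamma$ and, given the history $h_m=(x_0,\theta_1,\dots,\theta_m,x_m)$ with $\theta_m<\infty$, the pair $(\theta_{m+1},x_{m+1})$ has the law $\Lambda^m(dy|h_m,u)\,e^{-\int_0^u\Lambda^m(S|h_m,v)dv}\,du$ on $(0,\infty)\times S$ and the mass $e^{-\int_0^\infty\Lambda^m(S|h_m,v)dv}$ at $(\infty,x_\infty)$, where $\Lambda^m(\Gamma|h_m,u)=\int_A\pi(da|h_m,T_m+u)\,q(\Gamma\setminus\{x_m\}|x_m,a)$.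 Put $$V_0(\pi)=E^\pi_\gamma\Big[\int_0^\infty e^{-\alpha t}\int_A c_0(\xi_{t-},a)\,\pi(da|\omega,t)\,dt\Big].$$ Assume that there are measurable functions $w,w':S\to[1,\infty)$ and constants $\rho,b,L',\rho',b',M',c'\ge 0$ such that the following holds. (1) $\int_S w(y)q(dy|x,a)\le\rho w(x)+b$ on $K$, and there are measurable sets $S_0\subseteq S_1\subseteq\cdots$ with $\bigcup_l S_l=S$, $\lim_l\inf_{x\in S\setminus S_l}w(x)=\infty$ and $\sup_{x\in S_l}\bar q_x<\infty$ for every $l$. (2) $\int_S w\,d\gamma<\infty$ and $\alpha>\rho$. (3) $(\bar q_x+1)w'(x)\le L'w(x)$ and $|\inf_{a\in A(x)}c_0(x,a)|\le M'w'(x)+c'$ for all $x\in S$; $\int_S w'(y)q(dy|x,a)\le\rho'w'(x)+b'$ on $K$; and $\alpha>\rho'$. (4) For every $x\in S$: $A(x)$ is compact, $a\mapsto c_0(x,a)$ is lower semicontinuous on $A(x)$, $a\mapsto\int_S w(y)q(dy|x,a)$ is continuous on $A(x)$, and $a\mapsto\int_S u(y)q(dy|x,a)$ is lower semicontinuous on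 $A(x)$ for every bounded nonnegative measurable $u$. Let $\mathbf B_{w'}(S)$ be the set of measurable $u:S\to\mathbb R$ with $\sup_x|u(x)|/w'(x)<\infty$, and consider the Bellman equation $$\alpha u(x)=\inf_{a\in A(x)}\Big\{c_0(x,a)+\int_S q(dy|x,a)u(y)\Big\},\qquad x\in S.$$ (a) If $u^*\in\mathbf B_{w'}(S)$ solves the Bellman equation, then there is a deterministic stationary policy $\varphi^*$ with $\int_S u^*\,d\gamma=\inf_\pi V_0(\pi)=V_0(\varphi^*)$, where the infimum is over all policies. If $\varphi$ is measurable, $\varphi(x)\in A(x)$, and $\varphi(x)$ attains the infimum in the Bellman equation for $u^*$ at every $x$, then the policy $\varphi$ is optimal, that is, $V_0(\varphi)=\inf_\pi V_0(\pi)$. (b) The Bellman equation has exactly one solution $u^*$ in $\mathbf B_{w'}(S)$. It is the pointwise limit of the non-increasing sequence of functions in $\mathbf B_{w'}(S)$ given by $u^{(0)}(x)=\frac{M'(\alpha w'(x)+b')}{\alpha(\alpha-\rho')}+\frac{c'}{\alpha}$ and $$u^{(n+1)}(x)=\inf_{a\in A(x)}\Big\{\frac{c_0(x,a)}{\alpha+1+\bar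 q_x}+\frac{1+\bar q_x}{\alpha+1+\bar q_x}\int_S u^{(n)}(y)\Big(\frac{q(dy|x,a)}{1+\bar q_x}+I\{x\in dy\}\Big)\Big\}.$$ (c) $u^*$ solves the dual linear program: maximize $\int_S v\,d\gamma$ over all $v\in\mathbf B_{w'}(S)$ with $\frac1\alpha c_0(x,a)-v(x)+\frac1\alpha\int_S v(y)q(dy|x,a)\ge 0$ for all $(x,a)\in K$. (d) A feasible $v$ of this program solves it if and only if $v=u^*$ $\gamma$-almost surely. -/

import Mathlib

open MeasureTheory ProbabilityTheory Set Filter Topology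
open scoped ENNReal NNReal

set_option linter.unusedSectionVars false

/-- The primitives of a continuous-time Markov decision process with state space `S` and action
space `A`, except for the discount factor and the initial distribution. The transition rate
`q(dy|x,a)` is extended by zero from the set of admissible pairs to all of `S × A`; the values of
the cost rate at non-admissible pairs play no role. -/
structure CTMDP (S A : Type*) [MeasurableSpace S] [MeasurableSpace A] where
  /-- the set `A(x)` of admissible actions -/
  Adm : S → Set A
  measurableSet_graph : MeasurableSet {p : S × A | p.2 ∈ Adm p.1}
  exists_selector : ∃ φ : S → A, Measurable φ ∧ ∀ x, φ x ∈ Adm x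
  /-- the signed kernel `q(dy|x,a)` of transition rates -/
  q : S → A → SignedMeasure S
  measurable_q : ∀ Γ : Set S, MeasurableSet Γ → Measurable fun p : S × A => q p.1 p.2 Γ
  q_off : ∀ x a, a ∉ Adm x → q x a = 0
  q_nonneg : ∀ x, ∀ a ∈ Adm x, ∀ Γ : Set S, MeasurableSet Γ → x ∉ Γ → 0 ≤ q x a Γ
  q_conservative : ∀ x, ∀ a ∈ Adm x, q x a univ = 0
  q_stable : ∀ x, BddAbove ((fun a => -(q x a {x})) '' Adm x)
  /-- the cost rate `c₀(x,a)` -/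
  cost : S → A → ℝ
  measurable_cost : Measurable fun p : S × A => cost p.1 p.2

/-- A (possibly exploding or absorbed) trajectory is recorded as the sequence
`(0, x₀), (θ₁, x₁), (θ₂, x₂), …` of sojourn times and post-jump states; `Sum.inr ()` is the
isolated point `x_∞`. This is the type of one entry of the sequence. -/
abbrev Entry (S : Type*) : Type _ := ℝ≥0∞ × (S ⊕ Unit)

/-- The sequences `(x₀, θ₁, x₁, θ₂, …)` of the sample space: either all sojourn times are in
`(0, ∞)` and all states in `S`, or from some index `m ≥ 1` on all entries are `(∞, x_∞)` while the
earlier ones are as before. -/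
def IsPath {S : Type*} (ω : ℕ → Entry S) : Prop :=
  (ω 0).1 = 0 ∧ (ω 0).2 ≠ Sum.inr () ∧
    ∀ n, 0 < (ω (n + 1)).1 ∧ ((ω (n + 1)).1 = ∞ ↔ (ω (n + 1)).2 = Sum.inr ()) ∧
      ((ω n).2 = Sum.inr () → (ω (n + 1)).2 = Sum.inr ())

/-- The sample space `Ω`, with the trace of the product σ-algebra. -/
abbrev PathSpace (S : Type*) : Type _ := {ω : ℕ → Entry S // IsPath ω}

section Trajectories

variable {S : Type*}

/-- The jump moments `T_m = θ₁ + … + θ_m`. -/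
noncomputable def jumpTime (m : ℕ) (ω : ℕ → Entry S) : ℝ≥0∞ := ∑ k ∈ Finset.range (m + 1), (ω k).1

/-- The left limit `ξ_{t-}` of the controlled process: `x₀` at `t = 0`, `x_m` for
`T_m < t ≤ T_{m+1}`, and `x_∞` for `t > 0` with `t ≥ T_∞ = lim T_m`. -/
noncomputable def leftState (t : ℝ≥0) (ω : ℕ → Entry S) : S ⊕ Unit :=
  open Classical in
  if t = 0 then (ω 0).2
  else if h : ∃ m, jumpTime m ω < t ∧ (t : ℝ≥0∞) ≤ jumpTime (m + 1) ω then (ω (Nat.find h)).2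
  else Sum.inr ()

lemma jumpTime_mono (ω : ℕ → Entry S) : Monotone fun m => jumpTime m ω := by
  intro m k hmk
  exact Finset.sum_le_sum_of_subset (Finset.range_mono (by omega))

lemma leftState_eq {t : ℝ≥0} {ω : ℕ → Entry S} {m : ℕ} (h1 : jumpTime m ω < t)
    (h2 : (t : ℝ≥0∞) ≤ jumpTime (m + 1) ω) : leftState t ω = (ω m).2 := by
  have ht : t ≠ 0 := by rintro rfl; simp at h1
  have hex : ∃ m, jumpTime m ω < t ∧ (t : ℝ≥0∞) ≤ jumpTime (m + 1) ω := ⟨m, h1, h2⟩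
  classical
  unfold leftState
  rw [if_neg ht, dif_pos hex]
  have key : ∀ i j, jumpTime i ω < t → (t : ℝ≥0∞) ≤ jumpTime (j + 1) ω → i ≤ j := by
    intro i j hi hj
    by_contra hlt
    exact absurd (hj.trans (jumpTime_mono ω (by omega : j + 1 ≤ i))) (not_le.2 hi)
  have hs := Nat.find_spec hex
  rw [le_antisymm (key _ _ hs.1 h2) (key _ _ h1 hs.2)]

lemma ne_inr_of_jumpTime_ne_top {ω : ℕ → Entry S} (hω : IsPath ω) {m : ℕ}
    (h : jumpTime m ω ≠ ∞) : (ω m).2 ≠ Sum.inr () := by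
  rcases m with _ | m
  · exact hω.2.1
  · intro hx
    apply h
    have := ((hω.2.2 m).2.1).2 hx
    unfold jumpTime
    exact ENNReal.sum_eq_top.2 ⟨m + 1, by simp, this⟩

variable [MeasurableSpace S]

lemma measurable_jumpTime (m : ℕ) : Measurable (jumpTime (S := S) m) := by
  unfold jumpTime
  fun_prop

lemma measurableSet_isPath : MeasurableSet {ω : ℕ → Entry S | IsPath ω} := by
  have hinr : MeasurableSet {z : S ⊕ Unit | z = Sum.inr ()} := by
    have : {z : S ⊕ Unit | z = Sum.inr ()} = Set.range Sum.inr := by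
      ext z; rcases z with z | z <;> simp
    rw [this]
    exact measurableSet_range_inr
  have h2 (n : ℕ) : MeasurableSet {ω : ℕ → Entry S | (ω n).2 = Sum.inr ()} :=
    (by fun_prop : Measurable fun ω : ℕ → Entry S => (ω n).2) hinr
  have h1 (n : ℕ) : Measurable fun ω : ℕ → Entry S => (ω n).1 := by fun_prop
  have h3 (n : ℕ) : MeasurableSet {ω : ℕ → Entry S | (ω n).1 = ∞} :=
    h1 n (measurableSet_singleton _)
  refine MeasurableSet.inter (h1 0 (measurableSet_singleton _)) ?_
  refine MeasurableSet.inter (h2 0).compl ?_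
  show MeasurableSet {ω : ℕ → Entry S | ∀ n, 0 < (ω (n + 1)).1 ∧
    ((ω (n + 1)).1 = ∞ ↔ (ω (n + 1)).2 = Sum.inr ()) ∧
      ((ω n).2 = Sum.inr () → (ω (n + 1)).2 = Sum.inr ())}
  rw [ofPred_forall]
  refine MeasurableSet.iInter fun n => ?_
  refine MeasurableSet.inter (h1 (n + 1) measurableSet_Ioi) ?_
  exact MeasurableSet.inter ((h3 (n + 1)).iff (h2 (n + 1))) ((h2 n).imp (h2 (n + 1)))

variable (S) in
/-- The history `F_t = σ({T_m ≤ s, x_m ∈ Γ} : s ≤ t, m ≥ 0, Γ measurable in S)`. -/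
noncomputable def pathFiltration :
    Filtration ℝ≥0 (inferInstance : MeasurableSpace (PathSpace S)) where
  seq t := MeasurableSpace.generateFrom {B | ∃ (m : ℕ) (s : ℝ≥0) (Γ : Set S), s ≤ t ∧
    MeasurableSet Γ ∧ B = {ω | jumpTime m ω.1 ≤ s ∧ (ω.1 m).2 ∈ Sum.inl '' Γ}}
  mono' := by
    intro s t hst
    refine MeasurableSpace.generateFrom_mono ?_
    rintro B ⟨m, r, Γ, hr, hΓ, rfl⟩
    exact ⟨m, r, Γ, hr.trans hst, hΓ, rfl⟩
  le' := by
    intro t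
    refine MeasurableSpace.generateFrom_le ?_
    rintro B ⟨m, r, Γ, hr, hΓ, rfl⟩
    refine MeasurableSet.inter ?_ ?_
    · exact ((measurable_jumpTime m).comp measurable_subtype_coe) measurableSet_Iic
    · exact (measurable_snd.comp ((measurable_pi_apply m).comp measurable_subtype_coe))
        (measurableSet_inl_image.2 hΓ)

/-- Predictable sets are jointly measurable. -/
lemma predictable_le : (pathFiltration S).predictable ≤
    (inferInstance : MeasurableSpace (ℝ≥0 × PathSpace S)) := by
  refine MeasurableSpace.generateFrom_le ?_
  rintro B (⟨A, hA, rfl⟩ | ⟨i, A, hA, rfl⟩)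
  · exact (measurableSet_singleton _).prod ((pathFiltration S).le _ _ hA)
  · exact measurableSet_Ioi.prod ((pathFiltration S).le _ _ hA)

lemma measurable_leftState :
    Measurable[(pathFiltration S).predictable]
      fun p : ℝ≥0 × PathSpace S => leftState p.1 p.2.1 := by
  intro B hB
  set F : ℕ → Set (S ⊕ Unit) → Set (ℝ≥0 × PathSpace S) := fun m B =>
    {p | jumpTime m p.2.1 < p.1 ∧ (p.2.1 m).2 ∈ B} with hF
  have hFm (m : ℕ) (B : Set (S ⊕ Unit)) (hB : MeasurableSet B) :
      MeasurableSet[(pathFiltration S).predictable] (F m B) := by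
    have : F m B = ⋃ r : ℚ, Set.Ioi (Real.toNNReal r) ×ˢ {ω : PathSpace S |
        jumpTime m ω.1 ≤ (Real.toNNReal r : ℝ≥0) ∧ (ω.1 m).2 ∈ Sum.inl '' (Sum.inl ⁻¹' B)} := by
      ext ⟨t, ω⟩
      simp only [hF, mem_ofPred_eq, mem_iUnion, mem_prod, mem_Ioi]
      constructor
      · rintro ⟨h1, h2⟩
        have hne : jumpTime m ω.1 ≠ ∞ := (h1.trans ENNReal.coe_lt_top).ne
        obtain ⟨q, hq0, hq1, hq2⟩ := ENNReal.lt_iff_exists_rat_btwn.1 h1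
        refine ⟨q, by exact_mod_cast hq2, hq1.le, ?_⟩
        have hx := ne_inr_of_jumpTime_ne_top ω.2 hne
        rcases hz : (ω.1 m).2 with z | z
        · exact ⟨z, by rw [mem_preimage, ← hz]; exact h2, rfl⟩
        · exact absurd hz hx
      · rintro ⟨r, h1, h2, z, hz, hz'⟩
        exact ⟨h2.trans_lt (by exact_mod_cast h1), hz' ▸ hz⟩
    rw [this]
    refine MeasurableSet.iUnion fun r => measurableSet_predictable_Ioi_prod ?_
    exact MeasurableSpace.measurableSet_generateFrom
      ⟨m, _, _, le_rfl, measurable_inl hB, rfl⟩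
  have h0 (B : Set (S ⊕ Unit)) (hB : MeasurableSet B) :
      MeasurableSet[(pathFiltration S).predictable]
        {p : ℝ≥0 × PathSpace S | p.1 = 0 ∧ (p.2.1 0).2 ∈ B} := by
    have : {p : ℝ≥0 × PathSpace S | p.1 = 0 ∧ (p.2.1 0).2 ∈ B} =
        {⊥} ×ˢ {ω : PathSpace S | jumpTime 0 ω.1 ≤ (0 : ℝ≥0) ∧
          (ω.1 0).2 ∈ Sum.inl '' (Sum.inl ⁻¹' B)} := by
      ext ⟨t, ω⟩
      simp only [mem_ofPred_eq, mem_prod, mem_singleton_iff, bot_eq_zero]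
      refine and_congr_right fun _ => ?_
      have hx : (ω.1 0).2 ≠ Sum.inr () := ω.2.2.1
      have hT : jumpTime 0 ω.1 ≤ (0 : ℝ≥0) := by simp [jumpTime, ω.2.1]
      rcases hz : (ω.1 0).2 with z | z
      · simpa using fun _ => le_antisymm (by simpa using hT) zero_le
      · exact absurd hz hx
    rw [this]
    refine measurableSet_predictable_singleton_bot_prod ?_
    exact MeasurableSpace.measurableSet_generateFrom
      ⟨0, 0, _, le_rfl, measurable_inl hB, rfl⟩
  set N : Set (ℝ≥0 × PathSpace S) :=
    {p | p.1 = 0 ∧ (p.2.1 0).2 ∈ univ} ∪ ⋃ m, (F m univ \ F (m + 1) univ) with hN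
  have hNm : MeasurableSet[(pathFiltration S).predictable] N :=
    (h0 _ MeasurableSet.univ).union (MeasurableSet.iUnion fun m =>
      (hFm m _ MeasurableSet.univ).diff (hFm (m + 1) _ MeasurableSet.univ))
  have hset : (fun p : ℝ≥0 × PathSpace S => leftState p.1 p.2.1) ⁻¹' B =
      ({p | p.1 = 0 ∧ (p.2.1 0).2 ∈ B} ∪ ⋃ m, (F m B \ F (m + 1) univ)) ∪
        (Nᶜ ∩ {_p | Sum.inr () ∈ B}) := by
    ext ⟨t, ω⟩
    by_cases ht : t = 0
    · subst ht
      simp [hN, hF, leftState]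
    · by_cases hex : ∃ m, jumpTime m ω.1 < t ∧ (t : ℝ≥0∞) ≤ jumpTime (m + 1) ω.1
      · obtain ⟨m, h1, h2⟩ := hex
        have key : ∀ i, jumpTime i ω.1 < t → (t : ℝ≥0∞) ≤ jumpTime (i + 1) ω.1 → i = m := by
          have key : ∀ i j, jumpTime i ω.1 < t → (t : ℝ≥0∞) ≤ jumpTime (j + 1) ω.1 → i ≤ j := by
            intro i j hi hj
            by_contra hlt
            exact absurd (hj.trans (jumpTime_mono ω.1 (by omega : j + 1 ≤ i))) (not_le.2 hi)
          exact fun i hi hi' => le_antisymm (key _ _ hi h2) (key _ _ h1 hi')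
        simp only [mem_preimage, leftState_eq h1 h2, hN, hF, mem_union, mem_ofPred_eq, ht,
          false_and, mem_iUnion, Set.mem_sdiff, mem_univ, and_true, not_lt, false_or, mem_inter_iff,
          mem_compl_iff]
        constructor
        · exact fun h => Or.inl ⟨m, ⟨h1, h⟩, h2⟩
        · rintro (⟨i, ⟨hi, hB⟩, hi'⟩ | ⟨hn, -⟩)
          · rwa [key i hi hi'] at hB
          · exact absurd ⟨m, h1, h2⟩ hn
      · have hl : leftState t ω.1 = Sum.inr () := by
          classical
          unfold leftState
          rw [if_neg ht, dif_neg hex]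
        simp only [mem_preimage, hl, hN, hF, mem_union, mem_ofPred_eq, ht,
          false_and, mem_iUnion, Set.mem_sdiff, mem_univ, and_true, not_lt, false_or, mem_inter_iff,
          mem_compl_iff, hex, not_false_eq_true, true_and]
        constructor
        · exact fun h => Or.inr h
        · rintro (⟨i, ⟨hi, -⟩, hi'⟩ | h)
          · exact absurd ⟨i, hi, hi'⟩ hex
          · exact h
  rw [hset]
  refine MeasurableSet.union (MeasurableSet.union (h0 B hB) (MeasurableSet.iUnion fun m =>
      (hFm m _ hB).diff (hFm (m + 1) _ MeasurableSet.univ))) (hNm.compl.inter ?_)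
  exact MeasurableSet.const _

end Trajectories

/-- A bounded hazard rate `g` defines a probability law on `(0, ∞]`. -/
lemma lintegral_hazard {g : ℝ → ℝ≥0∞} (hg : Measurable g) {C : ℝ≥0} (hC : ∀ u, g u ≤ C) :
    (∫⁻ u in Ioi (0 : ℝ), EReal.exp (-((∫⁻ v in Ioc 0 u, g v : ℝ≥0∞) : EReal)) * g u) +
      EReal.exp (-((∫⁻ v in Ioi (0 : ℝ), g v : ℝ≥0∞) : EReal)) = 1 := by
  set f : ℝ → ℝ := fun u => (g u).toReal with hf
  have hgtop (u : ℝ) : g u ≠ ∞ := ((hC u).trans_lt ENNReal.coe_lt_top).ne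
  have hfm : Measurable f := hg.ennreal_toReal
  have hf0 (u : ℝ) : 0 ≤ f u := ENNReal.toReal_nonneg
  have hfC (u : ℝ) : f u ≤ C := ENNReal.toReal_le_coe_of_le_coe (hC u)
  have hli : LocallyIntegrable f volume := by
    refine (locallyIntegrable_const (C : ℝ)).mono hfm.aestronglyMeasurable
      (Eventually.of_forall fun u => ?_)
    rw [Real.norm_of_nonneg (hf0 u), Real.norm_of_nonneg C.coe_nonneg]
    exact hfC u
  have hii (a b : ℝ) : IntervalIntegrable f volume a b :=
    intervalIntegrable_iff.mpr ((hli.integrableOn_isCompact isCompact_uIcc).mono_set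
      uIoc_subset_uIcc)
  set F : ℝ → ℝ := fun u => ∫ v in (0 : ℝ)..u, f v with hF
  have hlF (u : ℝ) (hu : 0 ≤ u) : ∫⁻ v in Ioc 0 u, g v = ENNReal.ofReal (F u) := by
    rw [hF]
    simp only
    rw [intervalIntegral.integral_of_le hu,
      ofReal_integral_eq_lintegral_ofReal ((intervalIntegrable_iff_integrableOn_Ioc_of_le hu).1
        (hii 0 u)) (Eventually.of_forall hf0)]
    exact lintegral_congr fun v => (ENNReal.ofReal_toReal (hgtop v)).symm
  have hF0 (u : ℝ) (hu : 0 ≤ u) : 0 ≤ F u :=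
    intervalIntegral.integral_nonneg hu fun v _ => hf0 v
  set E : ℝ → ℝ := fun u => Real.exp (-F u) with hE
  have hlE (u : ℝ) (hu : 0 ≤ u) :
      EReal.exp (-((∫⁻ v in Ioc 0 u, g v : ℝ≥0∞) : EReal)) = ENNReal.ofReal (E u) := by
    rw [hlF u hu, EReal.coe_ennreal_ofReal, max_eq_left (hF0 u hu), ← EReal.coe_neg,
      EReal.exp_coe]
  have hFL : LipschitzWith C F := by
    refine LipschitzWith.of_dist_le_mul fun x y => ?_
    rw [Real.dist_eq, Real.dist_eq, hF]
    simp only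
    rw [intervalIntegral.integral_interval_sub_left (hii 0 x) (hii 0 y), ← Real.norm_eq_abs]
    refine intervalIntegral.norm_integral_le_of_norm_le_const fun v _ => ?_
    rw [Real.norm_of_nonneg (hf0 v)]
    exact hfC v
  have hexp : LipschitzOnWith 1 (fun x : ℝ => Real.exp (-x)) (Ici 0) := by
    refine (convex_Ici 0).lipschitzOnWith_of_nnnorm_hasDerivWithin_le
      (f' := fun x => - Real.exp (-x)) (fun x _ => ?_) fun x hx => ?_
    · have := ((Real.hasDerivAt_exp (-x)).comp x (hasDerivAt_neg x)).hasDerivWithinAt (s := Ici 0)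
      rw [mul_neg_one] at this
      exact this
    · rw [← NNReal.coe_le_coe]
      simpa using hx
  have hEn (n : ℕ) : (∫⁻ u in Ioc (0 : ℝ) n,
      EReal.exp (-((∫⁻ v in Ioc 0 u, g v : ℝ≥0∞) : EReal)) * g u) +
      EReal.exp (-((∫⁻ v in Ioc (0 : ℝ) n, g v : ℝ≥0∞) : EReal)) = 1 := by
    have hn : (0 : ℝ) ≤ n := n.cast_nonneg
    have hac : AbsolutelyContinuousOnInterval E 0 n := by
      refine LipschitzOnWith.absolutelyContinuousOnInterval (K := 1 * C) ?_
      refine hexp.comp (hFL.lipschitzOnWith) fun u hu => ?_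
      rw [uIcc_of_le hn] at hu
      exact hF0 u hu.1
    have hE1 : ∫ u in (0 : ℝ)..n, E u * f u = 1 - E n := by
      have h1 := hac.integral_deriv_eq_sub
      have h2 : ∫ u in (0 : ℝ)..n, deriv E u = ∫ u in (0 : ℝ)..n, -(E u * f u) := by
        refine intervalIntegral.integral_congr_ae ?_
        filter_upwards [LocallyIntegrable.ae_hasDerivAt_integral hli] with u hu _
        have := ((Real.hasDerivAt_exp (-F u)).comp u (hu 0).neg).deriv
        rw [hE]
        refine this.trans ?_
        ring
      rw [h2, intervalIntegral.integral_neg] at h1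
      have h3 : E 0 = 1 := by simp [hE, hF]
      linarith
    have hcE : Continuous E := Real.continuous_exp.comp hFL.continuous.neg
    have hint : IntervalIntegrable (fun u => E u * f u) volume 0 n :=
      (hii 0 n).continuousOn_mul hcE.continuousOn
    have hEle : E n ≤ 1 := by
      rw [hE]
      simpa using hF0 n hn
    have hE2 : ∫⁻ u in Ioc (0 : ℝ) n,
        EReal.exp (-((∫⁻ v in Ioc 0 u, g v : ℝ≥0∞) : EReal)) * g u =
        ENNReal.ofReal (1 - E n) := by
      rw [← hE1, intervalIntegral.integral_of_le hn,
        ofReal_integral_eq_lintegral_ofReal ((intervalIntegrable_iff_integrableOn_Ioc_of_le hn).1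
          hint) (Eventually.of_forall fun u => mul_nonneg (Real.exp_pos _).le (hf0 u))]
      refine setLIntegral_congr_fun measurableSet_Ioc fun u hu => ?_
      rw [hlE u hu.1.le, ENNReal.ofReal_mul (Real.exp_pos _).le, ENNReal.ofReal_toReal (hgtop u)]
    rw [hE2, hlE n hn, ← ENNReal.ofReal_add (by linarith) (Real.exp_pos _).le,
      show (1 - E n + Real.exp (-F n) : ℝ) = 1 by rw [hE]; ring, ENNReal.ofReal_one]
  have hU : ⋃ n : ℕ, Ioc (0 : ℝ) n = Ioi 0 := by
    ext x
    simp only [mem_iUnion, mem_Ioc, mem_Ioi]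
    exact ⟨fun ⟨n, h, _⟩ => h, fun h => let ⟨n, hn⟩ := exists_nat_ge x; ⟨n, h, hn⟩⟩
  have hlim (k : ℝ → ℝ≥0∞) : Tendsto (fun n : ℕ => ∫⁻ u in Ioc (0 : ℝ) n, k u) atTop
      (𝓝 (∫⁻ u in Ioi (0 : ℝ), k u)) := by
    have hm : Monotone fun n : ℕ => Ioc (0 : ℝ) n := fun m n hmn =>
      Ioc_subset_Ioc_right (by exact_mod_cast hmn)
    rw [← hU, setLIntegral_iUnion_of_directed _ hm.directed_le]
    refine tendsto_atTop_iSup fun m n hmn => ?_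
    exact lintegral_mono_set (hm hmn)
  have h1 := (hlim fun u => EReal.exp (-((∫⁻ v in Ioc 0 u, g v : ℝ≥0∞) : EReal)) * g u).add
    ((ENNReal.continuous_exp.tendsto _).comp
      ((continuous_neg.tendsto _).comp ((continuous_coe_ennreal_ereal.tendsto _).comp (hlim g))))
  refine tendsto_nhds_unique h1 ?_
  refine tendsto_const_nhds.congr fun n => ?_
  exact (hEn n).symm

namespace CTMDP

variable {S A : Type*} [MeasurableSpace S] [MeasurableSpace A]

/-- `A(x)` on the extended state space, with `A(x_∞) = {a_∞}`; here `a_∞ = Sum.inr ()`. -/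
def admExt (M : CTMDP S A) : S ⊕ Unit → Set (A ⊕ Unit)
  | Sum.inl x => Sum.inl '' M.Adm x
  | Sum.inr _ => {Sum.inr ()}

lemma measurableSet_admExt (M : CTMDP S A) (z : S ⊕ Unit) : MeasurableSet (M.admExt z) := by
  rcases z with x | x
  · exact measurableSet_inl_image.2 (measurable_prodMk_left M.measurableSet_graph)
  · have : M.admExt (Sum.inr x) = Set.range Sum.inr := by
      ext z; rcases z with z | z <;> simp [admExt]
    rw [this]
    exact measurableSet_range_inr

/-- The cost rate on the extended spaces (zero at the isolated points). -/
def costExt (M : CTMDP S A) : S ⊕ Unit → A ⊕ Unit → ℝ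
  | Sum.inl x, Sum.inl a => M.cost x a
  | _, _ => 0

/-- Randomized history-dependent policies: predictable transition probabilities
`π(da|ω,t)` on `A ∪ {a_∞}`, concentrated on `A(ξ_{t-})`. -/
structure Policy (M : CTMDP S A) where
  toFun : ℝ≥0 → PathSpace S → Measure (A ⊕ Unit)
  isProbabilityMeasure : ∀ t ω, IsProbabilityMeasure (toFun t ω)
  predictable : ∀ Γ : Set (A ⊕ Unit), MeasurableSet Γ →
    Measurable[(pathFiltration S).predictable] fun p : ℝ≥0 × PathSpace S => toFun p.1 p.2 Γ
  concentrated : ∀ t ω, toFun t ω (M.admExt (leftState t ω.1))ᶜ = 0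

/-- Measurable maps `φ` with `φ(x) ∈ A(x)` for all states `x`. -/
structure Selector (M : CTMDP S A) where
  toFun : S → A
  measurable : Measurable toFun
  mem : ∀ x, toFun x ∈ M.Adm x

/-- The deterministic stationary policy given by `φ`: at time `t` it uses the action
`φ(ξ_{t-})`, where `φ(x_∞) = a_∞`. -/
noncomputable def Selector.policy {M : CTMDP S A} (φ : M.Selector) : M.Policy where
  toFun t ω := Measure.dirac (Sum.map φ.toFun id (leftState t ω.1))
  isProbabilityMeasure _ _ := inferInstance
  predictable Γ hΓ := by
    have h1 : Measurable (Sum.map φ.toFun (id : Unit → Unit)) :=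
      Measurable.sumMap φ.measurable measurable_id
    have h2 := (Measure.measurable_coe hΓ).comp
      (Measure.measurable_dirac.comp (h1.comp measurable_leftState))
    exact h2
  concentrated t ω := by
    rw [Measure.dirac_apply' _ (M.measurableSet_admExt _).compl, indicator_of_notMem]
    rcases leftState t ω.1 with x | x
    · simp [admExt, φ.mem x]
    · simp [admExt]

section Law

lemma q_compl_nonneg (M : CTMDP S A) (x : S) (a : A) :
    VectorMeasure.restrict 0 {x}ᶜ ≤ (M.q x a).restrict {x}ᶜ := by
  refine VectorMeasure.restrict_le_restrict_of_subset_le _ _ fun Γ hΓ hsub => ?_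
  by_cases ha : a ∈ M.Adm x
  · exact M.q_nonneg x a ha Γ hΓ fun hx => hsub hx rfl
  · simp [M.q_off x a ha]

lemma measurable_q_diff (M : CTMDP S A) {D : Set (S × S)} (hD : MeasurableSet D) :
    Measurable fun p : S × A => M.q p.1 p.2 (Prod.mk p.1 ⁻¹' D) := by
  have huniv : ∀ x a, M.q x a univ = 0 := fun x a => by
    by_cases ha : a ∈ M.Adm x
    · exact M.q_conservative x a ha
    · simp [M.q_off x a ha]
  induction D, hD using MeasurableSpace.induction_on_inter generateFrom_prod.symm
    isPiSystem_prod with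
  | empty => simp
  | basic t ht =>
    obtain ⟨B, hB, Γ, hΓ, rfl⟩ := ht
    classical
    have : (fun p : S × A => M.q p.1 p.2 (Prod.mk p.1 ⁻¹' B ×ˢ Γ)) =
        fun p => if p.1 ∈ B then M.q p.1 p.2 Γ else 0 := by
      ext p
      by_cases hp : p.1 ∈ B <;> simp [hp, mk_preimage_prod_right]
    rw [this]
    exact Measurable.ite (measurable_fst hB) (M.measurable_q Γ hΓ) measurable_const
  | compl t ht ih =>
    have : (fun p : S × A => M.q p.1 p.2 (Prod.mk p.1 ⁻¹' tᶜ)) =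
        fun p => - M.q p.1 p.2 (Prod.mk p.1 ⁻¹' t) := by
      ext p
      have h2 := VectorMeasure.of_add_of_sdiff (v := M.q p.1 p.2)
        (measurable_prodMk_left (x := p.1) ht) MeasurableSet.univ (subset_univ _)
      rw [huniv, ← compl_eq_univ_sdiff] at h2
      rw [preimage_compl]
      linarith
    rw [this]
    exact ih.neg
  | iUnion f hdisj hf ih =>
    refine measurable_of_tendsto_metrizable (f := fun n (p : S × A) =>
      ∑ i ∈ Finset.range n, M.q p.1 p.2 (Prod.mk p.1 ⁻¹' f i))
      (fun n => Finset.measurable_sum _ fun i _ => ih i) ?_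
    rw [tendsto_pi_nhds]
    intro p
    rw [preimage_iUnion]
    exact ((M.q p.1 p.2).m_iUnion (fun i => measurable_prodMk_left (hf i))
      (fun i j hij => (hdisj hij).preimage _)).tendsto_sum_nat

variable [StandardBorelSpace S]

/-- The jump rate measure `Γ ↦ q(Γ \ {x} | x, a)`. -/
noncomputable def jumpRate (M : CTMDP S A) (x : S) (a : A) : Measure S :=
  (M.q x a).toMeasureOfZeroLE {x}ᶜ (measurableSet_singleton x).compl (M.q_compl_nonneg x a)

lemma jumpRate_apply (M : CTMDP S A) (x : S) (a : A) {Γ : Set S} (hΓ : MeasurableSet Γ) :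
    M.jumpRate x a Γ = ENNReal.ofReal (M.q x a (Γ \ {x})) := by
  unfold jumpRate
  rw [SignedMeasure.toMeasureOfZeroLE_apply _ _ _ hΓ, ENNReal.ofReal]
  congr 1
  rw [show Γ \ {x} = {x}ᶜ ∩ Γ by rw [sdiff_eq, inter_comm]]
  refine Subtype.ext (Real.coe_toNNReal _ ?_).symm
  exact VectorMeasure.nonneg_of_zero_le_restrict _
    (VectorMeasure.zero_le_restrict_subset _ (measurableSet_singleton x).compl
      inter_subset_left (M.q_compl_nonneg x a))

/-- The jump rates are bounded by `sup_{a ∈ A(x)} q_x(a)`. -/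
lemma exists_jumpRate_le (M : CTMDP S A) (x : S) :
    ∃ C : ℝ≥0, ∀ a, M.jumpRate x a univ ≤ C := by
  obtain ⟨C, hC⟩ := M.q_stable x
  refine ⟨C.toNNReal, fun a => ?_⟩
  rw [M.jumpRate_apply x a MeasurableSet.univ]
  by_cases ha : a ∈ M.Adm x
  · refine ENNReal.ofReal_le_ofReal ?_
    have h1 := hC (mem_image_of_mem _ ha)
    have h2 := VectorMeasure.of_add_of_sdiff (v := M.q x a) (measurableSet_singleton x)
      MeasurableSet.univ (subset_univ _)
    rw [M.q_conservative x a ha] at h2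
    linarith
  · simp [M.q_off x a ha]

/-- The jump rate on the extended spaces; no jumps occur at the isolated points. -/
noncomputable def rateExt (M : CTMDP S A) : S ⊕ Unit → A ⊕ Unit → Measure S
  | Sum.inl x, Sum.inl a => M.jumpRate x a
  | _, _ => 0

lemma measurable_rateExt (M : CTMDP S A) :
    Measurable fun p : (S ⊕ Unit) × (A ⊕ Unit) => M.rateExt p.1 p.2 := by
  refine Measure.measurable_of_measurable_coe _ fun Γ hΓ => ?_
  have hemb : MeasurableEmbedding (Prod.map Sum.inl Sum.inl : S × A → (S ⊕ Unit) × (A ⊕ Unit)) :=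
    
    MeasurableEmbedding.prodMap ⟨Sum.inl_injective, measurable_inl, fun _ hs => measurableSet_inl_image.2 hs⟩
      ⟨Sum.inl_injective, measurable_inl, fun _ hs => measurableSet_inl_image.2 hs⟩
  have hg : Measurable fun p : S × A => M.jumpRate p.1 p.2 Γ := by
    have : (fun p : S × A => M.jumpRate p.1 p.2 Γ) = fun p => ENNReal.ofReal
        (M.q p.1 p.2 (Prod.mk p.1 ⁻¹' ({z : S × S | z.2 ∈ Γ} \ {z | z.2 = z.1}))) := by
      ext p
      rw [M.jumpRate_apply _ _ hΓ]
      rfl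
    rw [this]
    exact (M.measurable_q_diff ((measurable_snd hΓ).diff
      (measurableSet_eq_fun measurable_snd measurable_fst))).ennreal_ofReal
  convert! hemb.measurable_extend hg (measurable_const (a := (0 : ℝ≥0∞))) using 1
  ext ⟨z, b⟩
  rcases z with x | x
  · rcases b with a | a
    · exact (hemb.injective.extend_apply (fun p : S × A => M.jumpRate p.1 p.2 Γ) _ (x, a)).symm
    · rw [Function.extend_apply' _ _ _ (by rintro ⟨⟨x', a'⟩, h⟩; simp at h)]
      simp [rateExt]
  · rw [Function.extend_apply' _ _ _ (by rintro ⟨⟨x', a'⟩, h⟩; simp at h)]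
    simp [rateExt]

lemma exists_rateExt_le (M : CTMDP S A) (z : S ⊕ Unit) :
    ∃ C : ℝ≥0, ∀ b, M.rateExt z b univ ≤ C := by
  rcases z with x | x
  · obtain ⟨C, hC⟩ := M.exists_jumpRate_le x
    refine ⟨C, fun b => ?_⟩
    rcases b with a | a
    · exact hC a
    · simp [rateExt]
  · exact ⟨0, fun b => by simp [rateExt]⟩

/-- A policy as a measurable function on `[0, ∞)` times all sequences of entries (the value at the
sequences that are not in the sample space is irrelevant). -/
noncomputable def Policy.ext {M : CTMDP S A} (π : M.Policy) (p : ℝ≥0 × (ℕ → Entry S)) :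
    Measure (A ⊕ Unit) :=
  open Classical in if h : IsPath p.2 then π.toFun p.1 ⟨p.2, h⟩ else Measure.dirac (Sum.inr ())

lemma Policy.measurable_ext {M : CTMDP S A} (π : M.Policy) : Measurable π.ext := by
  classical
  have hs : MeasurableSet {p : ℝ≥0 × (ℕ → Entry S) | IsPath p.2} :=
    measurable_snd measurableSet_isPath
  have hf : Measurable fun p : {p : ℝ≥0 × (ℕ → Entry S) | IsPath p.2} =>
      π.toFun p.1.1 ⟨p.1.2, p.2⟩ := by
    refine Measure.measurable_of_measurable_coe _ fun Γ hΓ => ?_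
    exact ((π.predictable Γ hΓ).mono predictable_le le_rfl).comp
      ((measurable_fst.comp measurable_subtype_coe).prodMk
        ((measurable_snd.comp measurable_subtype_coe).subtype_mk))
  exact Measurable.dite hf (g := fun _ => Measure.dirac (Sum.inr ())) measurable_const hs

instance {M : CTMDP S A} (π : M.Policy) (p : ℝ≥0 × (ℕ → Entry S)) :
    IsProbabilityMeasure (π.ext p) := by
  unfold Policy.ext
  split_ifs with h
  · exact π.isProbabilityMeasure _ _
  · infer_instance

/-- Finite histories `(0, x₀), (θ₁, x₁), …, (θ_n, x_n)`. -/
abbrev Hist (S : Type*) (n : ℕ) : Type _ := (Finset.Iic n) → Entry S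

/-- The history `h` continued by `(∞, x_∞), (∞, x_∞), …`. -/
def Hist.continue {S : Type*} {n : ℕ} (h : Hist S n) : ℕ → Entry S :=
  fun k => if hk : k ∈ Finset.Iic n then h ⟨k, hk⟩ else (∞, Sum.inr ())

lemma Hist.measurable_continue {n : ℕ} : Measurable (Hist.continue (S := S) (n := n)) := by
  refine measurable_pi_lambda _ fun k => ?_
  unfold Hist.continue
  split_ifs with hk
  · exact measurable_pi_apply _
  · exact measurable_const

/-- The jump intensity after the `n`-th jump,
`Λⁿ(dy|h, u) = ∫_A π(da|h, T_n + u) q(dy \ {x_n}|x_n, a)`. A predictable `π(·|ω,t)` depends for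
`T_n < t ≤ T_{n+1}` on `ω` only through `(x₀, θ₁, …, θ_n, x_n)`, so that it may be evaluated at
the trajectory that makes no jump after the history `h`. -/
noncomputable def intensity {M : CTMDP S A} (π : M.Policy) (n : ℕ) (h : Hist S n) (u : ℝ) :
    Measure S :=
  (π.ext ((jumpTime n h.continue).toNNReal + u.toNNReal, h.continue)).bind
    (M.rateExt (h.continue n).2)

lemma measurable_intensity {M : CTMDP S A} (π : M.Policy) (n : ℕ) :
    Measurable fun p : Hist S n × ℝ => intensity π n p.1 p.2 := by
  have h1 : Measurable fun p : Hist S n × ℝ => p.1.continue :=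
    Hist.measurable_continue.comp measurable_fst
  have h2 : Measurable fun p : Hist S n × ℝ =>
      ((jumpTime n p.1.continue).toNNReal + p.2.toNNReal, p.1.continue) :=
    ((((measurable_jumpTime n).comp h1).ennreal_toNNReal).add
      measurable_snd.real_toNNReal).prodMk h1
  have h3 : Measurable fun p : Hist S n × ℝ => (p.1.continue n).2 :=
    measurable_snd.comp ((measurable_pi_apply n).comp h1)
  let κ : Kernel (Hist S n × ℝ) (A ⊕ Unit) := ⟨_, π.measurable_ext.comp h2⟩
  have : IsMarkovKernel κ := ⟨fun p => inferInstanceAs (IsProbabilityMeasure (π.ext _))⟩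
  refine Measure.measurable_of_measurable_coe _ fun Γ hΓ => ?_
  have h4 (z : S ⊕ Unit) : Measurable (M.rateExt z) :=
    M.measurable_rateExt.comp measurable_prodMk_left
  have h5 : (fun p : Hist S n × ℝ => intensity π n p.1 p.2 Γ) = fun p =>
      ∫⁻ b, M.rateExt (p.1.continue n).2 b Γ ∂(κ p) := by
    ext p
    exact Measure.bind_apply hΓ (h4 _).aemeasurable
  rw [h5]
  refine Measurable.lintegral_kernel_prod_right (κ := κ)
    (f := fun p b => M.rateExt (p.1.continue n).2 b Γ) ?_
  exact (Measure.measurable_coe hΓ).comp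
    (M.measurable_rateExt.comp ((h3.comp measurable_fst).prodMk measurable_snd))

lemma exists_intensity_le {M : CTMDP S A} (π : M.Policy) (n : ℕ) (h : Hist S n) :
    ∃ C : ℝ≥0, ∀ u, intensity π n h u univ ≤ C := by
  obtain ⟨C, hC⟩ := M.exists_rateExt_le (h.continue n).2
  refine ⟨C, fun u => ?_⟩
  have h4 (z : S ⊕ Unit) : Measurable (M.rateExt z) :=
    M.measurable_rateExt.comp measurable_prodMk_left
  unfold intensity
  rw [Measure.bind_apply MeasurableSet.univ (h4 _).aemeasurable]
  refine (lintegral_mono hC).trans ?_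
  simp

/-- The probability `exp(-∫₀ᵘ Λⁿ(S|h, v) dv)` of no jump during the time `u` after the history. -/
noncomputable def survival {M : CTMDP S A} (π : M.Policy) (n : ℕ) (h : Hist S n) (u : ℝ) : ℝ≥0∞ :=
  EReal.exp (-((∫⁻ v in Ioc 0 u, intensity π n h v univ : ℝ≥0∞) : EReal))

/-- The probability `exp(-∫₀^∞ Λⁿ(S|h, v) dv)` of no further jump after the history. -/
noncomputable def survivalTop {M : CTMDP S A} (π : M.Policy) (n : ℕ) (h : Hist S n) : ℝ≥0∞ :=
  EReal.exp (-((∫⁻ v in Ioi (0 : ℝ), intensity π n h v univ : ℝ≥0∞) : EReal))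

/-- The conditional law of `(θ_{n+1}, x_{n+1})` given the history `h`: it is
`Λⁿ(dy|h, u) exp(-∫₀ᵘ Λⁿ(S|h, v) dv) du` on `(0, ∞) × S`, and has the mass
`exp(-∫₀^∞ Λⁿ(S|h, v) dv)` at `(∞, x_∞)`. (After `x_n = x_∞` the intensity is zero, and
the next entry is `(∞, x_∞)`.) -/
noncomputable def nextEntryLaw {M : CTMDP S A} (π : M.Policy) (n : ℕ) (h : Hist S n) :
    Measure (Entry S) :=
  ((volume.restrict (Ioi (0 : ℝ))).bind fun u =>
    survival π n h u • (intensity π n h u).map fun y => (ENNReal.ofReal u, Sum.inl y)) +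
  survivalTop π n h • Measure.dirac (∞, Sum.inr ())

lemma measurable_intensity_univ {M : CTMDP S A} (π : M.Policy) (n : ℕ) :
    Measurable fun p : Hist S n × ℝ => intensity π n p.1 p.2 univ :=
  (Measure.measurable_coe MeasurableSet.univ).comp (measurable_intensity π n)

lemma measurable_exp_neg {X : Type*} [MeasurableSpace X] {f : X → ℝ≥0∞} (hf : Measurable f) :
    Measurable fun x => EReal.exp (-((f x : ℝ≥0∞) : EReal)) :=
  EReal.measurable_exp.comp hf.coe_ereal_ennreal.neg

lemma measurable_survival {M : CTMDP S A} (π : M.Policy) (n : ℕ) :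
    Measurable fun p : Hist S n × ℝ => survival π n p.1 p.2 := by
  have h0 : Measurable fun p : (Hist S n × ℝ) × ℝ => (p.1.1, p.2) :=
    (measurable_fst.comp measurable_fst).prodMk measurable_snd
  have h1 := (measurable_intensity_univ π n).comp h0
  simp only [Function.comp_def] at h1
  have hs : MeasurableSet {p : (Hist S n × ℝ) × ℝ | 0 < p.2 ∧ p.2 ≤ p.1.2} :=
    (measurableSet_lt measurable_const measurable_snd).inter
      (measurableSet_le measurable_snd (measurable_snd.comp measurable_fst))
  have h2 : Measurable fun p : Hist S n × ℝ =>
      ∫⁻ v in Ioc 0 p.2, intensity π n p.1 v univ := by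
    have h3 : (fun p : Hist S n × ℝ => ∫⁻ v in Ioc 0 p.2, intensity π n p.1 v univ) =
        fun p => ∫⁻ v, {p : (Hist S n × ℝ) × ℝ | 0 < p.2 ∧ p.2 ≤ p.1.2}.indicator
          (fun p : (Hist S n × ℝ) × ℝ => intensity π n p.1.1 p.2 univ) (p, v) := by
      funext p
      rw [← lintegral_indicator measurableSet_Ioc]
      refine lintegral_congr fun v => ?_
      simp only [indicator_apply, mem_Ioc, mem_ofPred_eq]
    rw [h3]
    exact (h1.indicator hs).lintegral_prod_right' (ν := volume)
  unfold survival
  exact measurable_exp_neg h2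

lemma measurable_survivalTop {M : CTMDP S A} (π : M.Policy) (n : ℕ) :
    Measurable fun h : Hist S n => survivalTop π n h := by
  have h1 : Measurable fun p : Hist S n × ℝ => intensity π n p.1 p.2 univ :=
    (Measure.measurable_coe MeasurableSet.univ).comp (measurable_intensity π n)
  have h2 : Measurable fun h : Hist S n => ∫⁻ v in Ioi (0 : ℝ), intensity π n h v univ :=
    h1.lintegral_prod_right' (ν := volume.restrict (Ioi (0 : ℝ)))
  unfold survivalTop
  exact measurable_exp_neg h2

lemma measurable_mark (u : ℝ) :
    Measurable fun y : S => ((ENNReal.ofReal u, Sum.inl y) : Entry S) :=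
  measurable_const.prodMk measurable_inl

lemma measurable_density {M : CTMDP S A} (π : M.Policy) (n : ℕ) :
    Measurable fun p : Hist S n × ℝ => survival π n p.1 p.2 •
      (intensity π n p.1 p.2).map fun y => ((ENNReal.ofReal p.2, Sum.inl y) : Entry S) := by
  have hfin (p : Hist S n × ℝ) : IsFiniteMeasure (intensity π n p.1 p.2) := by
    obtain ⟨C, hC⟩ := exists_intensity_le π n p.1
    exact ⟨(hC p.2).trans_lt ENNReal.coe_lt_top⟩
  have hmap : Measurable fun p : Hist S n × ℝ =>
      (intensity π n p.1 p.2).map fun y => ((ENNReal.ofReal p.2, Sum.inl y) : Entry S) := by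
    refine Measurable.measure_of_isPiSystem generateFrom_prod.symm isPiSystem_prod ?_ ?_
    · rintro _ ⟨B, hB, Γ, hΓ, rfl⟩
      replace hB : MeasurableSet B := hB
      replace hΓ : MeasurableSet Γ := hΓ
      classical
      have : (fun p : Hist S n × ℝ => ((intensity π n p.1 p.2).map
          fun y => ((ENNReal.ofReal p.2, Sum.inl y) : Entry S)) (B ×ˢ Γ)) = fun p =>
          if ENNReal.ofReal p.2 ∈ B then intensity π n p.1 p.2 (Sum.inl ⁻¹' Γ) else 0 := by
        ext p
        rw [Measure.map_apply (measurable_mark p.2) (hB.prod hΓ)]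
        by_cases hp : ENNReal.ofReal p.2 ∈ B
        · rw [if_pos hp]
          congr 1
          ext y
          simp [hp]
        · rw [if_neg hp]
          convert! measure_empty (μ := intensity π n p.1 p.2)
          ext y
          simp [hp]
      rw [this]
      exact Measurable.ite (measurable_snd.ennreal_ofReal hB)
        ((Measure.measurable_coe (measurable_inl hΓ)).comp (measurable_intensity π n))
        measurable_const
    · have : (fun p : Hist S n × ℝ => ((intensity π n p.1 p.2).map
          fun y => ((ENNReal.ofReal p.2, Sum.inl y) : Entry S)) univ) = fun p =>
          intensity π n p.1 p.2 univ := by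
        ext p
        rw [Measure.map_apply (measurable_mark p.2) MeasurableSet.univ, preimage_univ]
      rw [this]
      exact (Measure.measurable_coe MeasurableSet.univ).comp (measurable_intensity π n)
  refine Measure.measurable_of_measurable_coe _ fun Γ hΓ => ?_
  exact (measurable_survival π n).mul ((Measure.measurable_coe hΓ).comp hmap)

lemma measurable_density' {M : CTMDP S A} (π : M.Policy) (n : ℕ) (h : Hist S n) :
    Measurable fun u : ℝ => survival π n h u •
      (intensity π n h u).map fun y => ((ENNReal.ofReal u, Sum.inl y) : Entry S) :=
  (measurable_density π n).comp measurable_prodMk_left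

/-- The conditional laws form a stochastic kernel. -/
noncomputable def nextEntryKernel {M : CTMDP S A} (π : M.Policy) (n : ℕ) :
    Kernel (Hist S n) (Entry S) where
  toFun := nextEntryLaw π n
  measurable' := by
    refine Measure.measurable_of_measurable_coe _ fun Γ hΓ => ?_
    have h1 : Measurable fun p : Hist S n × ℝ => (survival π n p.1 p.2 •
      (intensity π n p.1 p.2).map fun y => ((ENNReal.ofReal p.2, Sum.inl y) : Entry S)) Γ :=
      (Measure.measurable_coe hΓ).comp (measurable_density π n)
    have h2 := h1.lintegral_prod_right' (ν := volume.restrict (Ioi (0 : ℝ)))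
    have h3 : (fun h => nextEntryLaw π n h Γ) = fun h => (∫⁻ u in Ioi (0 : ℝ),
        (survival π n h u • (intensity π n h u).map
          fun y => ((ENNReal.ofReal u, Sum.inl y) : Entry S)) Γ) +
        survivalTop π n h * Measure.dirac ((∞, Sum.inr ()) : Entry S) Γ := by
      ext h
      unfold nextEntryLaw
      rw [Measure.add_apply, Measure.bind_apply hΓ (measurable_density' π n h).aemeasurable]
      rfl
    rw [h3]
    exact h2.add ((measurable_survivalTop π n).mul_const _)

instance {M : CTMDP S A} (π : M.Policy) (n : ℕ) : IsMarkovKernel (nextEntryKernel π n) := by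
  refine ⟨fun h => ⟨?_⟩⟩
  show nextEntryLaw π n h univ = 1
  obtain ⟨C, hC⟩ := exists_intensity_le π n h
  have h0 : Measurable fun u : ℝ => (h, u) := measurable_prodMk_left
  have hg := (measurable_intensity_univ π n).comp h0
  simp only [Function.comp_def] at hg
  have h1 : nextEntryLaw π n h univ =
      (∫⁻ u in Ioi (0 : ℝ), survival π n h u * intensity π n h u univ) + survivalTop π n h := by
    unfold nextEntryLaw
    rw [Measure.add_apply,
      Measure.bind_apply MeasurableSet.univ (measurable_density' π n h).aemeasurable,
      Measure.smul_apply, measure_univ, smul_eq_mul, mul_one]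
    congr 1
    refine lintegral_congr fun u => ?_
    rw [Measure.smul_apply, Measure.map_apply (measurable_mark u) MeasurableSet.univ,
      preimage_univ, smul_eq_mul]
  rw [h1]
  unfold survival survivalTop
  exact lintegral_hazard hg hC

/-- The law `P_γ^π` on the sample space: the initial state has the law `γ`, and the conditional
law of each entry given the preceding ones is `nextEntryLaw` (Ionescu-Tulcea). It is first built
on the space of all sequences of entries and then restricted to the sample space. -/
noncomputable def pathLaw {M : CTMDP S A} (π : M.Policy) (γ : Measure S) :
    Measure (PathSpace S) :=
  ((γ.map fun x => (fun _ => (0, Sum.inl x) : Hist S 0)).bind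
    (Kernel.traj (X := fun _ => Entry S) (nextEntryKernel π) 0)).comap Subtype.val

/-- The expected total discounted integral
`E_γ^π [∫₀^∞ e^{-αt} ∫_A f(ξ_{t-}, a) π(da|ω,t) dt]` of a nonnegative function. -/
noncomputable def discounted {M : CTMDP S A} (π : M.Policy) (γ : Measure S) (α : ℝ)
    (f : S ⊕ Unit → A ⊕ Unit → ℝ≥0∞) : ℝ≥0∞ :=
  ∫⁻ ω, (∫⁻ t in Ioi (0 : ℝ), ENNReal.ofReal (Real.exp (-α * t)) *
    (∫⁻ a, f (leftState t.toNNReal ω.1) a ∂(π.toFun t.toNNReal ω))) ∂(pathLaw π γ)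

/-- The performance functional
`V₀(π) = E_γ^π [∫₀^∞ e^{-αt} ∫_A c₀(ξ_{t-}, a) π(da|ω,t) dt]`, with values in `(-∞, ∞]` as soon as
the part from the negative costs is finite (otherwise the value is `-∞`). -/
noncomputable def value (M : CTMDP S A) (γ : Measure S) (α : ℝ) (π : M.Policy) : EReal :=
  ((discounted π γ α fun z b => ENNReal.ofReal (M.costExt z b) : ℝ≥0∞) : EReal) -
    ((discounted π γ α fun z b => ENNReal.ofReal (-M.costExt z b) : ℝ≥0∞) : EReal)

/-- The optimal value over all randomized history-dependent policies. -/
noncomputable def optimalValue (M : CTMDP S A) (γ : Measure S) (α : ℝ) : EReal :=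
  ⨅ π : M.Policy, M.value γ α π

end Law

/-- `∫_S u(y) q(dy|x,a)`. -/
noncomputable def qInt (M : CTMDP S A) (x : S) (a : A) (u : S → ℝ) : ℝ :=
  ∫ᵛ y, u y ∂•(M.q x a)

/-- `q̄_x = sup_{a ∈ A(x)} q_x(a)`, where `q_x(a) = -q({x}|x,a)`. -/
noncomputable def qBar (M : CTMDP S A) (x : S) : ℝ := sSup ((fun a => -(M.q x a {x})) '' M.Adm x)

/-- The measurable functions with a finite `w`-weighted norm `sup_x |u(x)|/w(x)`. -/
def MemWeighted (w u : S → ℝ) : Prop :=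
  Measurable u ∧ BddAbove (Set.range fun x => |u x| / w x)

/-- The Lyapunov drift condition `∫ w(y) q(dy|x,a) ≤ ρ w(x) + b` on admissible pairs, including the
existence of the integrals, for a measurable weight function `w ≥ 1` and `ρ, b ≥ 0`. -/
structure Drift (M : CTMDP S A) (w : S → ℝ) (ρ b : ℝ) : Prop where
  measurable : Measurable w
  one_le : ∀ x, 1 ≤ w x
  rho_nonneg : 0 ≤ ρ
  b_nonneg : 0 ≤ b
  integrable : ∀ x, ∀ a ∈ M.Adm x, (M.q x a).Integrable w
  drift : ∀ x, ∀ a ∈ M.Adm x, M.qInt x a w ≤ ρ * w x + b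

/-- The Lyapunov-type condition for non-explosion: the drift condition, and an increasing system of
measurable sets `S_l` with union `S` such that `inf_{S \ S_l} w → ∞` (the infimum over the empty
set is `∞`) and `q̄` is bounded on each `S_l`. -/
structure Regular (M : CTMDP S A) (w : S → ℝ) (ρ b : ℝ) : Prop extends Drift M w ρ b where
  exhaustion : ∃ Sl : ℕ → Set S, Monotone Sl ∧ (∀ l, MeasurableSet (Sl l)) ∧ ⋃ l, Sl l = univ ∧
    Tendsto (fun l => ⨅ x ∈ (Sl l)ᶜ, ((w x : ℝ) : EReal)) atTop (𝓝 ⊤) ∧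
    ∀ l, BddAbove (M.qBar '' Sl l)

/-- The conditions on the second weight function `w'`:
`(q̄_x + 1) w'(x) ≤ L' w(x)`, the drift condition, `α > ρ'`, and
`|inf_{a ∈ A(x)} c₀(x,a)| ≤ M' w'(x) + c'`. -/
structure SecondWeight (M : CTMDP S A) (α : ℝ) (w w' : S → ℝ) (L' ρ' b' M' c' : ℝ) : Prop
    extends Drift M w' ρ' b' where
  L_nonneg : 0 ≤ L'
  dominated : ∀ x, (M.qBar x + 1) * w' x ≤ L' * w x
  rho_lt : ρ' < α
  M_nonneg : 0 ≤ M'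
  c_nonneg : 0 ≤ c'
  cost_bddBelow : ∀ x, BddBelow (M.cost x '' M.Adm x)
  abs_sInf_cost_le : ∀ x, |sInf (M.cost x '' M.Adm x)| ≤ M' * w' x + c'

/-- The compactness-continuity conditions. -/
structure CompactContinuous [TopologicalSpace A] (M : CTMDP S A) (w : S → ℝ) : Prop where
  lsc_qInt : ∀ u : S → ℝ, Measurable u → (∀ y, 0 ≤ u y) → BddAbove (Set.range u) →
    ∀ x, LowerSemicontinuousOn (fun a => M.qInt x a u) (M.Adm x)
  continuous_qInt : ∀ x, ContinuousOn (fun a => M.qInt x a w) (M.Adm x)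
  lsc_cost : ∀ x, LowerSemicontinuousOn (M.cost x) (M.Adm x)
  isCompact_adm : ∀ x, IsCompact (M.Adm x)

/-- The Bellman equation `α u(x) = inf_{a ∈ A(x)} {c₀(x,a) + ∫ q(dy|x,a) u(y)}`, all `x ∈ S`. -/
def Bellman (M : CTMDP S A) (α : ℝ) (u : S → ℝ) : Prop :=
  ∀ x, IsGLB ((fun a => M.cost x a + M.qInt x a u) '' M.Adm x) (α * u x)

/-- The value iteration: `u⁽⁰⁾(x) = m (α w(x) + b) / (α (α - ρ)) + c / α` and
`u⁽ⁿ⁺¹⁾(x) = inf_{a ∈ A(x)} {c₀(x,a) / (α + 1 + q̄_x) +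
  (1 + q̄_x) / (α + 1 + q̄_x) ∫ u⁽ⁿ⁾(y) (q(dy|x,a) / (1 + q̄_x) + I{x ∈ dy})}`. -/
noncomputable def iterate (M : CTMDP S A) (α : ℝ) (w : S → ℝ) (m c ρ b : ℝ) : ℕ → S → ℝ
  | 0 => fun x => m * (α * w x + b) / (α * (α - ρ)) + c / α
  | n + 1 => fun x => sInf ((fun a => M.cost x a / (α + 1 + M.qBar x) +
      (1 + M.qBar x) / (α + 1 + M.qBar x) *
        (M.qInt x a (iterate M α w m c ρ b n) / (1 + M.qBar x) + iterate M α w m c ρ b n x)) ''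
      M.Adm x)

/-- Feasibility for the dual linear program with the weight `w`. -/
def DualFeasible (M : CTMDP S A) (α : ℝ) (w v : S → ℝ) : Prop :=
  MemWeighted w v ∧
    ∀ x, ∀ a ∈ M.Adm x, 0 ≤ 1 / α * M.cost x a - v x + 1 / α * M.qInt x a v

/-- `v` solves the dual linear program: it maximizes `∫ γ(dy) v(y)` over the feasible functions. -/
def DualOptimal (M : CTMDP S A) (γ : Measure S) (α : ℝ) (w v : S → ℝ) : Prop :=
  M.DualFeasible α w v ∧ ∀ v', M.DualFeasible α w v' → ∫ y, v' y ∂γ ≤ ∫ y, v y ∂γ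

end CTMDP

/-! A policy enters $V_0$ only through its discounted occupation measure $\eta=\sum_n\eta_n$ on
$S\times A$, where $\eta_n$ collects the time between the $n$-th and the next jump. Put
$D_n(f)=E[e^{-\alpha T_n}f(x_n)]$ for $f\ge 0$, with $f(x_\infty)=0$. Given the history, the law of
the next jump killed at rate $\alpha$ has total mass one, so
$D_n(f)=\int(\alpha+q_x(a))f(x)\,d\eta_n$. The jump itself gives $D_{n+1}(f)=\int\int
f(y)\,q(dy\setminus\{x\}|x,a)\,d\eta_n$. Summing over $n$ yields the balance equation
`lintegral_totalOccupation_balance`, an identity in $[0,\infty]$.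

The drift condition, summed along the same recursion, makes $w$ integrable for $\eta$. Since $(\bar
q+1)w'\le L'w$, both sides of the balance equation are then finite for $f$ bounded by a multiple of
$w'$. They may be subtracted, which gives Dynkin's formula $\int(\alpha v-qv)\,d\eta=\int
v\,d\gamma$ for $v\in\mathbf B_{w'}(S)$ (`dynkin`).

The verification argument is now short. If $\alpha v\le c_0+qv$ on $K$, then $\int v\,d\gamma\le
V_0(\pi)$ for every policy (`SecondWeight.integral_le_value`), with equality for a selector that
attains equality (`SecondWeight.value_policy`). Taking $\gamma=\delta_x$ shows that every
subsolution lies below every solution at every point (`Bellman.le_of_subsolution`). This gives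
uniqueness. The dual program is also settled, because its feasible functions are exactly the
subsolutions in $\mathbf B_{w'}(S)$.

Existence comes from value iteration (`CompactContinuous.exists_tendsto_iterate`). The iteration
operator is monotone because of the added multiple of $v(x)$. The function $u^{(0)}$ is a
supersolution and $-u^{(0)}$ a subsolution, so the iterates decrease and stay bounded below. The
limit solves the equation by dominated convergence.

Measurable minima and minimizers rest on `MeasurableSet.projection_of_isCompact_section`: a Borel
set with compact sections has a Borel projection. Its source is Novikov's separation theorem,
through the structure of Borel sets with open sections. -/

/-! ### Separation of analytic sets and projections of Borel sets with compact sections -/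

section DescriptiveSetTheory

/-- A sequence of sets is Borel separated if the sets are contained in measurable sets with empty
intersection. -/
def BorelSeparated {α : Type*} [MeasurableSpace α] (A : ℕ → Set α) : Prop :=
  ∃ B : ℕ → Set α, (∀ n, A n ⊆ B n) ∧ (∀ n, MeasurableSet (B n)) ∧ ⋂ n, B n = ∅

/-- Separators of the refined sequences combine by a union at the index $k$ and intersections at all
other indices. A point in all the combined sets lies in the $k$-th separator for some $j$, hence in
every separator for that same $j$, which is impossible. -/
lemma BorelSeparated.of_split {α : Type*} [MeasurableSpace α] {A : ℕ → Set α} (k : ℕ)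
    {A' : ℕ → ℕ → Set α} (hk : A k ⊆ ⋃ j, A' j k) (hne : ∀ n, n ≠ k → ∀ j, A n ⊆ A' j n)
    (h : ∀ j, BorelSeparated (A' j)) : BorelSeparated A := by
  choose B hAB hB hemp using h
  classical
  refine ⟨fun n => if n = k then ⋃ j, B j n else ⋂ j, B j n, fun n => ?_, fun n => ?_, ?_⟩
  · by_cases hn : n = k
    · subst hn
      simp only [if_true]
      exact hk.trans (iUnion_mono fun j => hAB j n)
    · simp only [hn, if_false]
      exact subset_iInter fun j => (hne n hn j).trans (hAB j n)
  · dsimp only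
    split_ifs
    · exact MeasurableSet.iUnion fun j => hB j n
    · exact MeasurableSet.iInter fun j => hB j n
  · refine eq_empty_of_forall_notMem fun z hz => ?_
    rw [mem_iInter] at hz
    have hzk := hz k
    simp only [if_true, mem_iUnion] at hzk
    obtain ⟨j, hj⟩ := hzk
    have : z ∈ ⋂ n, B j n := by
      refine mem_iInter.2 fun n => ?_
      by_cases hn : n = k
      · exact hn ▸ hj
      · have := hz n
        simp only [hn, if_false, mem_iInter] at this
        exact this j
    rw [hemp] at this
    exact this

/-- A branch of the tree of finite sequences along which a property of finite sequences persists. -/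
lemma exists_branch {P : ℕ → (ℕ → ℕ) → Prop} (h0 : P 0 fun _ => 0)
    (hloc : ∀ k a b, (∀ m < k, a m = b m) → P k a → P k b)
    (hstep : ∀ k a, P k a → ∃ j, P (k + 1) (Function.update a k j)) :
    ∃ a, ∀ k, P k a := by
  classical
  choose! J hJ using hstep
  let p : ℕ → ℕ → ℕ := fun k => Nat.rec (fun _ => 0) (fun k a => Function.update a k (J k a)) k
  have hp (k : ℕ) : p (k + 1) = Function.update (p k) k (J k (p k)) := rfl
  have hP (k : ℕ) : P k (p k) := by
    induction k with
    | zero => exact h0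
    | succ k ih => rw [hp]; exact hJ _ _ ih
  -- The entry $m$ is written at stage $m+1$ and never changed later, so the diagonal sequence
  -- agrees below $k$ with the stage $k$.
  have hst (m k : ℕ) (hmk : m + 1 ≤ k) : p k m = p (m + 1) m := by
    induction k, hmk using Nat.le_induction with
    | base => rfl
    | succ k hk ih => rw [hp, Function.update_of_ne (by omega), ih]
  exact ⟨fun m => p (m + 1) m, fun k => hloc k (p k) _ (fun m hm => hst m k hm) (hP k)⟩

/-- **Novikov's separation theorem**: a sequence of analytic sets with empty intersection is Borel
separated. -/
theorem MeasureTheory.AnalyticSet.borelSeparated {α : Type*} [TopologicalSpace α] [T2Space α]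
    [MeasurableSpace α] [OpensMeasurableSpace α] {A : ℕ → Set α} (hA : ∀ n, AnalyticSet (A n))
    (hemp : ⋂ n, A n = ∅) : BorelSeparated A := by
  classical
  by_cases hex : ∃ n, A n = ∅
  · obtain ⟨n, hn⟩ := hex
    refine ⟨fun k => if k = n then ∅ else univ, fun k => ?_, fun k => ?_, ?_⟩
    · by_cases hk : k = n
      · subst hk; simp [hn]
      · simp [hk]
    · dsimp only; split_ifs <;> simp
    · exact eq_empty_of_forall_notMem fun z hz => by simpa using mem_iInter.1 hz n
  push Not at hex
  have hf : ∀ n, ∃ f : (ℕ → ℕ) → α, Continuous f ∧ range f = A n := fun n => by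
    have := hA n
    rw [AnalyticSet] at this
    exact this.resolve_left (hex n).ne_empty
  choose f hfc hfr using hf
  -- One sequence $a$ codes a parameter for every $f_i$ through the pairing function. Passing from
  -- $k$ to $k+1$ prescribes one further coordinate of one parameter, so exactly one set is split
  -- into countably many pieces. Non-separation therefore survives along some branch.
  let Q : ℕ → (ℕ → ℕ) → ℕ → Set α := fun k a i =>
    f i '' {y | ∀ m, Nat.pair i m < k → y m = a (Nat.pair i m)}
  by_contra hsep
  obtain ⟨a, ha⟩ : ∃ a, ∀ k, ¬ BorelSeparated (Q k a) := by
    refine exists_branch ?_ ?_ ?_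
    · convert hsep using 2
      ext i : 1
      simp [Q, hfr]
    · intro k a b hab h
      convert h using 2
      ext i : 1
      have : {y : ℕ → ℕ | ∀ m, Nat.pair i m < k → y m = b (Nat.pair i m)} =
          {y | ∀ m, Nat.pair i m < k → y m = a (Nat.pair i m)} := by
        ext y
        exact forall_congr' fun m => imp_congr_right fun hm => by rw [hab _ hm]
      simp only [Q, this]
    · intro k a h
      by_contra hno
      push Not at hno
      refine h (BorelSeparated.of_split (Nat.unpair k).1 ?_ ?_ hno)
      · rintro _ ⟨y, hy, rfl⟩
        refine mem_iUnion.2 ⟨y (Nat.unpair k).2, y, fun m hm => ?_, rfl⟩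
        rcases (Nat.lt_succ_iff_lt_or_eq).1 hm with h1 | h1
        · rw [Function.update_of_ne h1.ne]
          exact hy m h1
        · rw [h1, Function.update_self]
          have := congrArg Nat.unpair h1
          rw [Nat.unpair_pair] at this
          rw [← this]
      · rintro n hn j _ ⟨y, hy, rfl⟩
        refine ⟨y, fun m hm => ?_, rfl⟩
        rcases (Nat.lt_succ_iff_lt_or_eq).1 hm with h1 | h1
        · rw [Function.update_of_ne h1.ne]
          exact hy m h1
        · refine absurd ?_ hn
          rw [← h1, Nat.unpair_pair]
  -- The branch singles out one point in each set. These points cannot all coincide, as the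
  -- intersection is empty. Two distinct ones have disjoint open neighbourhoods, which separate a
  -- late stage.
  let y : ℕ → ℕ → ℕ := fun i m => a (Nat.pair i m)
  obtain ⟨i, j, hij⟩ : ∃ i j, f i (y i) ≠ f j (y j) := by
    by_contra hall
    push Not at hall
    have : f 0 (y 0) ∈ ⋂ n, A n := mem_iInter.2 fun n => by
      rw [hall 0 n, ← hfr n]
      exact mem_range_self _
    rw [hemp] at this
    exact this
  obtain ⟨u, v, hu, hv, hiu, hjv, huv⟩ := t2_separation hij
  have key : ∀ i (u : Set α), IsOpen u → f i (y i) ∈ u → ∃ K, ∀ k, K ≤ k → Q k a i ⊆ u := by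
    intro i u hu hiu
    obtain ⟨_, ⟨z, M, rfl⟩, hz, hsub⟩ :=
      (PiNat.isTopologicalBasis_cylinders fun _ : ℕ => ℕ).mem_nhds_iff.1
        ((hu.preimage (hfc i)).mem_nhds hiu)
    -- The sum is a crude bound above the codes of the first $M$ coordinates of the $i$-th
    -- parameter; from then on they are all prescribed.
    refine ⟨∑ m ∈ Finset.range M, (Nat.pair i m + 1), fun k hk => ?_⟩
    rintro _ ⟨x, hx, rfl⟩
    refine hsub ?_
    rw [PiNat.mem_cylinder_iff_eq.1 hz |>.symm]
    rw [PiNat.mem_cylinder_iff]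
    intro m hm
    refine hx m (lt_of_lt_of_le (Nat.lt_succ_self _) (le_trans ?_ hk))
    exact Finset.single_le_sum (f := fun m => Nat.pair i m + 1) (fun _ _ => Nat.zero_le _)
      (Finset.mem_range.2 hm)
  obtain ⟨K, hK⟩ := key i u hu hiu
  obtain ⟨K', hK'⟩ := key j v hv hjv
  have hne : i ≠ j := by rintro rfl; exact hij rfl
  refine ha (max K K') ⟨fun n => if n = i then u else if n = j then v else univ, ?_, ?_, ?_⟩
  · intro n
    dsimp only
    split_ifs with h1 h2
    · exact h1 ▸ hK _ (le_max_left _ _)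
    · exact h2 ▸ hK' _ (le_max_right _ _)
    · exact subset_univ _
  · intro n
    dsimp only
    split_ifs
    · exact hu.measurableSet
    · exact hv.measurableSet
    · exact MeasurableSet.univ
  · refine eq_empty_of_forall_notMem fun z hz => ?_
    have h1 := mem_iInter.1 hz i
    have h2 := mem_iInter.1 hz j
    simp only [if_true, hne.symm, if_false] at h1 h2
    exact huv.le_bot ⟨h1, h2⟩

/-- The **Kunugui–Novikov theorem**: a Borel set with open sections is a countable union of
measurable rectangles whose second sides are members of a given basis. -/
theorem MeasurableSet.exists_eq_iUnion_prod_of_isOpen_section {X Z : Type*} [TopologicalSpace X]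
    [PolishSpace X] [MeasurableSpace X] [BorelSpace X] [TopologicalSpace Z] [PolishSpace Z]
    [MeasurableSpace Z] [BorelSpace Z] {H : Set (X × Z)} (hH : MeasurableSet H)
    (hopen : ∀ x, IsOpen {z | (x, z) ∈ H}) {V : ℕ → Set Z}
    (hV : TopologicalSpace.IsTopologicalBasis (range V)) :
    ∃ B : ℕ → Set X, (∀ n, MeasurableSet (B n)) ∧ H = ⋃ n, B n ×ˢ V n := by
  have hVo (n : ℕ) : IsOpen (V n) := hV.isOpen ⟨n, rfl⟩
  -- This is the largest base whose rectangle over $V_n$ fits into $H$. It is only coanalytic, so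
  -- Borel sets must be found inside these bases that still cover $H$.
  let C : ℕ → Set X := fun n => {x | ∀ z ∈ V n, (x, z) ∈ H}
  have hC (n : ℕ) : AnalyticSet (C n)ᶜ := by
    have : (C n)ᶜ = Prod.fst '' (Hᶜ ∩ univ ×ˢ V n) := by
      ext x
      simp only [C, mem_compl_iff, mem_ofPred_eq, not_forall, mem_image, mem_inter_iff, mem_prod,
        mem_univ, true_and, Prod.exists, exists_and_right, exists_eq_right, exists_prop]
      exact exists_congr fun z => and_comm
    rw [this]
    exact (MeasurableSet.analyticSet (hH.compl.inter
      (MeasurableSet.univ.prod (hVo n).measurableSet))).image_of_continuous continuous_fst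
  have hHC : H = ⋃ n, C n ×ˢ V n := by
    ext ⟨x, z⟩
    simp only [mem_iUnion, mem_prod]
    constructor
    · intro hxz
      obtain ⟨_, ⟨n, rfl⟩, hz, hsub⟩ := hV.mem_nhds_iff.1 ((hopen x).mem_nhds hxz)
      exact ⟨n, fun z' hz' => hsub hz', hz⟩
    · rintro ⟨n, hx, hz⟩
      exact hx z hz
  have hcompl (n : ℕ) : AnalyticSet (C n ×ˢ V n)ᶜ := by
    rw [compl_prod_eq_union]
    rw [union_eq_iUnion]
    refine AnalyticSet.iUnion fun b => ?_
    cases b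
    · exact (MeasurableSet.univ.prod (hVo n).measurableSet.compl).analyticSet
    · rw [cond_true, ← univ_inter (_ ×ˢ _)]
      have := (hC n).preimage (X := X × Z) continuous_fst
      convert this using 1
      ext ⟨x, z⟩
      simp
  -- $H$ and the complements of the rectangles are analytic with empty intersection. The complements
  -- of their Borel separators are Borel subsets of the rectangles and still cover $H$.
  let D : ℕ → Set (X × Z) := fun n => Nat.casesOn n H fun n => (C n ×ˢ V n)ᶜ
  obtain ⟨B, hDB, hB, hemp⟩ : BorelSeparated D := by
    refine AnalyticSet.borelSeparated (fun n => ?_) ?_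
    · cases n with
      | zero => exact hH.analyticSet
      | succ n => exact hcompl n
    · refine eq_empty_of_forall_notMem fun p hp => ?_
      rw [mem_iInter] at hp
      have h0 : p ∈ H := hp 0
      rw [hHC, mem_iUnion] at h0
      obtain ⟨n, hn⟩ := h0
      exact hp (n + 1) hn
  -- The projection of the Borel piece is analytic and contained in $C_n$, so a Borel set lies
  -- between the two.
  have hE (n : ℕ) : MeasurablySeparable (Prod.fst '' (B (n + 1))ᶜ) (C n)ᶜ := by
    refine AnalyticSet.measurablySeparable
      ((hB (n + 1)).compl.analyticSet.image_of_continuous continuous_fst) (hC n) ?_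
    rw [disjoint_compl_right_iff_subset]
    rintro _ ⟨p, hp, rfl⟩
    have : p ∈ C n ×ˢ V n := by
      by_contra hcon
      exact hp (hDB (n + 1) hcon)
    exact this.1
  choose E hEs hEd hEm using hE
  refine ⟨E, hEm, Subset.antisymm ?_ ?_⟩
  · intro p hp
    by_contra hcon
    have : p ∈ ⋂ n, B n := by
      refine mem_iInter.2 fun n => ?_
      cases n with
      | zero => exact hDB 0 hp
      | succ n =>
        by_contra hpB
        have hpC : p ∈ C n ×ˢ V n := by
          by_contra hcon'
          exact hpB (hDB (n + 1) hcon')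
        exact hcon (mem_iUnion.2 ⟨n, hEs n ⟨p, hpB, rfl⟩, hpC.2⟩)
    rw [hemp] at this
    exact this
  · refine iUnion_subset fun n => ?_
    rintro ⟨x, z⟩ ⟨hx, hz⟩
    have hxC : x ∈ C n := by
      by_contra hcon
      exact (hEd n).le_bot ⟨hcon, hx⟩
    exact hxC z hz

/-- The projection of a Borel set with compact sections is Borel. -/
theorem MeasurableSet.projection_of_isCompact_section {S A : Type*} [MeasurableSpace S]
    [StandardBorelSpace S] [TopologicalSpace A] [TopologicalSpace.MetrizableSpace A]
    [SecondCountableTopology A] [MeasurableSpace A] [BorelSpace A] [StandardBorelSpace A]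
    {G : Set (S × A)} (hG : MeasurableSet G) (hc : ∀ x, IsCompact {a | (x, a) ∈ G}) :
    MeasurableSet {x | ∃ a, (x, a) ∈ G} := by
  let := upgradeStandardBorel S
  let := TopologicalSpace.metrizableSpaceMetric A
  -- In the Hilbert cube the compact sections have open complements inside a compact space, whatever
  -- the topology of $A$ is like globally.
  obtain ⟨F, hF⟩ := Metric.PiNatEmbed.exists_embedding_to_hilbert_cube (X := A)
  let Z := ℕ → unitInterval
  -- The topology of $A$ is not assumed to be Polish. Borel images come from the standard Borel
  -- structure and injectivity.
  have hFm : MeasurableEmbedding F :=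
    hF.continuous.measurable.measurableEmbedding hF.injective
  have hidF : MeasurableEmbedding (Prod.map id F : S × A → S × Z) :=
    MeasurableEmbedding.id.prodMap hFm
  let H : Set (S × Z) := (Prod.map id F '' G)ᶜ
  have hH : MeasurableSet H := (hidF.measurableSet_image.2 hG).compl
  have hsec (x : S) : {z | (x, z) ∈ H} = (F '' {a | (x, a) ∈ G})ᶜ := by
    ext z
    simp [H]
  obtain ⟨b, hbc, hbne, hb⟩ := TopologicalSpace.exists_countable_basis Z
  have hbn : b.Nonempty := by
    by_contra hcon
    rw [not_nonempty_iff_eq_empty] at hcon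
    have := hb.sUnion_eq
    rw [hcon, sUnion_empty] at this
    exact absurd (mem_univ (fun _ => 0 : Z)) (this ▸ notMem_empty _)
  obtain ⟨V, rfl⟩ := hbc.exists_eq_range hbn
  obtain ⟨B, hB, hHB⟩ := hH.exists_eq_iUnion_prod_of_isOpen_section (fun x => by
    rw [hsec]
    exact ((hc x).image hF.continuous).isClosed.isOpen_compl) hb
  -- A point is outside the projection exactly when the whole cube is its section of $H$. By
  -- compactness finitely many basic sets suffice to cover it, and there are only countably many
  -- finite families.
  have hfin : {x | ∃ a, (x, a) ∈ G}ᶜ =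
      ⋃ t ∈ {t : Finset ℕ | (⋃ n ∈ t, V n) = univ}, ⋂ n ∈ t, B n := by
    ext x
    simp only [mem_compl_iff, mem_ofPred_eq, not_exists, mem_iUnion, mem_iInter, exists_prop]
    constructor
    · intro hx
      have hcov : ∀ z : Z, ∃ n, x ∈ B n ∧ z ∈ V n := fun z => by
        have : (x, z) ∈ H := by
          rintro ⟨⟨x', a⟩, hG', he⟩
          obtain rfl : x' = x := congrArg Prod.fst he
          exact hx a hG'
        rw [hHB, mem_iUnion] at this
        exact this
      obtain ⟨t, ht⟩ := isCompact_univ.elim_finite_subcover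
        (fun n : {n // x ∈ B n} => V n) (fun n => hb.isOpen ⟨n, rfl⟩) (fun z _ => by
          obtain ⟨n, h1, h2⟩ := hcov z
          exact mem_iUnion.2 ⟨⟨n, h1⟩, h2⟩)
      refine ⟨t.map (Function.Embedding.subtype _), ?_, fun n hn => ?_⟩
      · refine eq_univ_of_univ_subset (ht.trans ?_)
        simp only [iUnion_subset_iff]
        intro n hn z hz
        refine mem_iUnion₂.2 ⟨n, ?_, hz⟩
        simpa using ⟨n.2, hn⟩
      · obtain ⟨m, -, rfl⟩ := Finset.mem_map.1 hn
        exact m.2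
    · rintro ⟨t, ht, hxt⟩ a ha
      have hz : F a ∈ ⋃ n ∈ t, V n := by rw [ht]; trivial
      obtain ⟨n, hn, hz⟩ := mem_iUnion₂.1 hz
      have : (x, F a) ∈ H := by
        rw [hHB]
        exact mem_iUnion.2 ⟨n, hxt n hn, hz⟩
      exact this ⟨(x, a), ha, rfl⟩
  rw [← MeasurableSet.compl_iff, hfin]
  exact MeasurableSet.biUnion (Set.to_countable _) fun t _ =>
    Finset.measurableSet_biInter t fun n _ => hB n

end DescriptiveSetTheory

/-! ### Measurable minima and selectors -/

section Selection

variable {S A : Type*} [MeasurableSpace S] [StandardBorelSpace S] [TopologicalSpace A]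
  [TopologicalSpace.MetrizableSpace A] [SecondCountableTopology A] [MeasurableSpace A]
  [BorelSpace A] [StandardBorelSpace A]

/-- The minimum of a lower semicontinuous function over the compact sections of a Borel set is a
measurable function. -/
lemma measurable_of_isLeast_image {G : Set (S × A)} (hG : MeasurableSet G)
    (hc : ∀ x, IsCompact {a | (x, a) ∈ G}) (hne : ∀ x, ∃ a, (x, a) ∈ G) {f : S → A → ℝ}
    (hf : Measurable fun p : S × A => f p.1 p.2)
    (hlsc : ∀ x, LowerSemicontinuousOn (f x) {a | (x, a) ∈ G}) {m : S → ℝ}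
    (hm : ∀ x, IsGLB (f x '' {a | (x, a) ∈ G}) (m x)) : Measurable m := by
  refine measurable_of_Iic fun r => ?_
  -- The minimum is attained, so the sublevel set of $m$ is a projection. Its sections are compact
  -- by lower semicontinuity.
  have : m ⁻¹' Iic r = {x | ∃ a, (x, a) ∈ G ∩ {p | f p.1 p.2 ≤ r}} := by
    ext x
    constructor
    · intro hx
      obtain ⟨a, ha, hmin⟩ := (hlsc x).exists_isMinOn (hne x) (hc x)
      refine ⟨a, ha, le_trans ((hm x).2 ?_) hx⟩
      rintro _ ⟨b, hb, rfl⟩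
      exact hmin hb
    · rintro ⟨a, ha, har⟩
      exact ((hm x).1 ⟨a, ha, rfl⟩).trans har
  rw [this]
  refine (hG.inter (hf measurableSet_Iic)).projection_of_isCompact_section fun x => ?_
  exact (hlsc x).isCompact_inter_preimage_Iic (hc x) r

/-- A Borel set with nonempty compact sections contains the graph of a measurable function. -/
theorem MeasurableSet.exists_measurable_selector {G : Set (S × A)} (hG : MeasurableSet G)
    (hc : ∀ x, IsCompact {a | (x, a) ∈ G}) (hne : ∀ x, ∃ a, (x, a) ∈ G) :
    ∃ φ : S → A, Measurable φ ∧ ∀ x, (x, φ x) ∈ G := by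
  let := TopologicalSpace.metrizableSpaceMetric A
  let T := {G : Set (S × A) // MeasurableSet G ∧ (∀ x, IsCompact {a | (x, a) ∈ G}) ∧
    ∀ x, ∃ a, (x, a) ∈ G}
  -- Each section is cut down to the minimizers of the $n$-th of countably many continuous functions
  -- that separate points. Repeating this for all $n$ leaves exactly one point in each section:
  -- compactness keeps one, separation excludes a second.
  have hstep : ∀ (n : ℕ) (G : T), ∃ G' : T, G'.1 ⊆ G.1 ∧ ∀ x a b, (x, a) ∈ G'.1 →
      (x, b) ∈ G'.1 →
        Metric.PiNatEmbed.distDenseSeq A n a = Metric.PiNatEmbed.distDenseSeq A n b := by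
    rintro n ⟨G, hG, hc, hne⟩
    let f : A → ℝ := fun a => Metric.PiNatEmbed.distDenseSeq A n a
    have hfc : Continuous f :=
      continuous_subtype_val.comp (Metric.PiNatEmbed.continuous_distDenseSeq n)
    have hlsc : ∀ x, LowerSemicontinuousOn f {a | (x, a) ∈ G} := fun x =>
      hfc.lowerSemicontinuous.lowerSemicontinuousOn _
    choose g hg hmin using fun x => (hlsc x).exists_isMinOn (hne x) (hc x)
    have hglb : ∀ x, IsGLB (f '' {a | (x, a) ∈ G}) (f (g x)) := fun x =>
      IsLeast.isGLB ⟨⟨g x, hg x, rfl⟩, by rintro _ ⟨b, hb, rfl⟩; exact hmin x hb⟩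
    have hmm : Measurable fun x => f (g x) :=
      measurable_of_isLeast_image hG hc hne (f := fun _ => f)
        (hfc.measurable.comp measurable_snd) hlsc hglb
    refine ⟨⟨G ∩ {p | f p.2 ≤ f (g p.1)}, ?_, fun x => ?_, fun x => ⟨g x, hg x, le_refl (f (g x))⟩⟩,
      inter_subset_left, fun x a b ha hb => ?_⟩
    · exact hG.inter (measurableSet_le (hfc.measurable.comp measurable_snd)
        (hmm.comp measurable_fst))
    · exact (hlsc x).isCompact_inter_preimage_Iic (hc x) (f (g x))
    · refine Subtype.ext (le_antisymm ?_ ?_)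
      · exact ha.2.trans (hmin x hb.1)
      · exact hb.2.trans (hmin x ha.1)
  choose F hFs hFe using hstep
  let p : ℕ → T := fun n => Nat.rec ⟨G, hG, hc, hne⟩ F n
  have hanti : Antitone fun n => (p n).1 := antitone_nat_of_succ_le fun n => hFs n (p n)
  have hex : ∀ x, ∃ a, ∀ n, (x, a) ∈ (p n).1 := fun x => by
    have := IsCompact.nonempty_iInter_of_sequence_nonempty_isCompact_isClosed
      (fun n => {a | (x, a) ∈ (p n).1}) (fun n a ha => hanti (Nat.le_succ n) ha)
      (fun n => (p n).2.2.2 x) ((p 0).2.2.1 x) (fun n => ((p n).2.2.1 x).isClosed)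
    obtain ⟨a, ha⟩ := this
    exact ⟨a, fun n => mem_iInter.1 ha n⟩
  choose φ hφ using hex
  have huniq : ∀ x a, (∀ n, (x, a) ∈ (p n).1) → a = φ x := fun x a ha => by
    by_contra hcon
    obtain ⟨n, hn⟩ := Metric.PiNatEmbed.injective_distDenseSeq a (φ x) hcon
    exact hn (hFe n (p n) x a (φ x) (ha (n + 1)) (hφ x (n + 1)))
  refine ⟨φ, measurable_of_isClosed fun C hC => ?_, fun x => hφ x 0⟩
  -- The intersection is the graph of `φ`, so this is again a projection of a Borel set whose
  -- sections have at most one point.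
  have : φ ⁻¹' C = {x | ∃ a, (x, a) ∈ (⋂ n, (p n).1) ∩ {q | q.2 ∈ C}} := by
    ext x
    constructor
    · exact fun hx => ⟨φ x, mem_iInter.2 (hφ x), hx⟩
    · rintro ⟨a, ha, haC⟩
      have h := huniq x a (mem_iInter.1 ha)
      rw [mem_preimage, ← h]
      exact haC
  rw [this]
  refine ((MeasurableSet.iInter fun n => (p n).2.1).inter
    (measurable_snd hC.measurableSet)).projection_of_isCompact_section fun x => ?_
  refine Set.Subsingleton.isCompact fun a ha b hb => ?_
  rw [huniq x a (mem_iInter.1 ha.1), huniq x b (mem_iInter.1 hb.1)]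

end Selection

/-! ### Integrals against the signed transition rates -/

namespace CTMDP

variable {S A : Type*} [MeasurableSpace S] [MeasurableSpace A]

section SignedIntegral

variable [StandardBorelSpace S] (M : CTMDP S A)

instance (x : S) (a : A) : IsFiniteMeasure (M.jumpRate x a) := by
  obtain ⟨C, hC⟩ := M.exists_jumpRate_le x
  exact ⟨(hC a).trans_lt ENNReal.coe_lt_top⟩

lemma measurable_jumpRate : Measurable fun p : S × A => M.jumpRate p.1 p.2 :=
  M.measurable_rateExt.comp
    ((measurable_inl.comp measurable_fst).prodMk (measurable_inl.comp measurable_snd))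

lemma jumpRate_of_notMem {x : S} {a : A} (ha : a ∉ M.Adm x) : M.jumpRate x a = 0 := by
  refine Measure.ext fun Γ hΓ => ?_
  rw [M.jumpRate_apply x a hΓ, M.q_off x a ha]
  simp

lemma q_univ (x : S) (a : A) : M.q x a univ = 0 := by
  by_cases ha : a ∈ M.Adm x
  · exact M.q_conservative x a ha
  · simp [M.q_off x a ha]

lemma jumpRate_real (x : S) (a : A) {Γ : Set S} (hΓ : MeasurableSet Γ) :
    (M.jumpRate x a).real Γ = M.q x a (Γ \ {x}) := by
  rw [measureReal_def, M.jumpRate_apply x a hΓ, ENNReal.toReal_ofReal]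
  by_cases ha : a ∈ M.Adm x
  · exact M.q_nonneg x a ha _ (hΓ.diff (measurableSet_singleton x)) fun h => h.2 rfl
  · simp [M.q_off x a ha]

lemma jumpRate_real_univ (x : S) (a : A) : (M.jumpRate x a).real univ = -(M.q x a {x}) := by
  rw [M.jumpRate_real x a MeasurableSet.univ]
  have h2 := VectorMeasure.of_add_of_sdiff (v := M.q x a) (measurableSet_singleton x)
    MeasurableSet.univ (subset_univ _)
  rw [M.q_univ] at h2
  linarith

lemma jumpRate_real_le_qBar {x : S} {a : A} (ha : a ∈ M.Adm x) :
    (M.jumpRate x a).real univ ≤ M.qBar x := by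
  rw [M.jumpRate_real_univ]
  exact le_csSup (M.q_stable x) ⟨a, ha, rfl⟩

lemma adm_nonempty (x : S) : (M.Adm x).Nonempty := by
  obtain ⟨φ, -, h⟩ := M.exists_selector
  exact ⟨φ x, h x⟩

lemma qBar_nonneg (x : S) : 0 ≤ M.qBar x := by
  obtain ⟨a, ha⟩ := M.adm_nonempty x
  exact measureReal_nonneg.trans (M.jumpRate_real_le_qBar ha)

/-- Away from $x$ the signed measure is the jump rate, and conservativity forces the atom at $x$ to
balance the total rate. Signed integrals thereby reduce to integrals against a finite positive
measure. -/
lemma q_eq_sub_dirac (x : S) (a : A) : M.q x a = (M.jumpRate x a).toSignedMeasure -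
    VectorMeasure.dirac x ((M.jumpRate x a).real univ) := by
  ext Γ hΓ
  rw [sub_apply, Measure.toSignedMeasure_apply_measurable hΓ, M.jumpRate_real x a hΓ,
    M.jumpRate_real_univ]
  by_cases hx : x ∈ Γ
  · rw [VectorMeasure.dirac_apply_of_mem hΓ hx]
    have := VectorMeasure.of_add_of_sdiff (v := M.q x a) (measurableSet_singleton x) hΓ
      (singleton_subset_iff.2 hx)
    linarith
  · rw [VectorMeasure.dirac_apply_of_notMem hx, sdiff_singleton_eq_self hx, sub_zero]

lemma jumpRate_le_variation (x : S) (a : A) : M.jumpRate x a ≤ (M.q x a).variation := by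
  refine Measure.le_intro fun Γ hΓ _ => ?_
  rw [M.jumpRate_apply x a hΓ]
  refine le_trans ?_ ((VectorMeasure.enorm_measure_le_variation (M.q x a) (Γ \ {x})).trans
    (measure_mono sdiff_subset))
  exact Real.ofReal_le_enorm _

/-- The atom at $x$ imposes no condition, since every function is integrable against a point mass.
-/
lemma q_integrable_iff {x : S} {a : A} {f : S → ℝ} :
    (M.q x a).Integrable f ↔ Integrable f (M.jumpRate x a) := by
  refine ⟨fun h => Integrable.mono_measure h (M.jumpRate_le_variation x a), fun h => ?_⟩
  rw [M.q_eq_sub_dirac]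
  refine VectorMeasure.Integrable.sub_vectorMeasure ?_ ?_
  · rw [VectorMeasure.Integrable, Measure.variation_toSignedMeasure]
    exact h
  · rw [VectorMeasure.Integrable, VectorMeasure.variation_dirac]
    exact (integrable_dirac enorm_lt_top).smul_measure enorm_ne_top

/-- The integral against the transition rate in terms of the jump rate measure. -/
lemma qInt_eq {x : S} {a : A} {f : S → ℝ}
    (hi : Integrable f (M.jumpRate x a)) :
    M.qInt x a f = ∫ y, f y ∂(M.jumpRate x a) - (M.jumpRate x a).real univ * f x := by
  unfold qInt
  have h1 : ((M.jumpRate x a).toSignedMeasure).Integrable f := by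
    rw [VectorMeasure.Integrable, Measure.variation_toSignedMeasure]
    exact hi
  have h2 : (VectorMeasure.dirac x ((M.jumpRate x a).real univ)).Integrable f := by
    rw [VectorMeasure.Integrable, VectorMeasure.variation_dirac]
    exact (integrable_dirac enorm_lt_top).smul_measure enorm_ne_top
  rw [M.q_eq_sub_dirac, VectorMeasure.integral_sub_vectorMeasure h1 h2,
    VectorMeasure.integral_dirac, ← VectorMeasure.integral_toSignedMeasure]
  -- Multiplication in $\mathbb R$ is symmetric, so the order in which function and measure are
  -- paired is immaterial.
  have : (ContinuousLinearMap.lsmul ℝ ℝ : ℝ →L[ℝ] ℝ →L[ℝ] ℝ) =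
      (ContinuousLinearMap.lsmul ℝ ℝ).flip := by
    ext
    simp
  rw [← this]
  simp [mul_comm]

lemma measurable_qInt {f : S → ℝ} (hf : Measurable f)
    (hi : ∀ x, ∀ a ∈ M.Adm x, Integrable f (M.jumpRate x a)) :
    Measurable fun p : S × A => M.qInt p.1 p.2 f := by
  have hi' : ∀ x a, Integrable f (M.jumpRate x a) := fun x a => by
    by_cases ha : a ∈ M.Adm x
    · exact hi x a ha
    · rw [M.jumpRate_of_notMem ha]
      exact integrable_zero_measure
  -- Lower integrals of the positive and negative parts depend measurably on the measure, which
  -- settles joint measurability in $(x,a)$.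
  have h1 : (fun p : S × A => M.qInt p.1 p.2 f) = fun p =>
      ((∫⁻ y, ENNReal.ofReal (f y) ∂(M.jumpRate p.1 p.2)).toReal -
        (∫⁻ y, ENNReal.ofReal (-f y) ∂(M.jumpRate p.1 p.2)).toReal) -
        (M.jumpRate p.1 p.2 univ).toReal * f p.1 := by
    ext p
    rw [M.qInt_eq (hi' _ _), integral_eq_lintegral_pos_part_sub_lintegral_neg_part (hi' _ _)]
    rfl
  rw [h1]
  have hl (g : S → ℝ≥0∞) (hg : Measurable g) :
      Measurable fun p : S × A => ∫⁻ y, g y ∂(M.jumpRate p.1 p.2) :=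
    (Measure.measurable_lintegral hg).comp M.measurable_jumpRate
  refine ((hl _ hf.ennreal_ofReal).ennreal_toReal.sub
    (hl _ hf.neg.ennreal_ofReal).ennreal_toReal).sub (Measurable.mul ?_ (hf.comp measurable_fst))
  exact ((Measure.measurable_coe MeasurableSet.univ).comp M.measurable_jumpRate).ennreal_toReal

lemma Drift.integrable_jumpRate {M : CTMDP S A} {w : S → ℝ} {ρ b : ℝ} (h : M.Drift w ρ b)
    {x : S} {a : A} (ha : a ∈ M.Adm x) : Integrable w (M.jumpRate x a) :=
  M.q_integrable_iff.1 (h.integrable x a ha)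

lemma integrable_of_le {μ : Measure S} {w u : S → ℝ} {C : ℝ} (hu : Measurable u)
    (hw : Integrable w μ) (hle : ∀ x, |u x| ≤ C * w x) : Integrable u μ :=
  (hw.const_mul C).mono' hu.aestronglyMeasurable (Eventually.of_forall hle)

lemma qInt_add {x : S} {a : A} {f g : S → ℝ}
    (hfi : Integrable f (M.jumpRate x a)) (hgi : Integrable g (M.jumpRate x a)) :
    M.qInt x a (fun y => f y + g y) = M.qInt x a f + M.qInt x a g := by
  rw [M.qInt_eq (f := fun y => f y + g y) (hfi.add hgi), M.qInt_eq hfi, M.qInt_eq hgi,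
    integral_add hfi hgi]
  ring

lemma qInt_const_mul {x : S} {a : A} {f : S → ℝ} (c : ℝ)
    (hfi : Integrable f (M.jumpRate x a)) :
    M.qInt x a (fun y => c * f y) = c * M.qInt x a f := by
  rw [M.qInt_eq (hfi.const_mul c), M.qInt_eq hfi, integral_const_mul]
  ring

lemma qInt_const (x : S) (a : A) (c : ℝ) : M.qInt x a (fun _ => c) = 0 := by
  rw [M.qInt_eq (integrable_const c), integral_const, smul_eq_mul, sub_self]

/-- The compactness-continuity conditions extend to all functions with finite weighted norm. -/
lemma CompactContinuous.lowerSemicontinuousOn_qInt [TopologicalSpace A] {M : CTMDP S A}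
    {w : S → ℝ} {ρ b : ℝ} (hcc : M.CompactContinuous w) (hw : M.Drift w ρ b) {u : S → ℝ} {C : ℝ}
    (hu : Measurable u) (hle : ∀ x, |u x| ≤ C * w x) (x : S) :
    LowerSemicontinuousOn (fun a => M.qInt x a u) (M.Adm x) := by
  have hf : Measurable fun y => u y + C * w y := hu.add (hw.measurable.const_mul C)
  have hf0 : ∀ y, 0 ≤ u y + C * w y := fun y => by have := (abs_le.1 (hle y)).1; linarith
  have hui : ∀ a ∈ M.Adm x, Integrable u (M.jumpRate x a) := fun a ha =>
    integrable_of_le hu (hw.integrable_jumpRate ha) hle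
  have hwi : ∀ a ∈ M.Adm x, Integrable (fun y => C * w y) (M.jumpRate x a) := fun a ha =>
    (hw.integrable_jumpRate ha).const_mul C
  have hfi : ∀ a ∈ M.Adm x, Integrable (fun y => u y + C * w y) (M.jumpRate x a) := fun a ha =>
    (hui a ha).add (hwi a ha)
  -- The shift by $Cw$ makes $u$ nonnegative, and truncation makes it bounded, so the semicontinuity
  -- hypothesis applies to each `g n`.
  let g : ℕ → S → ℝ := fun n y => min (u y + C * w y) n
  have hgm (n : ℕ) : Measurable (g n) := hf.min measurable_const
  have hg0 (n : ℕ) (y : S) : 0 ≤ g n y := le_min (hf0 y) n.cast_nonneg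
  have hgf (n : ℕ) (y : S) : g n y ≤ u y + C * w y := min_le_left _ _
  have hgi (n : ℕ) (a : A) (ha : a ∈ M.Adm x) : Integrable (g n) (M.jumpRate x a) :=
    (hfi a ha).mono' (hgm n).aestronglyMeasurable (Eventually.of_forall fun y => by
      rw [Real.norm_of_nonneg (hg0 n y)]
      exact hgf n y)
  -- The value at $x$ enters `qInt` with a negative sign. Truncations bound the integral from below
  -- only if they leave that value unchanged, hence only levels from $N$ on are used.
  obtain ⟨N, hN⟩ := exists_nat_ge (u x + C * w x)
  have hgx (n : ℕ) (hn : N ≤ n) : g n x = u x + C * w x :=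
    min_eq_left (hN.trans (by exact_mod_cast hn))
  have hlsc : LowerSemicontinuousOn (fun a => M.qInt x a fun y => u y + C * w y) (M.Adm x) := by
    intro a ha r hr
    have hlim : Tendsto (fun n => M.qInt x a (g n)) atTop
        (𝓝 (M.qInt x a fun y => u y + C * w y)) := by
      rw [M.qInt_eq (hfi a ha)]
      have h1 : Tendsto (fun n => ∫ y, g n y ∂(M.jumpRate x a)) atTop
          (𝓝 (∫ y, (u y + C * w y) ∂(M.jumpRate x a))) := by
        refine tendsto_integral_of_dominated_convergence (fun y => u y + C * w y)
          (fun n => (hgm n).aestronglyMeasurable) (hfi a ha)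
          (fun n => Eventually.of_forall fun y => ?_) (Eventually.of_forall fun y => ?_)
        · rw [Real.norm_of_nonneg (hg0 n y)]
          exact hgf n y
        · obtain ⟨K, hK⟩ := exists_nat_ge (u y + C * w y)
          refine tendsto_const_nhds.congr' ?_
          filter_upwards [eventually_ge_atTop K] with n hn
          exact (min_eq_left (hK.trans (by exact_mod_cast hn))).symm
      refine (h1.sub_const _).congr' ?_
      filter_upwards [eventually_ge_atTop N] with n hn
      rw [M.qInt_eq (hgi n a ha), hgx n hn]
    obtain ⟨n, hn, hnN⟩ := ((hlim.eventually (lt_mem_nhds hr)).and (eventually_ge_atTop N)).exists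
    have := hcc.lsc_qInt (g n) (hgm n) (hg0 n)
      ⟨n, by rintro _ ⟨y, rfl⟩; exact min_le_right _ _⟩ x a ha r hn
    filter_upwards [this, self_mem_nhdsWithin] with a' h1 ha'
    refine h1.trans_le ?_
    rw [M.qInt_eq (hgi n a' ha'), M.qInt_eq (hfi a' ha'), hgx n hnN]
    exact sub_le_sub_right (integral_mono (hgi n a' ha') (hfi a' ha') (hgf n)) _
  -- Continuity of the integral of $w$, not merely semicontinuity, is what allows the shift to be
  -- removed.
  have hcont : ContinuousOn (fun a => -C * M.qInt x a w) (M.Adm x) :=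
    (hcc.continuous_qInt x).const_mul _
  have hsum := hlsc.add hcont.lowerSemicontinuousOn
  have heq : ∀ a ∈ M.Adm x, M.qInt x a (fun y => u y + C * w y) + -C * M.qInt x a w =
      M.qInt x a u := fun a ha => by
    rw [M.qInt_add (hui a ha) (hwi a ha),
      M.qInt_const_mul C (hw.integrable_jumpRate ha)]
    ring
  intro a ha r hr
  have := hsum a ha r (by simpa only [heq a ha] using hr)
  filter_upwards [this, self_mem_nhdsWithin] with a' h1 ha'
  simpa only [heq a' ha'] using h1

end SignedIntegral

end CTMDP

/-! ### Predictable sets see only the past jumps -/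

section PredictableLocality

variable {S : Type*} [MeasurableSpace S]

lemma jumpTime_congr {n : ℕ} {ω ω' : ℕ → Entry S} (h : ∀ k ≤ n, ω k = ω' k) :
    jumpTime n ω = jumpTime n ω' :=
  Finset.sum_congr rfl fun k hk => by rw [h k (by simpa [Nat.lt_succ_iff] using hk)]

/-- Up to a time strictly before the jump $n+1$ of both trajectories, a generating event with index
above $n$ contains neither of them. One with index at most $n$ depends only on the common entries.
-/
lemma mem_of_mem_pathFiltration {n : ℕ} {s : ℝ≥0} {B : Set (PathSpace S)}
    (hB : MeasurableSet[pathFiltration S s] B) {ω ω' : PathSpace S}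
    (h : ∀ k ≤ n, ω.1 k = ω'.1 k) (h1 : (s : ℝ≥0∞) < jumpTime (n + 1) ω.1)
    (h2 : (s : ℝ≥0∞) < jumpTime (n + 1) ω'.1) : ω ∈ B ↔ ω' ∈ B := by
  have key : ∀ {ω : PathSpace S} {m : ℕ} {r : ℝ≥0}, r ≤ s →
      (s : ℝ≥0∞) < jumpTime (n + 1) ω.1 → jumpTime m ω.1 ≤ r → m ≤ n := by
    intro ω m r hr hs hm
    by_contra hlt
    have h3 : jumpTime (n + 1) ω.1 ≤ jumpTime m ω.1 := jumpTime_mono ω.1 (by omega)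
    exact absurd (h3.trans (hm.trans (by exact_mod_cast hr))) (not_le.2 hs)
  induction B, hB using MeasurableSpace.generateFrom_induction with
  | hC B hB =>
    obtain ⟨m, r, Γ, hr, hΓ, rfl⟩ := hB
    constructor
    · rintro ⟨h3, h4⟩
      have hm := key hr h1 h3
      exact ⟨(jumpTime_congr fun k hk => h k (hk.trans hm)) ▸ h3, h m hm ▸ h4⟩
    · rintro ⟨h3, h4⟩
      have hm := key hr h2 h3
      exact ⟨(jumpTime_congr fun k hk => h k (hk.trans hm)) ▸ h3, (h m hm).symm ▸ h4⟩
  | empty => simp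
  | compl t ht ih => exact not_congr ih
  | iUnion f hf ih => simp only [mem_iUnion, ih]

/-- The generating rectangles $(i,\infty)\times B$ with $B\in\mathcal F_i$ are open on the left.
Hence $t\le T_{n+1}$ gives $i<T_{n+1}$, and locality of the filtration applies even at the jump
time. The rectangles over time zero are excluded by $t>0$. -/
lemma mem_of_mem_predictable {n : ℕ} {t : ℝ≥0} {B : Set (ℝ≥0 × PathSpace S)}
    (hB : MeasurableSet[(pathFiltration S).predictable] B) {ω ω' : PathSpace S} (ht : 0 < t)
    (h : ∀ k ≤ n, ω.1 k = ω'.1 k) (h1 : (t : ℝ≥0∞) ≤ jumpTime (n + 1) ω.1)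
    (h2 : (t : ℝ≥0∞) ≤ jumpTime (n + 1) ω'.1) : (t, ω) ∈ B ↔ (t, ω') ∈ B := by
  induction B, hB using MeasurableSpace.generateFrom_induction with
  | hC B hB =>
    rcases hB with ⟨B, hB, rfl⟩ | ⟨i, B, hB, rfl⟩
    · simp [ht.ne']
    · simp only [mem_prod, mem_Ioi]
      refine and_congr_right fun hi => ?_
      have hi' : (i : ℝ≥0∞) < t := by exact_mod_cast hi
      exact mem_of_mem_pathFiltration hB h (hi'.trans_le h1) (hi'.trans_le h2)
  | empty => simp
  | compl t ht ih => exact not_congr ih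
  | iUnion f hf ih => simp only [mem_iUnion, ih]

/-- A predictable policy depends, up to the next jump, only on the past jumps. -/
lemma CTMDP.Policy.toFun_congr {A : Type*} [MeasurableSpace A] {M : CTMDP S A} (π : M.Policy)
    {n : ℕ} {t : ℝ≥0} {ω ω' : PathSpace S} (ht : 0 < t)
    (h : ∀ k ≤ n, ω.1 k = ω'.1 k) (h1 : (t : ℝ≥0∞) ≤ jumpTime (n + 1) ω.1)
    (h2 : (t : ℝ≥0∞) ≤ jumpTime (n + 1) ω'.1) : π.toFun t ω = π.toFun t ω' := by
  refine Measure.ext fun Γ hΓ => ?_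
  -- The level set of the value at $(t,\omega)$ is predictable and contains $(t,\omega)$, so it
  -- contains $(t,\omega')$ as well.
  have hB := π.predictable Γ hΓ (measurableSet_singleton (π.toFun t ω Γ))
  exact ((mem_of_mem_predictable hB ht h h1 h2).1 rfl).symm

end PredictableLocality

/-! ### Histories and the law of the sequence of entries -/

namespace CTMDP

variable {S A : Type*} [MeasurableSpace S] [MeasurableSpace A]

section Histories

lemma Hist.continue_frestrictLe {n k : ℕ} (ω : ℕ → Entry S) (hk : k ≤ n) :
    Hist.continue (Preorder.frestrictLe n ω : Hist S n) k = ω k := by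
  unfold Hist.continue
  rw [dif_pos (Finset.mem_Iic.2 hk)]
  rfl

lemma Hist.continue_of_lt {n k : ℕ} (h : Hist S n) (hk : n < k) :
    h.continue k = (∞, Sum.inr ()) := by
  unfold Hist.continue
  rw [dif_neg (by simpa using hk)]

lemma jumpTime_continue_frestrictLe {n : ℕ} (ω : ℕ → Entry S) :
    jumpTime n (Hist.continue (Preorder.frestrictLe n ω : Hist S n)) = jumpTime n ω :=
  jumpTime_congr fun _ hk => Hist.continue_frestrictLe ω hk

lemma jumpTime_succ (n : ℕ) (ω : ℕ → Entry S) :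
    jumpTime (n + 1) ω = jumpTime n ω + (ω (n + 1)).1 :=
  Finset.sum_range_succ _ _

lemma jumpTime_succ_continue {n : ℕ} (h : Hist S n) : jumpTime (n + 1) h.continue = ∞ := by
  rw [jumpTime_succ, h.continue_of_lt (Nat.lt_succ_self n)]
  simp

lemma isPath_continue {n : ℕ} {ω : ℕ → Entry S} (hω : IsPath ω) :
    IsPath (Hist.continue (Preorder.frestrictLe n ω : Hist S n)) := by
  refine ⟨?_, ?_, fun k => ?_⟩
  · rw [Hist.continue_frestrictLe ω (Nat.zero_le n)]; exact hω.1
  · rw [Hist.continue_frestrictLe ω (Nat.zero_le n)]; exact hω.2.1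
  · rcases Nat.lt_or_ge k n with hk | hk
    · rw [Hist.continue_frestrictLe ω hk, Hist.continue_frestrictLe ω hk.le]
      exact hω.2.2 k
    · rw [Hist.continue_of_lt _ (Nat.lt_succ_of_le hk)]
      simp

/-- An infinite jump time means that some sojourn was infinite; that entry carries $x_\infty$, which
then persists. -/
lemma ne_inr_of_isPath_of_jumpTime_eq_top {ω : ℕ → Entry S} (hω : IsPath ω) {n : ℕ}
    (h : jumpTime n ω = ∞) : (ω n).2 = Sum.inr () := by
  induction n with
  | zero => simp [jumpTime, hω.1] at h
  | succ n ih =>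
    rw [jumpTime_succ, ENNReal.add_eq_top] at h
    rcases h with h | h
    · exact (hω.2.2 n).2.2 (ih h)
    · exact (hω.2.2 n).2.1.1 h

end Histories

section ExtendedFunctions

/-- A function on `S × A` extended by zero to the spaces with isolated points. -/
noncomputable def extZero (G : S × A → ℝ≥0∞) (p : (S ⊕ Unit) × (A ⊕ Unit)) : ℝ≥0∞ :=
  Function.extend (Prod.map Sum.inl Sum.inl : S × A → (S ⊕ Unit) × (A ⊕ Unit)) G 0 p

lemma measurableEmbedding_inl_inl :
    MeasurableEmbedding (Prod.map Sum.inl Sum.inl : S × A → (S ⊕ Unit) × (A ⊕ Unit)) :=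
  MeasurableEmbedding.prodMap
    ⟨Sum.inl_injective, measurable_inl, fun _ hs => measurableSet_inl_image.2 hs⟩
    ⟨Sum.inl_injective, measurable_inl, fun _ hs => measurableSet_inl_image.2 hs⟩

lemma measurable_extZero {G : S × A → ℝ≥0∞} (hG : Measurable G) : Measurable (extZero G) :=
  measurableEmbedding_inl_inl.measurable_extend hG measurable_const

@[simp] lemma extZero_inl_inl (G : S × A → ℝ≥0∞) (x : S) (a : A) :
    extZero G (Sum.inl x, Sum.inl a) = G (x, a) :=
  measurableEmbedding_inl_inl.injective.extend_apply G 0 (x, a)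

@[simp] lemma extZero_inr_left (G : S × A → ℝ≥0∞) (u : Unit) (b : A ⊕ Unit) :
    extZero G (Sum.inr u, b) = 0 :=
  Function.extend_apply' _ _ _ (by rintro ⟨⟨x', a'⟩, h⟩; simp at h)

@[simp] lemma extZero_inr_right (G : S × A → ℝ≥0∞) (z : S ⊕ Unit) (u : Unit) :
    extZero G (z, Sum.inr u) = 0 :=
  Function.extend_apply' _ _ _ (by rintro ⟨⟨x', a'⟩, h⟩; simp at h)

end ExtendedFunctions

variable [StandardBorelSpace S] {M : CTMDP S A} (π : M.Policy) (γ : Measure S)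

section Laws

/-- The law of the marked point process on the space of all sequences of entries. -/
noncomputable def seqLaw : Measure (ℕ → Entry S) :=
  (γ.map fun x => (fun _ => (0, Sum.inl x) : Hist S 0)).bind
    (Kernel.traj (X := fun _ => Entry S) (nextEntryKernel π) 0)

/-- The law of the history up to the `n`-th jump. -/
noncomputable def histLaw (n : ℕ) : Measure (Hist S n) :=
  (seqLaw π γ).map (Preorder.frestrictLe (π := fun _ => Entry S) n)

lemma measurable_frestrictLe (n : ℕ) :
    Measurable fun ω : ℕ → Entry S => (Preorder.frestrictLe n ω : Hist S n) :=
  Preorder.measurable_frestrictLe (X := fun _ => Entry S) n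

lemma measurable_initial : Measurable fun x : S => (fun _ => (0, Sum.inl x) : Hist S 0) :=
  measurable_pi_lambda _ fun _ => measurable_const.prodMk measurable_inl

instance [IsProbabilityMeasure γ] : IsProbabilityMeasure (seqLaw π γ) := by
  have : IsProbabilityMeasure (γ.map fun x => (fun _ => (0, Sum.inl x) : Hist S 0)) :=
    Measure.isProbabilityMeasure_map measurable_initial.aemeasurable
  unfold seqLaw
  infer_instance

instance [IsProbabilityMeasure γ] (n : ℕ) : IsProbabilityMeasure (histLaw π γ n) :=
  Measure.isProbabilityMeasure_map (Preorder.measurable_frestrictLe n).aemeasurable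

/-- This is the defining property of the Ionescu-Tulcea measure, in the form in which conditioning
on a history is used throughout. -/
lemma histLaw_compProd [IsProbabilityMeasure γ] (n : ℕ) :
    histLaw π γ n ⊗ₘ nextEntryKernel π n =
      (seqLaw π γ).map fun ω => ((Preorder.frestrictLe n ω : Hist S n), ω (n + 1)) := by
  have : IsProbabilityMeasure (γ.map fun x => (fun _ => (0, Sum.inl x) : Hist S 0)) :=
    Measure.isProbabilityMeasure_map measurable_initial.aemeasurable
  rw [Measure.compProd_eq_comp_prod, histLaw, seqLaw, Measure.map_comp _ _ (by fun_prop),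
    Kernel.traj_map_frestrictLe, Measure.comp_assoc, Measure.map_comp _ _ (by fun_prop)]
  congr with x₀ : 1
  rw [Kernel.comp_apply, ← Measure.compProd_eq_comp_prod, Kernel.map_apply _ (by fun_prop),
    Kernel.partialTraj_compProd_eq_map_traj zero_le]

lemma lintegral_seqLaw_succ [IsProbabilityMeasure γ] (n : ℕ) {F : Hist S n × Entry S → ℝ≥0∞}
    (hF : Measurable F) :
    ∫⁻ ω, F ((Preorder.frestrictLe n ω : Hist S n), ω (n + 1)) ∂(seqLaw π γ) =
      ∫⁻ h, ∫⁻ e, F (h, e) ∂(nextEntryKernel π n h) ∂(histLaw π γ n) := by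
  rw [← Measure.lintegral_compProd hF, histLaw_compProd, lintegral_map hF]
  exact (Preorder.measurable_frestrictLe n).prodMk (measurable_pi_apply (n + 1))

lemma lintegral_histLaw (n : ℕ) {F : Hist S n → ℝ≥0∞} (hF : Measurable F) :
    ∫⁻ h, F h ∂(histLaw π γ n) =
      ∫⁻ ω, F (Preorder.frestrictLe n ω : Hist S n) ∂(seqLaw π γ) :=
  lintegral_map hF (Preorder.measurable_frestrictLe n)

lemma lintegral_histLaw_zero {F : Hist S 0 → ℝ≥0∞} (hF : Measurable F) :
    ∫⁻ h, F h ∂(histLaw π γ 0) = ∫⁻ x, F (fun _ => (0, Sum.inl x)) ∂γ := by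
  have h1 : histLaw π γ 0 = γ.map fun x => (fun _ => (0, Sum.inl x) : Hist S 0) := by
    rw [histLaw, seqLaw, Measure.map_comp _ _ (by fun_prop), Kernel.traj_map_frestrictLe,
      Kernel.partialTraj_self, Measure.id_comp]
  rw [h1, lintegral_map hF measurable_initial]

lemma lintegral_nextEntryKernel (n : ℕ) (h : Hist S n) {F : Entry S → ℝ≥0∞} (hF : Measurable F) :
    ∫⁻ e, F e ∂(nextEntryKernel π n h) =
      (∫⁻ u in Ioi (0 : ℝ), survival π n h u *
        ∫⁻ y, F (ENNReal.ofReal u, Sum.inl y) ∂(intensity π n h u)) +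
        survivalTop π n h * F (∞, Sum.inr ()) := by
  show ∫⁻ e, F e ∂(nextEntryLaw π n h) = _
  unfold nextEntryLaw
  rw [lintegral_add_measure, lintegral_smul_measure, lintegral_dirac' _ hF,
    Measure.lintegral_bind (measurable_density' π n h).aemeasurable hF.aemeasurable]
  congr 1
  refine lintegral_congr fun u => ?_
  rw [lintegral_smul_measure, lintegral_map hF (measurable_mark u), smul_eq_mul]

/-- The conditional law of the action at the time `u` after the `n`-th jump. -/
noncomputable def actionKernel (n : ℕ) : Kernel (Hist S n × ℝ) (A ⊕ Unit) where
  toFun p := π.ext ((jumpTime n p.1.continue).toNNReal + p.2.toNNReal, p.1.continue)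
  measurable' := by
    have h1 : Measurable fun p : Hist S n × ℝ => p.1.continue :=
      Hist.measurable_continue.comp measurable_fst
    exact π.measurable_ext.comp (((((measurable_jumpTime n).comp h1).ennreal_toNNReal).add
      measurable_snd.real_toNNReal).prodMk h1)

instance (n : ℕ) : IsMarkovKernel (actionKernel π n) :=
  ⟨fun _ => inferInstanceAs (IsProbabilityMeasure (π.ext _))⟩

lemma lintegral_intensity (n : ℕ) (h : Hist S n) (u : ℝ) {f : S → ℝ≥0∞} (hf : Measurable f) :
    ∫⁻ y, f y ∂(intensity π n h u) =
      ∫⁻ b, ∫⁻ y, f y ∂(M.rateExt (h.continue n).2 b) ∂(actionKernel π n (h, u)) :=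
  Measure.lintegral_bind (M.measurable_rateExt.comp measurable_prodMk_left).aemeasurable
    hf.aemeasurable

lemma intensity_eq_zero {n : ℕ} {h : Hist S n} (hh : (h.continue n).2 = Sum.inr ()) (u : ℝ) :
    intensity π n h u = 0 := by
  refine Measure.ext fun Γ hΓ => ?_
  rw [← lintegral_indicator_one hΓ,
    lintegral_intensity π n h u (measurable_one.indicator hΓ), hh]
  simp [rateExt]

lemma measurableSet_inr : MeasurableSet {z : S ⊕ Unit | z = Sum.inr ()} := by
  have : {z : S ⊕ Unit | z = Sum.inr ()} = Set.range Sum.inr := by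
    ext z; rcases z with z | z <;> simp
  rw [this]
  exact measurableSet_range_inr

/-- `pathLaw` is a restriction to the sample space, and this shows that the restriction loses no
mass. New sojourn times are positive, an infinite one occurs only together with $x_\infty$, and the
intensity vanishes once $x_\infty$ is reached. -/
lemma ae_isPath [IsProbabilityMeasure γ] : ∀ᵐ ω ∂(seqLaw π γ), IsPath ω := by
  have h0 : ∀ᵐ ω ∂(seqLaw π γ), (ω 0).1 = 0 ∧ (ω 0).2 ≠ Sum.inr () := by
    have hm : MeasurableSet {h : Hist S 0 | (h.continue 0).1 = 0 ∧ (h.continue 0).2 ≠ Sum.inr ()} := by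
      have h1 : Measurable fun h : Hist S 0 => h.continue 0 :=
        (measurable_pi_apply 0).comp Hist.measurable_continue
      exact (measurable_fst.comp h1 (measurableSet_singleton 0)).inter
        (measurable_snd.comp h1 measurableSet_inr).compl
    have h2 := lintegral_histLaw_zero π γ (F := indicator
      {h : Hist S 0 | (h.continue 0).1 = 0 ∧ (h.continue 0).2 ≠ Sum.inr ()}ᶜ 1)
      (measurable_one.indicator hm.compl)
    rw [lintegral_histLaw π γ 0 (measurable_one.indicator hm.compl)] at h2
    have h3 : ∀ x : S, indicator
      {h : Hist S 0 | (h.continue 0).1 = 0 ∧ (h.continue 0).2 ≠ Sum.inr ()}ᶜ (1 : Hist S 0 → ℝ≥0∞)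
        (fun _ => (0, Sum.inl x)) = 0 := fun x => by
      rw [indicator_of_notMem]
      simp [Hist.continue]
    simp only [h3, lintegral_zero] at h2
    have hcm : Measurable fun ω : ℕ → Entry S => indicator
        {h : Hist S 0 | (h.continue 0).1 = 0 ∧ (h.continue 0).2 ≠ Sum.inr ()}ᶜ
        (1 : Hist S 0 → ℝ≥0∞) (Preorder.frestrictLe 0 ω) :=
      (measurable_one.indicator hm.compl).comp (measurable_frestrictLe 0)
    rw [lintegral_eq_zero_iff hcm] at h2
    filter_upwards [h2] with ω hω
    by_contra hcon
    rw [indicator_of_mem] at hω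
    · exact one_ne_zero hω
    · rw [mem_compl_iff, mem_ofPred_eq, Hist.continue_frestrictLe ω le_rfl]
      exact hcon
  have hs (n : ℕ) : ∀ᵐ ω ∂(seqLaw π γ), 0 < (ω (n + 1)).1 ∧
      ((ω (n + 1)).1 = ∞ ↔ (ω (n + 1)).2 = Sum.inr ()) ∧
      ((ω n).2 = Sum.inr () → (ω (n + 1)).2 = Sum.inr ()) := by
    let B : Set (Hist S n × Entry S) := {p | 0 < p.2.1 ∧ (p.2.1 = ∞ ↔ p.2.2 = Sum.inr ()) ∧
      ((p.1.continue n).2 = Sum.inr () → p.2.2 = Sum.inr ())}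
    have hB : MeasurableSet B := by
      have h1 : Measurable fun p : Hist S n × Entry S => (p.1.continue n).2 :=
        measurable_snd.comp ((measurable_pi_apply n).comp
          (Hist.measurable_continue.comp measurable_fst))
      have h2 : MeasurableSet {p : Hist S n × Entry S | p.2.2 = Sum.inr ()} :=
        (measurable_snd.comp measurable_snd) measurableSet_inr
      have h3 : Measurable fun p : Hist S n × Entry S => p.2.1 :=
        measurable_fst.comp measurable_snd
      refine (h3 measurableSet_Ioi).inter (MeasurableSet.inter ?_ ?_)
      · exact MeasurableSet.iff (h3 (measurableSet_singleton ∞)) h2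
      · exact MeasurableSet.imp (h1 measurableSet_inr) h2
    have h2 := lintegral_seqLaw_succ π γ n (F := indicator Bᶜ 1)
      (measurable_one.indicator hB.compl)
    have h3 : ∀ h : Hist S n, ∫⁻ e, indicator Bᶜ (1 : Hist S n × Entry S → ℝ≥0∞) (h, e)
        ∂(nextEntryKernel π n h) = 0 := fun h => by
      rw [lintegral_nextEntryKernel π n h (F := fun e => indicator Bᶜ 1 (h, e))
        ((measurable_one.indicator hB.compl).comp measurable_prodMk_left)]
      have h4 : indicator Bᶜ (1 : Hist S n × Entry S → ℝ≥0∞) (h, (∞, Sum.inr ())) = 0 := by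
        rw [indicator_of_notMem]
        simp [B]
      rw [h4, mul_zero, add_zero, setLIntegral_congr_fun (g := fun _ => 0) measurableSet_Ioi,
        lintegral_zero]
      intro u hu
      dsimp only
      by_cases hh : (h.continue n).2 = Sum.inr ()
      · rw [intensity_eq_zero π hh, lintegral_zero_measure, mul_zero]
      · have h5 : ∀ y : S, indicator Bᶜ (1 : Hist S n × Entry S → ℝ≥0∞)
            (h, (ENNReal.ofReal u, Sum.inl y)) = 0 := fun y => by
          rw [indicator_of_notMem]
          simp only [B, mem_compl_iff, mem_ofPred_eq, not_not]
          exact ⟨ENNReal.ofReal_pos.2 hu, by simp, fun h => absurd h hh⟩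
        simp only [h5, lintegral_zero, mul_zero]
    simp only [h3, lintegral_zero] at h2
    have hcm : Measurable fun ω : ℕ → Entry S =>
        indicator Bᶜ (1 : Hist S n × Entry S → ℝ≥0∞) (Preorder.frestrictLe n ω, ω (n + 1)) :=
      (measurable_one.indicator hB.compl).comp
        ((measurable_frestrictLe n).prodMk (measurable_pi_apply (n + 1)))
    rw [lintegral_eq_zero_iff hcm] at h2
    filter_upwards [h2] with ω hω
    have : ((Preorder.frestrictLe n ω : Hist S n), ω (n + 1)) ∈ B := by
      by_contra hcon
      rw [indicator_of_mem hcon] at hω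
      exact one_ne_zero hω
    simpa only [B, mem_ofPred_eq, Hist.continue_frestrictLe ω le_rfl] using this
  filter_upwards [h0, ae_all_iff.2 hs] with ω h1 h2
  exact ⟨h1.1, h1.2, h2⟩

lemma ae_histLaw_isPath [IsProbabilityMeasure γ] (n : ℕ) :
    ∀ᵐ h ∂(histLaw π γ n), IsPath h.continue := by
  refine (ae_map_iff (p := fun h : Hist S n => IsPath h.continue) (measurable_frestrictLe n).aemeasurable
    (Hist.measurable_continue measurableSet_isPath)).2 ?_
  filter_upwards [ae_isPath π γ] with ω hω
  exact isPath_continue hω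

end Laws

end CTMDP

/-! ### Further identities for hazard rates -/

lemma exp_neg_coe_add (a b : ℝ≥0∞) : EReal.exp (-((a + b : ℝ≥0∞) : EReal)) =
    EReal.exp (-(a : EReal)) * EReal.exp (-(b : EReal)) := by
  rw [← EReal.exp_add, EReal.coe_ennreal_add, EReal.neg_add, sub_eq_add_neg]
  · exact Or.inl (EReal.coe_ennreal_ne_bot a)
  · exact Or.inr (EReal.coe_ennreal_ne_bot b)

/-- Adding a killing rate to a hazard rate. -/
lemma lintegral_hazard_killing {g : ℝ → ℝ≥0∞} (hg : Measurable g) {C : ℝ≥0} (hC : ∀ u, g u ≤ C)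
    {α : ℝ} (hα : 0 < α) :
    ∫⁻ u in Ioi (0 : ℝ), ENNReal.ofReal (Real.exp (-α * u)) *
      EReal.exp (-((∫⁻ v in Ioc 0 u, g v : ℝ≥0∞) : EReal)) * (ENNReal.ofReal α + g u) = 1 := by
  have h := lintegral_hazard (g := fun u => ENNReal.ofReal α + g u) (hg.const_add _)
    (C := α.toNNReal + C) (fun u => by
      rw [ENNReal.coe_add]
      exact add_le_add le_rfl (hC u))
  -- With the constant rate $\alpha$ added, the total hazard is infinite, so the atom at infinity
  -- disappears.
  have htop : ∫⁻ v in Ioi (0 : ℝ), (ENNReal.ofReal α + g v) = ∞ := by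
    refine top_unique ?_
    calc ∞ = ∫⁻ v in Ioi (0 : ℝ), ENNReal.ofReal α := by
          rw [setLIntegral_const, Real.volume_Ioi, ENNReal.mul_top (by simpa using hα)]
      _ ≤ _ := lintegral_mono fun v => le_self_add
  rw [htop, EReal.coe_ennreal_top, EReal.neg_top, EReal.exp_bot, add_zero] at h
  rw [← h]
  refine setLIntegral_congr_fun measurableSet_Ioi fun u hu => ?_
  rw [lintegral_add_left measurable_const, setLIntegral_const, exp_neg_coe_add]
  congr 2
  rw [Real.volume_Ioc, sub_zero, ← ENNReal.ofReal_mul hα.le, EReal.coe_ennreal_ofReal,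
    max_eq_left (mul_nonneg hα.le (le_of_lt hu)), ← EReal.coe_neg, EReal.exp_coe, neg_mul]

/-- The tail of the law given by a hazard rate. -/
lemma lintegral_hazard_tail {g : ℝ → ℝ≥0∞} (hg : Measurable g) {C : ℝ≥0} (hC : ∀ u, g u ≤ C)
    {r : ℝ} (hr : 0 < r) :
    (∫⁻ u in Ici r, EReal.exp (-((∫⁻ v in Ioc 0 u, g v : ℝ≥0∞) : EReal)) * g u) +
      EReal.exp (-((∫⁻ v in Ioi (0 : ℝ), g v : ℝ≥0∞) : EReal)) =
    EReal.exp (-((∫⁻ v in Ioc 0 r, g v : ℝ≥0∞) : EReal)) := by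
  set s : ℝ → ℝ≥0∞ := fun u => EReal.exp (-((∫⁻ v in Ioc 0 u, g v : ℝ≥0∞) : EReal)) with hs
  have h1 := lintegral_hazard hg hC
  -- Switching the rate off from $r$ on moves the whole tail to the atom at infinity, whose mass
  -- becomes the survival probability at $r$. The two laws agree before $r$, and that common part is
  -- cancelled.
  have h2 := lintegral_hazard (g := (Iio r).indicator g) (hg.indicator measurableSet_Iio) (C := C)
    fun u => (indicator_le_self' (fun _ _ => zero_le) u).trans (hC u)
  have h3 : ∫⁻ v in Ioi (0 : ℝ), (Iio r).indicator g v = ∫⁻ v in Ioc 0 r, g v := by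
    rw [lintegral_indicator measurableSet_Iio, Measure.restrict_restrict measurableSet_Iio,
      restrict_Ioo_eq_restrict_Ioc.symm]
    congr 2
    ext x
    simp [and_comm]
  have h4 : ∫⁻ u in Ioi (0 : ℝ), EReal.exp (-((∫⁻ v in Ioc 0 u, (Iio r).indicator g v :
      ℝ≥0∞) : EReal)) * (Iio r).indicator g u = ∫⁻ u in Ioo 0 r, s u * g u := by
    rw [show Ioo (0 : ℝ) r = Iio r ∩ Ioi 0 by ext x; simp [and_comm],
      ← Measure.restrict_restrict measurableSet_Iio, ← lintegral_indicator measurableSet_Iio]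
    refine lintegral_congr fun u => ?_
    by_cases hu : u ∈ Iio r
    · rw [indicator_of_mem hu, indicator_of_mem hu]
      have : ∫⁻ v in Ioc 0 u, (Iio r).indicator g v = ∫⁻ v in Ioc 0 u, g v :=
        setLIntegral_congr_fun measurableSet_Ioc fun v hv =>
          indicator_of_mem (show v ∈ Iio r from lt_of_le_of_lt hv.2 hu) g
      rw [this]
    · rw [indicator_of_notMem hu, indicator_of_notMem hu, mul_zero]
  rw [h3, h4] at h2
  have h5 : ∫⁻ u in Ioi (0 : ℝ), s u * g u =
      (∫⁻ u in Ioo 0 r, s u * g u) + ∫⁻ u in Ici r, s u * g u := by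
    rw [← lintegral_union measurableSet_Ici, Ioo_union_Ici_eq_Ioi hr]
    rw [Set.disjoint_left]
    exact fun x hx hx' => absurd hx.2 (not_lt.2 hx')
  have h1' : (∫⁻ u in Ioi (0 : ℝ), s u * g u) +
      EReal.exp (-((∫⁻ v in Ioi (0 : ℝ), g v : ℝ≥0∞) : EReal)) = 1 := h1
  rw [h5, add_assoc, ← h2] at h1'
  refine (ENNReal.add_right_inj ?_).1 h1'
  refine ne_top_of_le_ne_top ENNReal.one_ne_top ?_
  rw [← h2]
  exact le_self_add

/-! ### Discounted occupation during one sojourn -/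

namespace CTMDP

variable {S A : Type*} [MeasurableSpace S] [MeasurableSpace A]
variable [StandardBorelSpace S] {M : CTMDP S A} (π : M.Policy) (γ : Measure S) (α : ℝ)

section Occupation

/-- The discount factor at a possibly infinite time (the value at `∞` is irrelevant). -/
noncomputable def discount (T : ℝ≥0∞) : ℝ≥0∞ := ENNReal.ofReal (Real.exp (-α * T.toReal))

lemma measurable_discount : Measurable (discount α) := by
  unfold discount
  fun_prop

lemma discount_add {T : ℝ≥0∞} (hT : T ≠ ∞) {u : ℝ} (hu : 0 ≤ u) :
    discount α (T + ENNReal.ofReal u) = discount α T * ENNReal.ofReal (Real.exp (-α * u)) := by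
  unfold discount
  rw [← ENNReal.ofReal_mul (Real.exp_pos _).le, ← Real.exp_add,
    ENNReal.toReal_add hT ENNReal.ofReal_ne_top, ENNReal.toReal_ofReal hu, mul_add]

/-- A function of the state, extended by zero to the isolated point. -/
def stateVal (f : S → ℝ≥0∞) : S ⊕ Unit → ℝ≥0∞ := Sum.elim f fun _ => 0

lemma measurable_stateVal {f : S → ℝ≥0∞} (hf : Measurable f) : Measurable (stateVal f) :=
  Measurable.sumElim hf measurable_const

lemma measurable_jumpTime_continue (n : ℕ) :
    Measurable fun h : Hist S n => jumpTime n h.continue :=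
  (measurable_jumpTime n).comp Hist.measurable_continue

lemma measurable_continue_state (n : ℕ) :
    Measurable fun h : Hist S n => (h.continue n).2 :=
  measurable_snd.comp ((measurable_pi_apply n).comp Hist.measurable_continue)

/-- The discount factor at the time `u` after the `n`-th jump times the probability of no further
jump until then. -/
noncomputable def sojournWeight (n : ℕ) (p : Hist S n × ℝ) : ℝ≥0∞ :=
  discount α (jumpTime n p.1.continue) *
    (ENNReal.ofReal (Real.exp (-α * p.2)) * survival π n p.1 p.2)

lemma measurable_sojournWeight (n : ℕ) : Measurable (sojournWeight π α n) := by
  refine Measurable.mul ?_ (Measurable.mul (by fun_prop) (measurable_survival π n))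
  exact (measurable_discount α).comp ((measurable_jumpTime_continue n).comp measurable_fst)

/-- The discounted occupation measure of states and actions during the sojourn after the `n`-th
jump. -/
noncomputable def occupation (n : ℕ) : Measure (S × A) :=
  (((((histLaw π γ n).prod (volume.restrict (Ioi (0 : ℝ)))).withDensity (sojournWeight π α n)) ⊗ₘ
    actionKernel π n).map fun p => ((p.1.1.continue n).2, p.2)).comap (Prod.map Sum.inl Sum.inl)

/-- The discounted expectation of `f` at the state after the `n`-th jump. -/
noncomputable def jumpValue (n : ℕ) (f : S → ℝ≥0∞) : ℝ≥0∞ :=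
  ∫⁻ h, discount α (jumpTime n h.continue) * stateVal f (h.continue n).2 ∂(histLaw π γ n)

/-- The mean of a function of state and action at the time `u` after the `n`-th jump. -/
noncomputable def actionMean (n : ℕ) (G : S × A → ℝ≥0∞) (p : Hist S n × ℝ) : ℝ≥0∞ :=
  ∫⁻ b, extZero G ((p.1.continue n).2, b) ∂(actionKernel π n p)

lemma measurable_actionMean_integrand (n : ℕ) {G : S × A → ℝ≥0∞} (hG : Measurable G) :
    Measurable fun p : (Hist S n × ℝ) × (A ⊕ Unit) => extZero G ((p.1.1.continue n).2, p.2) :=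
  (measurable_extZero hG).comp (((measurable_continue_state n).comp
    (measurable_fst.comp measurable_fst)).prodMk measurable_snd)

lemma measurable_actionMean (n : ℕ) {G : S × A → ℝ≥0∞} (hG : Measurable G) :
    Measurable (actionMean π n G) :=
  Measurable.lintegral_kernel_prod_right (κ := actionKernel π n)
    (f := fun p b => extZero G ((p.1.continue n).2, b)) (measurable_actionMean_integrand n hG)

lemma actionMean_of_inr {n : ℕ} {h : Hist S n} (hh : (h.continue n).2 = Sum.inr ())
    (G : S × A → ℝ≥0∞) (u : ℝ) : actionMean π n G (h, u) = 0 := by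
  simp only [actionMean, hh, extZero_inr_left, lintegral_zero]

lemma lintegral_occupation [IsProbabilityMeasure γ] (n : ℕ) {G : S × A → ℝ≥0∞}
    (hG : Measurable G) :
    ∫⁻ p, G p ∂(occupation π γ α n) = ∫⁻ h, (∫⁻ u in Ioi (0 : ℝ),
      sojournWeight π α n (h, u) * actionMean π n G (h, u)) ∂(histLaw π γ n) := by
  set ν := (((((histLaw π γ n).prod (volume.restrict (Ioi (0 : ℝ)))).withDensity
    (sojournWeight π α n)) ⊗ₘ actionKernel π n).map
      fun p => ((p.1.1.continue n).2, p.2)) with hν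
  -- Pulling back along the inclusion discards the isolated points, where the extension by zero
  -- vanishes.
  have h1 : ∫⁻ p, G p ∂(occupation π γ α n) = ∫⁻ p, extZero G p ∂ν := by
    have h2 : ∫⁻ p, extZero G p ∂ν =
        ∫⁻ p in range (Prod.map Sum.inl Sum.inl : S × A → (S ⊕ Unit) × (A ⊕ Unit)),
          extZero G p ∂ν := by
      rw [← lintegral_indicator measurableEmbedding_inl_inl.measurableSet_range]
      refine lintegral_congr fun p => ?_
      by_cases hp : p ∈ range (Prod.map Sum.inl Sum.inl : S × A → (S ⊕ Unit) × (A ⊕ Unit))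
      · rw [indicator_of_mem hp]
      · rw [indicator_of_notMem hp]
        exact Function.extend_apply' _ _ _ hp
    rw [h2, ← measurableEmbedding_inl_inl.map_comap, measurableEmbedding_inl_inl.lintegral_map]
    exact lintegral_congr fun p => (extZero_inl_inl G p.1 p.2).symm
  have h3 : Measurable fun p : (Hist S n × ℝ) × (A ⊕ Unit) => ((p.1.1.continue n).2, p.2) :=
    ((measurable_continue_state n).comp (measurable_fst.comp measurable_fst)).prodMk measurable_snd
  have hw := measurable_sojournWeight π α n
  have hm := measurable_actionMean π n hG
  rw [h1, hν, lintegral_map (measurable_extZero hG) h3,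
    Measure.lintegral_compProd (measurable_actionMean_integrand n hG)]
  refine (lintegral_withDensity_eq_lintegral_mul _ hw hm).trans ?_
  rw [lintegral_prod _ (hw.mul hm).aemeasurable]
  rfl

lemma jumpTime_ne_top {n : ℕ} {ω : ℕ → Entry S} (hω : IsPath ω) {x : S}
    (hx : (ω n).2 = Sum.inl x) : jumpTime n ω ≠ ∞ := fun h => by
  rw [ne_inr_of_isPath_of_jumpTime_eq_top hω h] at hx
  simp at hx

lemma leftState_continue {n : ℕ} {h : Hist S n} (hh : IsPath h.continue) {x : S}
    (hx : (h.continue n).2 = Sum.inl x) {u : ℝ} (hu : 0 < u) :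
    leftState ((jumpTime n h.continue).toNNReal + u.toNNReal) h.continue = Sum.inl x := by
  have hT := jumpTime_ne_top hh hx
  rw [← hx]
  refine leftState_eq ?_ ?_
  · rw [ENNReal.coe_add, ENNReal.coe_toNNReal hT]
    refine ENNReal.lt_add_right hT ?_
    simpa using hu
  · rw [jumpTime_succ_continue]
    exact le_top

lemma actionKernel_apply {n : ℕ} {h : Hist S n} (hh : IsPath h.continue) (u : ℝ) :
    actionKernel π n (h, u) =
      π.toFun ((jumpTime n h.continue).toNNReal + u.toNNReal) ⟨h.continue, hh⟩ :=
  dif_pos hh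

/-- Positivity of $u$ matters: at the jump time itself the left limit is in general still the state
before the jump, and the action is admissible for that state. -/
lemma ae_actionKernel {n : ℕ} {h : Hist S n} (hh : IsPath h.continue) {x : S}
    (hx : (h.continue n).2 = Sum.inl x) {u : ℝ} (hu : 0 < u) :
    ∀ᵐ b ∂(actionKernel π n (h, u)), b ∈ Sum.inl '' M.Adm x := by
  have h1 := π.concentrated ((jumpTime n h.continue).toNNReal + u.toNNReal) ⟨h.continue, hh⟩
  simp only [leftState_continue hh hx hu] at h1
  rw [actionKernel_apply π hh u]
  exact h1

lemma jumpValue_zero {f : S → ℝ≥0∞} (hf : Measurable f) :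
    jumpValue π γ α 0 f = ∫⁻ x, f x ∂γ := by
  unfold jumpValue
  rw [lintegral_histLaw_zero π γ (F := fun h : Hist S 0 =>
    discount α (jumpTime 0 h.continue) * stateVal f (h.continue 0).2)
    (((measurable_discount α).comp (measurable_jumpTime_continue 0)).mul
      ((measurable_stateVal hf).comp (measurable_continue_state 0)))]
  refine lintegral_congr fun x => ?_
  simp [discount, jumpTime, stateVal, Hist.continue]

/-- During a sojourn, the discounted time plus the jump intensity integrates to one. -/
lemma lintegral_occupation_killing [IsProbabilityMeasure γ] {α : ℝ} (hα : 0 < α) (n : ℕ)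
    {f : S → ℝ≥0∞} (hf : Measurable f) :
    ∫⁻ p, (ENNReal.ofReal α + M.jumpRate p.1 p.2 univ) * f p.1 ∂(occupation π γ α n) =
      jumpValue π γ α n f := by
  have hG : Measurable fun p : S × A =>
      (ENNReal.ofReal α + M.jumpRate p.1 p.2 univ) * f p.1 :=
    (((Measure.measurable_coe MeasurableSet.univ).comp M.measurable_jumpRate).const_add _).mul
      (hf.comp measurable_fst)
  rw [lintegral_occupation π γ α n hG]
  refine lintegral_congr_ae ?_
  filter_upwards [ae_histLaw_isPath π γ n] with h hh
  rcases hx : (h.continue n).2 with x | x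
  · have h1 : ∀ u ∈ Ioi (0 : ℝ), sojournWeight π α n (h, u) * actionMean π n (fun p : S × A =>
        (ENNReal.ofReal α + M.jumpRate p.1 p.2 univ) * f p.1) (h, u) =
        (discount α (jumpTime n h.continue) * f x) * (ENNReal.ofReal (Real.exp (-α * u)) *
          survival π n h u * (ENNReal.ofReal α + intensity π n h u univ)) := fun u hu => by
      have h2 : actionMean π n (fun p : S × A =>
          (ENNReal.ofReal α + M.jumpRate p.1 p.2 univ) * f p.1) (h, u) =
          (ENNReal.ofReal α + intensity π n h u univ) * f x := by
        have hm : Measurable fun b => M.rateExt (Sum.inl x) b univ :=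
          (Measure.measurable_coe MeasurableSet.univ).comp
            (M.measurable_rateExt.comp measurable_prodMk_left)
        have h3 := lintegral_intensity π n h u (f := 1) measurable_one
        simp only [Pi.one_apply, lintegral_one] at h3
        rw [h3, hx]
        calc actionMean π n (fun p : S × A =>
              (ENNReal.ofReal α + M.jumpRate p.1 p.2 univ) * f p.1) (h, u)
            = ∫⁻ b, (ENNReal.ofReal α + M.rateExt (Sum.inl x) b univ) * f x
                ∂(actionKernel π n (h, u)) := by
              refine lintegral_congr_ae ?_
              filter_upwards [ae_actionKernel π hh hx hu] with b hb
              obtain ⟨a, -, rfl⟩ := hb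
              simp only [hx, extZero_inl_inl]
              rfl
          _ = _ := by
              rw [lintegral_mul_const _ (hm.const_add _), lintegral_add_left measurable_const,
                lintegral_const, measure_univ, mul_one]
      rw [h2]
      unfold sojournWeight
      ring
    rw [setLIntegral_congr_fun measurableSet_Ioi h1]
    have hg := (measurable_intensity_univ π n).comp (measurable_prodMk_left (x := h))
    obtain ⟨C, hC⟩ := exists_intensity_le π n h
    rw [lintegral_const_mul]
    · have := lintegral_hazard_killing hg hC hα
      simp only [Function.comp_def] at this
      rw [show (∫⁻ u in Ioi (0 : ℝ), ENNReal.ofReal (Real.exp (-α * u)) * survival π n h u *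
        (ENNReal.ofReal α + intensity π n h u univ)) = 1 from this, mul_one]
      rfl
    · exact (Measurable.mul (by fun_prop)
        ((measurable_survival π n).comp measurable_prodMk_left)).mul (hg.const_add _)
  · simp only [actionMean_of_inr π hx, mul_zero, lintegral_zero]
    simp [stateVal]

/-- The discounted state after a jump in terms of the occupation measure before the jump. -/
lemma jumpValue_succ [IsProbabilityMeasure γ] (n : ℕ) {f : S → ℝ≥0∞} (hf : Measurable f) :
    jumpValue π γ α (n + 1) f =
      ∫⁻ p, ∫⁻ y, f y ∂(M.jumpRate p.1 p.2) ∂(occupation π γ α n) := by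
  have hG : Measurable fun p : S × A => ∫⁻ y, f y ∂(M.jumpRate p.1 p.2) :=
    (Measure.measurable_lintegral hf).comp M.measurable_jumpRate
  have hF : Measurable fun p : Hist S n × Entry S =>
      discount α (jumpTime n p.1.continue + p.2.1) * stateVal f p.2.2 :=
    ((measurable_discount α).comp (((measurable_jumpTime_continue n).comp measurable_fst).add
      (measurable_fst.comp measurable_snd))).mul
      ((measurable_stateVal hf).comp (measurable_snd.comp measurable_snd))
  have h1 : jumpValue π γ α (n + 1) f = ∫⁻ ω, discount α
      (jumpTime n (Hist.continue (Preorder.frestrictLe n ω : Hist S n)) + (ω (n + 1)).1) *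
      stateVal f (ω (n + 1)).2 ∂(seqLaw π γ) := by
    unfold jumpValue
    rw [lintegral_histLaw π γ (n + 1) (F := fun h : Hist S (n + 1) =>
      discount α (jumpTime (n + 1) h.continue) * stateVal f (h.continue (n + 1)).2)
      (((measurable_discount α).comp (measurable_jumpTime_continue (n + 1))).mul
        ((measurable_stateVal hf).comp (measurable_continue_state (n + 1))))]
    refine lintegral_congr fun ω => ?_
    rw [jumpTime_continue_frestrictLe, Hist.continue_frestrictLe ω le_rfl,
      jumpTime_continue_frestrictLe, jumpTime_succ]
  refine h1.trans ((lintegral_seqLaw_succ π γ n hF).trans ?_)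
  refine Eq.trans ?_ (lintegral_occupation π γ α n hG).symm
  refine lintegral_congr_ae ?_
  filter_upwards [ae_histLaw_isPath π γ n] with h hh
  have hFh : Measurable fun e : Entry S =>
      discount α (jumpTime n h.continue + e.1) * stateVal f e.2 :=
    ((measurable_discount α).comp (measurable_fst.const_add _)).mul
      ((measurable_stateVal hf).comp measurable_snd)
  refine (lintegral_nextEntryKernel π n h hFh).trans ?_
  -- The atom without a further jump contributes nothing, which is why the discount factor at
  -- infinity is irrelevant.
  rw [show stateVal f (Sum.inr ()) = 0 from rfl, mul_zero, mul_zero, add_zero]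
  refine setLIntegral_congr_fun measurableSet_Ioi fun u hu => ?_
  dsimp only
  rcases hx : (h.continue n).2 with x | x
  · have hT := jumpTime_ne_top hh hx
    rw [discount_add α hT (le_of_lt hu)]
    simp only [stateVal, Sum.elim_inl]
    rw [lintegral_const_mul _ hf, lintegral_intensity π n h u hf, hx]
    have h2 : ∀ b, ∫⁻ y, f y ∂(M.rateExt (Sum.inl x) b) =
        extZero (fun p : S × A => ∫⁻ y, f y ∂(M.jumpRate p.1 p.2)) (Sum.inl x, b) := by
      rintro (a | a)
      · rw [extZero_inl_inl]; rfl
      · rw [extZero_inr_right]; simp [rateExt]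
    unfold sojournWeight actionMean
    simp only [h2, hx]
    ring
  · rw [intensity_eq_zero π hx, lintegral_zero_measure, actionMean_of_inr π hx, mul_zero, mul_zero]

/-- The event contains the atom at infinity, so its mass is the tail of the density plus that atom,
as in `lintegral_hazard_tail`. -/
lemma nextEntryKernel_tail (n : ℕ) (h : Hist S n) {r : ℝ} (hr : 0 < r) :
    nextEntryKernel π n h {e | ENNReal.ofReal r ≤ e.1} = survival π n h r := by
  have hm : MeasurableSet {e : Entry S | ENNReal.ofReal r ≤ e.1} :=
    measurableSet_le measurable_const measurable_fst
  obtain ⟨C, hC⟩ := exists_intensity_le π n h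
  have hg := (measurable_intensity_univ π n).comp (measurable_prodMk_left (x := h))
  rw [← lintegral_indicator_one hm, lintegral_nextEntryKernel π n h (measurable_one.indicator hm)]
  rw [indicator_of_mem (show ((∞, Sum.inr ()) : Entry S) ∈ {e : Entry S | ENNReal.ofReal r ≤ e.1} from le_top (a := ENNReal.ofReal r)), Pi.one_apply, mul_one]
  refine Eq.trans ?_ (lintegral_hazard_tail hg hC hr)
  unfold survivalTop
  congr 1
  rw [show Ici r = Ici r ∩ Ioi 0 by
      ext x
      simp only [mem_Ici, mem_inter_iff, mem_Ioi]
      exact ⟨fun h => ⟨h, hr.trans_le h⟩, fun h => h.1⟩,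
    ← Measure.restrict_restrict measurableSet_Ici, ← lintegral_indicator measurableSet_Ici]
  refine setLIntegral_congr_fun measurableSet_Ioi fun u hu => ?_
  by_cases hur : r ≤ u
  · rw [indicator_of_mem (show u ∈ Ici r from hur)]
    have h1 : ∀ y : S, indicator {e : Entry S | ENNReal.ofReal r ≤ e.1} (1 : Entry S → ℝ≥0∞)
        (ENNReal.ofReal u, Sum.inl y) = 1 := fun y =>
      indicator_of_mem (s := {e : Entry S | ENNReal.ofReal r ≤ e.1})
        (show ENNReal.ofReal r ≤ ENNReal.ofReal u from ENNReal.ofReal_le_ofReal hur) _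
    simp only [h1, lintegral_one]
    rfl
  · rw [indicator_of_notMem (show u ∉ Ici r from hur)]
    have h1 : ∀ y : S, indicator {e : Entry S | ENNReal.ofReal r ≤ e.1} (1 : Entry S → ℝ≥0∞)
        (ENNReal.ofReal u, Sum.inl y) = 0 := fun y => by
      refine indicator_of_notMem (s := {e : Entry S | ENNReal.ofReal r ≤ e.1}) (fun hc => hur ?_) _
      exact (ENNReal.ofReal_le_ofReal_iff (le_of_lt hu)).1 hc
    simp only [h1, lintegral_zero, mul_zero]

end Occupation

end CTMDP

/-! ### From trajectories to the total occupation measure -/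

namespace CTMDP

variable {S A : Type*} [MeasurableSpace S] [MeasurableSpace A]
variable [StandardBorelSpace S] {M : CTMDP S A} (π : M.Policy) (γ : Measure S) (α : ℝ)

section TotalOccupation

/-- The discounted integral over the sojourn after the `n`-th jump, given the history and the next
entry. -/
noncomputable def sojournIntegral (n : ℕ) (G : S × A → ℝ≥0∞) (p : Hist S n × Entry S) : ℝ≥0∞ :=
  ∫⁻ u in Ioi (0 : ℝ), {q : (Hist S n × Entry S) × ℝ | ENNReal.ofReal q.2 ≤ q.1.2.1}.indicator 1
    (p, u) * (discount α (jumpTime n p.1.continue) * ENNReal.ofReal (Real.exp (-α * u)) *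
      actionMean π n G (p.1, u))

lemma measurable_sojournIntegrand (n : ℕ) {G : S × A → ℝ≥0∞} (hG : Measurable G) :
    Measurable fun q : (Hist S n × Entry S) × ℝ =>
      {q : (Hist S n × Entry S) × ℝ | ENNReal.ofReal q.2 ≤ q.1.2.1}.indicator 1 q *
        (discount α (jumpTime n q.1.1.continue) * ENNReal.ofReal (Real.exp (-α * q.2)) *
          actionMean π n G (q.1.1, q.2)) := by
  have h1 : MeasurableSet {q : (Hist S n × Entry S) × ℝ | ENNReal.ofReal q.2 ≤ q.1.2.1} :=
    measurableSet_le measurable_snd.ennreal_ofReal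
      (measurable_fst.comp (measurable_snd.comp measurable_fst))
  have h2 : Measurable fun q : (Hist S n × Entry S) × ℝ => q.1.1 :=
    measurable_fst.comp measurable_fst
  have h3 : Measurable fun q : (Hist S n × Entry S) × ℝ =>
      ENNReal.ofReal (Real.exp (-α * q.2)) := by fun_prop
  have h4 : Measurable fun q : (Hist S n × Entry S) × ℝ =>
      discount α (jumpTime n q.1.1.continue) :=
    (measurable_discount α).comp ((measurable_jumpTime_continue n).comp h2)
  exact (measurable_one.indicator h1).mul ((h4.mul h3).mul
    ((measurable_actionMean π n hG).comp (h2.prodMk measurable_snd)))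

lemma measurable_sojournIntegral (n : ℕ) {G : S × A → ℝ≥0∞} (hG : Measurable G) :
    Measurable (sojournIntegral π α n G) :=
  (measurable_sojournIntegrand π α n hG).lintegral_prod_right' (ν := volume.restrict (Ioi (0 : ℝ)))

/-- By Tonelli the next entry is integrated out first. The indicator that the sojourn lasts at least
$u$ then turns into the survival probability, the weight in the occupation measure. -/
lemma lintegral_sojournIntegral [IsProbabilityMeasure γ] (n : ℕ) {G : S × A → ℝ≥0∞}
    (hG : Measurable G) :
    ∫⁻ ω, sojournIntegral π α n G ((Preorder.frestrictLe n ω : Hist S n), ω (n + 1))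
      ∂(seqLaw π γ) = ∫⁻ p, G p ∂(occupation π γ α n) := by
  refine (lintegral_seqLaw_succ π γ n (measurable_sojournIntegral π α n hG)).trans ?_
  refine Eq.trans ?_ (lintegral_occupation π γ α n hG).symm
  refine lintegral_congr fun h => ?_
  unfold sojournIntegral
  have hm : Measurable fun q : Entry S × ℝ =>
      {q : (Hist S n × Entry S) × ℝ | ENNReal.ofReal q.2 ≤ q.1.2.1}.indicator
        (1 : (Hist S n × Entry S) × ℝ → ℝ≥0∞) ((h, q.1), q.2) *
        (discount α (jumpTime n h.continue) * ENNReal.ofReal (Real.exp (-α * q.2)) *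
          actionMean π n G (h, q.2)) :=
    (measurable_sojournIntegrand π α n hG).comp
      ((measurable_const.prodMk measurable_fst).prodMk measurable_snd)
  refine (lintegral_lintegral_swap hm.aemeasurable).trans ?_
  refine setLIntegral_congr_fun measurableSet_Ioi fun u hu => ?_
  have hu' : MeasurableSet {e : Entry S | ENNReal.ofReal u ≤ e.1} :=
    measurableSet_le measurable_const measurable_fst
  have h1 : ∀ e : Entry S, {q : (Hist S n × Entry S) × ℝ |
      ENNReal.ofReal q.2 ≤ q.1.2.1}.indicator (1 : (Hist S n × Entry S) × ℝ → ℝ≥0∞) ((h, e), u) =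
      {e : Entry S | ENNReal.ofReal u ≤ e.1}.indicator 1 e := fun e => rfl
  simp only [h1]
  rw [lintegral_mul_const _ (measurable_one.indicator hu'), lintegral_indicator_one hu',
    nextEntryKernel_tail π n h hu]
  unfold sojournWeight
  ring

/-- The discounted integral along a trajectory. -/
noncomputable def pathIntegral (G : S × A → ℝ≥0∞) (ω : ℕ → Entry S) : ℝ≥0∞ :=
  ∫⁻ t in Ioi (0 : ℝ), ENNReal.ofReal (Real.exp (-α * t)) *
    ∫⁻ b, extZero G (leftState t.toNNReal ω, b) ∂(π.ext (t.toNNReal, ω))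

lemma discounted_eq_lintegral_pathIntegral [IsProbabilityMeasure γ] (G : S × A → ℝ≥0∞) :
    discounted π γ α (fun z b => extZero G (z, b)) =
      ∫⁻ ω, pathIntegral π α G ω ∂(seqLaw π γ) := by
  have h1 : discounted π γ α (fun z b => extZero G (z, b)) =
      ∫⁻ ω : {ω // IsPath ω}, pathIntegral π α G ω.1 ∂((seqLaw π γ).comap Subtype.val) := by
    refine lintegral_congr fun ω => ?_
    refine lintegral_congr fun t => ?_
    rw [show π.ext (t.toNNReal, ω.1) = π.toFun t.toNNReal ω from dif_pos ω.2]
  rw [h1]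
  refine (lintegral_subtype_comap measurableSet_isPath _).trans ?_
  rw [Measure.restrict_eq_self_of_ae_mem (s := {ω | IsPath ω}) (ae_isPath π γ)]

/-- For $T_n<t\le T_{n+1}$ the left state is $x_n$, and predictability replaces the policy by its
value on the trajectory without further jumps. After the shift $t=T_n+u$ the integrand depends on
the history alone. -/
lemma setLIntegral_sojourn {G : S × A → ℝ≥0∞} {ω : ℕ → Entry S} (hω : IsPath ω) (n : ℕ) :
    ∫⁻ t in {t : ℝ | 0 < t ∧ jumpTime n ω < ENNReal.ofReal t ∧
      ENNReal.ofReal t ≤ jumpTime (n + 1) ω}, ENNReal.ofReal (Real.exp (-α * t)) *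
        ∫⁻ b, extZero G (leftState t.toNNReal ω, b) ∂(π.ext (t.toNNReal, ω)) =
      sojournIntegral π α n G ((Preorder.frestrictLe n ω : Hist S n), ω (n + 1)) := by
  unfold sojournIntegral
  -- After absorption the time interval is empty and the action mean is zero, so both sides vanish;
  -- otherwise the translation by $T_n$ makes sense.
  by_cases hT : jumpTime n ω = ∞
  · have hx := ne_inr_of_isPath_of_jumpTime_eq_top hω hT
    have hx' : (Hist.continue (Preorder.frestrictLe n ω : Hist S n) n).2 = Sum.inr () := by
      rw [Hist.continue_frestrictLe ω le_rfl, hx]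
    simp only [actionMean_of_inr π hx', hT, not_top_lt, false_and, and_false, ofPred_false,
      Measure.restrict_empty, lintegral_zero_measure, mul_zero, lintegral_zero]
  set T := (jumpTime n ω).toReal with hTdef
  have hT0 : 0 ≤ T := ENNReal.toReal_nonneg
  have hTT : jumpTime n ω = ENNReal.ofReal T := (ENNReal.ofReal_toReal hT).symm
  have hmeas : MeasurableSet {t : ℝ | 0 < t ∧ jumpTime n ω < ENNReal.ofReal t ∧
      ENNReal.ofReal t ≤ jumpTime (n + 1) ω} :=
    measurableSet_Ioi.inter ((measurableSet_lt measurable_const ENNReal.measurable_ofReal).inter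
      (measurableSet_le ENNReal.measurable_ofReal measurable_const))
  rw [← lintegral_indicator hmeas, ← lintegral_add_left_eq_self _ T,
    ← lintegral_indicator measurableSet_Ioi]
  refine lintegral_congr fun u => ?_
  by_cases hu : 0 < u
  swap
  · rw [indicator_of_notMem (show u ∉ Ioi 0 from hu), indicator_of_notMem]
    rintro ⟨-, h2, -⟩
    rw [hTT] at h2
    exact absurd (ENNReal.ofReal_le_ofReal (by linarith : T + u ≤ T)) (not_le.2 h2)
  rw [indicator_of_mem (show u ∈ Ioi 0 from hu)]
  have hadd : ENNReal.ofReal (T + u) = jumpTime n ω + ENNReal.ofReal u := by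
    rw [ENNReal.ofReal_add hT0 hu.le, hTT]
  by_cases hle : ENNReal.ofReal u ≤ (ω (n + 1)).1
  · have h1 : jumpTime n ω < ENNReal.ofReal (T + u) := by
      rw [hadd]
      exact ENNReal.lt_add_right hT (by simpa using hu)
    have h2 : ENNReal.ofReal (T + u) ≤ jumpTime (n + 1) ω := by
      rw [hadd, jumpTime_succ]
      exact add_le_add le_rfl hle
    rw [indicator_of_mem (show T + u ∈ {t : ℝ | 0 < t ∧ jumpTime n ω < ENNReal.ofReal t ∧
      ENNReal.ofReal t ≤ jumpTime (n + 1) ω} from ⟨by linarith, h1, h2⟩), indicator_of_mem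
      (show (((Preorder.frestrictLe n ω : Hist S n), ω (n + 1)), u) ∈
        {q : (Hist S n × Entry S) × ℝ | ENNReal.ofReal q.2 ≤ q.1.2.1} from hle), Pi.one_apply,
      one_mul]
    have hpath := isPath_continue (n := n) hω
    have hnn : (T + u).toNNReal = (jumpTime n (Hist.continue
        (Preorder.frestrictLe n ω : Hist S n))).toNNReal + u.toNNReal := by
      rw [jumpTime_continue_frestrictLe, Real.toNNReal_add hT0 hu.le, hTdef,
        ENNReal.toNNReal_toReal_eq]
    have hker : π.ext ((T + u).toNNReal, ω) =
        actionKernel π n ((Preorder.frestrictLe n ω : Hist S n), u) := by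
      rw [actionKernel_apply π hpath, ← hnn,
        show π.ext ((T + u).toNNReal, ω) = π.toFun (T + u).toNNReal ⟨ω, hω⟩ from dif_pos hω]
      refine π.toFun_congr (n := n) (by simpa using by linarith)
        (fun k hk => (Hist.continue_frestrictLe ω hk).symm) h2 ?_
      show _ ≤ jumpTime (n + 1) (Hist.continue (Preorder.frestrictLe n ω : Hist S n))
      rw [jumpTime_succ_continue]
      exact le_top
    have hleft : leftState (T + u).toNNReal ω = (ω n).2 := leftState_eq h1 h2
    rw [hker, hleft, jumpTime_continue_frestrictLe]
    unfold actionMean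
    simp only [Hist.continue_frestrictLe ω le_rfl]
    congr 1
    unfold discount
    rw [← ENNReal.ofReal_mul (Real.exp_pos _).le, ← Real.exp_add, mul_add]
  · rw [indicator_of_notMem, indicator_of_notMem (show
      (((Preorder.frestrictLe n ω : Hist S n), ω (n + 1)), u) ∉
        {q : (Hist S n × Entry S) × ℝ | ENNReal.ofReal q.2 ≤ q.1.2.1} from hle), zero_mul]
    rintro ⟨-, -, h2⟩
    rw [hadd, jumpTime_succ] at h2
    exact hle ((ENNReal.add_le_add_iff_left hT).1 h2)

/-- The sojourn intervals are disjoint, and at every other positive time the left state is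
$x_\infty$, where the integrand is zero. Explosion therefore needs no separate treatment. -/
lemma pathIntegral_eq_tsum {G : S × A → ℝ≥0∞} {ω : ℕ → Entry S} (hω : IsPath ω) :
    pathIntegral π α G ω = ∑' n, sojournIntegral π α n G
      ((Preorder.frestrictLe n ω : Hist S n), ω (n + 1)) := by
  have hmeas (n : ℕ) : MeasurableSet {t : ℝ | 0 < t ∧ jumpTime n ω < ENNReal.ofReal t ∧
      ENNReal.ofReal t ≤ jumpTime (n + 1) ω} :=
    measurableSet_Ioi.inter ((measurableSet_lt measurable_const ENNReal.measurable_ofReal).inter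
      (measurableSet_le ENNReal.measurable_ofReal measurable_const))
  have hdisj : Pairwise (Function.onFun Disjoint fun n : ℕ => {t : ℝ | 0 < t ∧
      jumpTime n ω < ENNReal.ofReal t ∧ ENNReal.ofReal t ≤ jumpTime (n + 1) ω}) := by
    have key : ∀ i j (t : ℝ), jumpTime i ω < ENNReal.ofReal t →
        ENNReal.ofReal t ≤ jumpTime (j + 1) ω → i ≤ j := by
      intro i j t hi hj
      by_contra hlt
      exact absurd (hj.trans (jumpTime_mono ω (by omega : j + 1 ≤ i))) (not_le.2 hi)
    intro i j hij
    rw [Function.onFun, Set.disjoint_left]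
    rintro t ⟨-, h1, h2⟩ ⟨-, h3, h4⟩
    exact hij (le_antisymm (key _ _ _ h1 h4) (key _ _ _ h3 h2))
  simp only [← setLIntegral_sojourn π α hω]
  rw [← lintegral_iUnion hmeas hdisj]
  unfold pathIntegral
  rw [← lintegral_indicator measurableSet_Ioi, ← lintegral_indicator (MeasurableSet.iUnion hmeas)]
  refine lintegral_congr fun t => ?_
  by_cases ht : 0 < t
  swap
  · rw [indicator_of_notMem (show t ∉ Ioi 0 from ht), indicator_of_notMem]
    intro h
    obtain ⟨n, hn⟩ := mem_iUnion.1 h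
    exact ht hn.1
  rw [indicator_of_mem (show t ∈ Ioi 0 from ht)]
  by_cases hex : ∃ n, jumpTime n ω < ENNReal.ofReal t ∧ ENNReal.ofReal t ≤ jumpTime (n + 1) ω
  · obtain ⟨n, h1, h2⟩ := hex
    have hmem : t ∈ ⋃ n : ℕ, {t : ℝ | 0 < t ∧ jumpTime n ω < ENNReal.ofReal t ∧
        ENNReal.ofReal t ≤ jumpTime (n + 1) ω} := mem_iUnion.2 ⟨n, ht, h1, h2⟩
    rw [indicator_of_mem hmem]
  · have hl : leftState t.toNNReal ω = Sum.inr () := by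
      classical
      unfold leftState
      rw [if_neg (by simpa using ht), dif_neg]
      exact hex
    rw [indicator_of_notMem, hl]
    · simp
    · intro h
      obtain ⟨n, hn⟩ := mem_iUnion.1 h
      exact hex ⟨n, hn.2⟩

/-- The total discounted occupation measure of states and actions. -/
noncomputable def totalOccupation : Measure (S × A) := Measure.sum (occupation π γ α)

/-- Discounted functionals are integrals with respect to the total occupation measure. -/
lemma discounted_eq_lintegral [IsProbabilityMeasure γ] {G : S × A → ℝ≥0∞} (hG : Measurable G) :
    discounted π γ α (fun z b => extZero G (z, b)) = ∫⁻ p, G p ∂(totalOccupation π γ α) := by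
  rw [discounted_eq_lintegral_pathIntegral, totalOccupation, lintegral_sum_measure]
  have h1 : ∫⁻ ω, pathIntegral π α G ω ∂(seqLaw π γ) = ∫⁻ ω, ∑' n, sojournIntegral π α n G
      ((Preorder.frestrictLe n ω : Hist S n), ω (n + 1)) ∂(seqLaw π γ) := by
    refine lintegral_congr_ae ?_
    filter_upwards [ae_isPath π γ] with ω hω
    exact pathIntegral_eq_tsum π α hω
  have h2 (n : ℕ) : Measurable fun ω : ℕ → Entry S =>
      sojournIntegral π α n G ((Preorder.frestrictLe n ω : Hist S n), ω (n + 1)) :=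
    (measurable_sojournIntegral π α n hG).comp
      ((measurable_frestrictLe n).prodMk (measurable_pi_apply (n + 1)))
  rw [h1, lintegral_tsum fun n => (h2 n).aemeasurable]
  exact tsum_congr fun n => lintegral_sojournIntegral π γ α n hG

/-- The occupation measure is concentrated on every set of pairs that is chosen at all times. -/
lemma ae_occupation_of_forall [IsProbabilityMeasure γ] (n : ℕ) {B : Set (S × A)}
    (hB : MeasurableSet B)
    (h : ∀ (t : ℝ≥0) (ω : PathSpace S) (x : S), leftState t ω.1 = Sum.inl x →
      ∀ᵐ b ∂(π.toFun t ω), ∀ a, b = Sum.inl a → (x, a) ∈ B) :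
    ∀ᵐ p ∂(occupation π γ α n), p ∈ B := by
  have h1 := lintegral_occupation π γ α n (G := Bᶜ.indicator 1) (measurable_one.indicator hB.compl)
  have h2 : ∫⁻ p, Bᶜ.indicator 1 p ∂(occupation π γ α n) = 0 := by
    rw [h1]
    refine (lintegral_congr_ae (g := fun _ => 0) ?_).trans lintegral_zero
    filter_upwards [ae_histLaw_isPath π γ n] with k hk
    refine (setLIntegral_congr_fun (g := fun _ => 0) measurableSet_Ioi fun u hu => ?_).trans
      lintegral_zero
    rcases hx : (k.continue n).2 with x | x
    · have h3 : actionMean π n (Bᶜ.indicator 1) (k, u) = 0 := by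
        refine (lintegral_congr_ae (g := fun _ => 0) ?_).trans lintegral_zero
        have h4 := h ((jumpTime n k.continue).toNNReal + u.toNNReal) ⟨k.continue, hk⟩ x
          (leftState_continue hk hx hu)
        rw [← actionKernel_apply π hk] at h4
        filter_upwards [h4] with b hb
        rcases b with a | a
        · simp only [hx, extZero_inl_inl]
          exact indicator_of_notMem (s := Bᶜ) (fun hc => hc (hb a rfl)) _
        · simp
      simp only [h3, mul_zero]
    · simp only [actionMean_of_inr π hx, mul_zero]
  rw [lintegral_indicator_one hB.compl] at h2
  exact h2

lemma ae_totalOccupation_of_forall [IsProbabilityMeasure γ] {B : Set (S × A)}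
    (hB : MeasurableSet B)
    (h : ∀ (t : ℝ≥0) (ω : PathSpace S) (x : S), leftState t ω.1 = Sum.inl x →
      ∀ᵐ b ∂(π.toFun t ω), ∀ a, b = Sum.inl a → (x, a) ∈ B) :
    ∀ᵐ p ∂(totalOccupation π γ α), p ∈ B := by
  unfold totalOccupation
  refine (Measure.ae_sum_iff' (p := fun p => p ∈ B) hB).2 ?_
  exact fun n => ae_occupation_of_forall π γ α n hB h

lemma forall_ae_mem_graph (t : ℝ≥0) (ω : PathSpace S) (x : S)
    (hx : leftState t ω.1 = Sum.inl x) :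
    ∀ᵐ b ∂(π.toFun t ω), ∀ a, b = Sum.inl a → (x, a) ∈ {p : S × A | p.2 ∈ M.Adm p.1} := by
  have h1 := π.concentrated t ω
  rw [hx] at h1
  have h2 : ∀ᵐ b ∂(π.toFun t ω), b ∈ M.admExt (Sum.inl x) := h1
  filter_upwards [h2] with b hb a hba
  obtain ⟨a', ha', rfl⟩ := hb
  obtain rfl := Sum.inl_injective hba
  exact ha'

lemma ae_occupation_adm [IsProbabilityMeasure γ] (n : ℕ) :
    ∀ᵐ p ∂(occupation π γ α n), p.2 ∈ M.Adm p.1 :=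
  ae_occupation_of_forall π γ α n M.measurableSet_graph (forall_ae_mem_graph π)

lemma ae_totalOccupation_adm [IsProbabilityMeasure γ] :
    ∀ᵐ p ∂(totalOccupation π γ α), p.2 ∈ M.Adm p.1 :=
  ae_totalOccupation_of_forall π γ α M.measurableSet_graph (forall_ae_mem_graph π)

lemma ae_totalOccupation_selector [IsProbabilityMeasure γ] [MeasurableEq A] (φ : M.Selector) :
    ∀ᵐ p ∂(totalOccupation φ.policy γ α), p.2 = φ.toFun p.1 := by
  refine ae_totalOccupation_of_forall φ.policy γ α (B := {p | p.2 = φ.toFun p.1})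
    (measurableSet_eq_fun measurable_snd (φ.measurable.comp measurable_fst)) ?_
  intro t ω x hx
  show ∀ᵐ b ∂(Measure.dirac (Sum.map φ.toFun id (leftState t ω.1))), _
  rw [hx]
  have hm : MeasurableSet {b : A ⊕ Unit | ∀ a, b = Sum.inl a → a = φ.toFun x} := by
    have : {b : A ⊕ Unit | ∀ a, b = Sum.inl a → a = φ.toFun x} =
        Sum.inl '' {φ.toFun x} ∪ range Sum.inr := by
      ext b
      rcases b with a | a <;> simp [eq_comm]
    rw [this]
    exact (measurableSet_inl_image.2 (measurableSet_singleton _)).union measurableSet_range_inr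
  refine (ae_dirac_iff hm).2 ?_
  rintro a ha
  exact (Sum.inl_injective ha).symm

end TotalOccupation

end CTMDP

/-! ### Balance equation, moment bounds and Dynkin's formula -/

namespace CTMDP

variable {S A : Type*} [MeasurableSpace S] [MeasurableSpace A]
variable [StandardBorelSpace S] {M : CTMDP S A} (π : M.Policy) (γ : Measure S)

section Dynkin

variable [IsProbabilityMeasure γ] {α : ℝ}

lemma measurable_jumpRate_univ (M : CTMDP S A) :
    Measurable fun p : S × A => M.jumpRate p.1 p.2 univ :=
  (Measure.measurable_coe MeasurableSet.univ).comp M.measurable_jumpRate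

lemma measurable_lintegral_jumpRate (M : CTMDP S A) {f : S → ℝ≥0∞} (hf : Measurable f) :
    Measurable fun p : S × A => ∫⁻ y, f y ∂(M.jumpRate p.1 p.2) :=
  (Measure.measurable_lintegral hf).comp M.measurable_jumpRate

lemma integrable_jumpRate_of_adm {v : S → ℝ}
    (hi : ∀ x, ∀ a ∈ M.Adm x, Integrable v (M.jumpRate x a)) (x : S) (a : A) :
    Integrable v (M.jumpRate x a) := by
  by_cases ha : a ∈ M.Adm x
  · exact hi x a ha
  · rw [M.jumpRate_of_notMem ha]
    exact integrable_zero_measure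

/-- The balance equation of the total occupation measure. -/
lemma lintegral_totalOccupation_balance (hα : 0 < α) {f : S → ℝ≥0∞} (hf : Measurable f) :
    ∫⁻ p, (ENNReal.ofReal α + M.jumpRate p.1 p.2 univ) * f p.1 ∂(totalOccupation π γ α) =
      ∫⁻ x, f x ∂γ + ∫⁻ p, ∫⁻ y, f y ∂(M.jumpRate p.1 p.2) ∂(totalOccupation π γ α) := by
  rw [totalOccupation, lintegral_sum_measure, lintegral_sum_measure]
  -- Both integrals become series of the same discounted jump values, the right one shifted by one
  -- index.
  simp only [lintegral_occupation_killing π γ hα _ hf, ← jumpValue_succ π γ α _ hf]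
  rw [tsum_eq_zero_add' ENNReal.summable, jumpValue_zero π γ α hf]

/-- Here $\delta$ plays the role of $\alpha-r$. One step of the recursion gives $D_{n+1}+\delta\int
f\,d\eta_n\le D_n+\beta\,\eta_n(S\times A)$. Carrying $D_N$ along in the partial sums avoids
subtraction in $[0,\infty]$, so no finiteness is presupposed. -/
lemma mul_lintegral_totalOccupation_le (hα : 0 < α) {f : S → ℝ≥0∞} (hf : Measurable f)
    {r δ β : ℝ≥0∞} (hδ : r + δ = ENNReal.ofReal α)
    (hdrift : ∀ x, ∀ a ∈ M.Adm x,
      ∫⁻ y, f y ∂(M.jumpRate x a) ≤ r * f x + β + M.jumpRate x a univ * f x) :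
    δ * ∫⁻ p, f p.1 ∂(totalOccupation π γ α) ≤
      ∫⁻ x, f x ∂γ + β * totalOccupation π γ α univ := by
  have hf1 : Measurable fun p : S × A => f p.1 := hf.comp measurable_fst
  have hqf : Measurable fun p : S × A => M.jumpRate p.1 p.2 univ * f p.1 :=
    (measurable_jumpRate_univ M).mul hf1
  have hD (n : ℕ) : jumpValue π γ α n f = ENNReal.ofReal α * ∫⁻ p, f p.1 ∂(occupation π γ α n) +
      ∫⁻ p, M.jumpRate p.1 p.2 univ * f p.1 ∂(occupation π γ α n) := by
    rw [← lintegral_occupation_killing π γ hα n hf, ← lintegral_const_mul _ hf1,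
      ← lintegral_add_right _ hqf]
    simp only [add_mul]
  have hS (n : ℕ) : jumpValue π γ α (n + 1) f ≤ r * ∫⁻ p, f p.1 ∂(occupation π γ α n) +
      β * occupation π γ α n univ +
      ∫⁻ p, M.jumpRate p.1 p.2 univ * f p.1 ∂(occupation π γ α n) := by
    rw [jumpValue_succ π γ α n hf, ← lintegral_const_mul _ hf1, ← lintegral_const,
      ← lintegral_add_right _ measurable_const, ← lintegral_add_right _ hqf]
    refine lintegral_mono_ae ?_
    filter_upwards [ae_occupation_adm π γ α n] with p hp
    exact hdrift p.1 p.2 hp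
  have hpart (N : ℕ) : jumpValue π γ α N f +
      δ * ∑ n ∈ Finset.range N, ∫⁻ p, f p.1 ∂(occupation π γ α n) ≤
      ∫⁻ x, f x ∂γ + β * ∑ n ∈ Finset.range N, occupation π γ α n univ := by
    induction N with
    | zero => simp [jumpValue_zero π γ α hf]
    | succ N ih =>
      rw [Finset.sum_range_succ, Finset.sum_range_succ, mul_add, mul_add, ← add_assoc, ← add_assoc]
      refine le_trans ?_ (add_le_add_left ih _)
      rw [hD N, ← hδ]
      refine (add_le_add_left (add_le_add_left (hS N) _) _).trans (le_of_eq ?_)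
      ring
  rw [totalOccupation, lintegral_sum_measure, Measure.sum_apply _ MeasurableSet.univ,
    ENNReal.tsum_eq_iSup_nat, ENNReal.mul_iSup]
  refine iSup_le fun N => le_add_self.trans ((hpart N).trans ?_)
  gcongr
  exact ENNReal.sum_le_tsum _

/-- With $f=1$ the moment bound says that $\alpha$ times the total mass is at most one. -/
lemma isFiniteMeasure_totalOccupation (hα : 0 < α) :
    IsFiniteMeasure (totalOccupation π γ α) := by
  have h := mul_lintegral_totalOccupation_le π γ hα (f := fun _ => 1) measurable_const
    (r := 0) (δ := ENNReal.ofReal α) (β := 0) (zero_add _) (fun x a _ => by simp)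
  simp only [lintegral_const, one_mul, zero_mul, add_zero, measure_univ] at h
  refine ⟨lt_top_iff_ne_top.2 fun htop => ?_⟩
  rw [htop, ENNReal.mul_top (by simpa using hα)] at h
  exact absurd h (by simp)

/-- The negative atom at $x$ is moved to the right-hand side, which puts the drift condition into a
form without subtraction. -/
lemma Drift.lintegral_le {w : S → ℝ} {ρ b : ℝ} (hw : M.Drift w ρ b) {x : S} {a : A}
    (ha : a ∈ M.Adm x) :
    ∫⁻ y, ENNReal.ofReal (w y) ∂(M.jumpRate x a) ≤ ENNReal.ofReal ρ * ENNReal.ofReal (w x) +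
      ENNReal.ofReal b + M.jumpRate x a univ * ENNReal.ofReal (w x) := by
  have h0 : ∀ y, 0 ≤ w y := fun y => zero_le_one.trans (hw.one_le y)
  have h1 := hw.drift x a ha
  rw [M.qInt_eq (hw.integrable_jumpRate ha)] at h1
  rw [← ofReal_integral_eq_lintegral_ofReal (hw.integrable_jumpRate ha) (Eventually.of_forall h0),
    ← ofReal_measureReal (μ := M.jumpRate x a), ← ENNReal.ofReal_mul hw.rho_nonneg,
    ← ENNReal.ofReal_mul measureReal_nonneg,
    ← ENNReal.ofReal_add (mul_nonneg hw.rho_nonneg (h0 x)) hw.b_nonneg,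
    ← ENNReal.ofReal_add (add_nonneg (mul_nonneg hw.rho_nonneg (h0 x)) hw.b_nonneg)
      (mul_nonneg measureReal_nonneg (h0 x))]
  exact ENNReal.ofReal_le_ofReal (by linarith)

/-- The weight function is integrable with respect to the total occupation measure. -/
lemma Drift.integrable_totalOccupation {w : S → ℝ} {ρ b : ℝ} (hw : M.Drift w ρ b) (hρ : ρ < α)
    (hγ : Integrable w γ) : Integrable (fun p : S × A => w p.1) (totalOccupation π γ α) := by
  have hα : 0 < α := hw.rho_nonneg.trans_lt hρ
  have h0 : ∀ y, 0 ≤ w y := fun y => zero_le_one.trans (hw.one_le y)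
  have := isFiniteMeasure_totalOccupation π γ hα
  have h := mul_lintegral_totalOccupation_le π γ hα hw.measurable.ennreal_ofReal
    (r := ENNReal.ofReal ρ) (δ := ENNReal.ofReal (α - ρ)) (β := ENNReal.ofReal b)
    (by rw [← ENNReal.ofReal_add hw.rho_nonneg (by linarith)]; congr 1; ring)
    (fun x a ha => hw.lintegral_le ha)
  refine ⟨(hw.measurable.comp measurable_fst).aestronglyMeasurable, ?_⟩
  rw [hasFiniteIntegral_iff_ofReal (f := fun p : S × A => w p.1)
    (Eventually.of_forall fun p => h0 p.1)]
  refine lt_top_iff_ne_top.2 fun htop => ?_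
  rw [htop, ENNReal.mul_top (by simpa using hρ)] at h
  refine absurd h (not_le.2 (ENNReal.add_lt_top.2 ⟨?_, ENNReal.mul_lt_top ENNReal.ofReal_lt_top
    (measure_lt_top _ _)⟩))
  exact (hasFiniteIntegral_iff_ofReal (Eventually.of_forall h0)).1 hγ.2

/-- Finiteness of the left side of the balance equation forces finiteness of both terms on the
right, and only then may the jump term be subtracted. -/
lemma integral_totalOccupation_of_nonneg (hα : 0 < α) {f : S → ℝ} (hf : Measurable f)
    (h0 : ∀ x, 0 ≤ f x) (hi : ∀ x, ∀ a ∈ M.Adm x, Integrable f (M.jumpRate x a))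
    (hfin : Integrable (fun p : S × A => (α + (M.jumpRate p.1 p.2).real univ) * f p.1)
      (totalOccupation π γ α)) :
    Integrable (fun p : S × A => α * f p.1 - M.qInt p.1 p.2 f) (totalOccupation π γ α) ∧
      ∫ p, (α * f p.1 - M.qInt p.1 p.2 f) ∂(totalOccupation π γ α) = ∫ x, f x ∂γ := by
  have hi' := integrable_jumpRate_of_adm hi
  have hb := lintegral_totalOccupation_balance π γ hα hf.ennreal_ofReal
  have hl (p : S × A) : (ENNReal.ofReal α + M.jumpRate p.1 p.2 univ) * ENNReal.ofReal (f p.1) =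
      ENNReal.ofReal ((α + (M.jumpRate p.1 p.2).real univ) * f p.1) := by
    rw [ENNReal.ofReal_mul (add_nonneg hα.le measureReal_nonneg),
      ENNReal.ofReal_add hα.le measureReal_nonneg, ofReal_measureReal]
  have hr (p : S × A) : ∫⁻ y, ENNReal.ofReal (f y) ∂(M.jumpRate p.1 p.2) =
      ENNReal.ofReal (∫ y, f y ∂(M.jumpRate p.1 p.2)) :=
    (ofReal_integral_eq_lintegral_ofReal (hi' _ _) (Eventually.of_forall h0)).symm
  have hl0 (p : S × A) : 0 ≤ (α + (M.jumpRate p.1 p.2).real univ) * f p.1 :=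
    mul_nonneg (add_nonneg hα.le measureReal_nonneg) (h0 _)
  have hr0 (p : S × A) : 0 ≤ ∫ y, f y ∂(M.jumpRate p.1 p.2) := integral_nonneg h0
  have hlt : ∫⁻ p, ENNReal.ofReal ((α + (M.jumpRate p.1 p.2).real univ) * f p.1)
      ∂(totalOccupation π γ α) < ∞ :=
    (hasFiniteIntegral_iff_ofReal (Eventually.of_forall hl0)).1 hfin.2
  have hrm : Measurable fun p : S × A => ∫ y, f y ∂(M.jumpRate p.1 p.2) := by
    have := (measurable_lintegral_jumpRate M hf.ennreal_ofReal).ennreal_toReal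
    simpa only [hr, ENNReal.toReal_ofReal (hr0 _)] using this
  simp only [hl, hr] at hb
  have hri : Integrable (fun p : S × A => ∫ y, f y ∂(M.jumpRate p.1 p.2))
      (totalOccupation π γ α) := by
    refine ⟨hrm.aestronglyMeasurable, ?_⟩
    rw [hasFiniteIntegral_iff_ofReal (Eventually.of_forall hr0)]
    rw [hb] at hlt
    exact le_add_self.trans_lt hlt
  have heq : (fun p : S × A => α * f p.1 - M.qInt p.1 p.2 f) = fun p =>
      (α + (M.jumpRate p.1 p.2).real univ) * f p.1 - ∫ y, f y ∂(M.jumpRate p.1 p.2) := by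
    ext p
    rw [M.qInt_eq (hi' _ _)]
    ring
  rw [heq]
  refine ⟨hfin.sub hri, ?_⟩
  rw [integral_sub hfin hri, integral_eq_lintegral_of_nonneg_ae (Eventually.of_forall hl0) hfin.1,
    integral_eq_lintegral_of_nonneg_ae (Eventually.of_forall hr0) hri.1,
    integral_eq_lintegral_of_nonneg_ae (Eventually.of_forall h0) hf.aestronglyMeasurable, hb,
    ENNReal.toReal_add]
  · ring
  · rw [hb] at hlt
    exact (le_self_add.trans_lt hlt).ne
  · rw [hb] at hlt
    exact (le_add_self.trans_lt hlt).ne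

/-- Dynkin's formula in terms of the total occupation measure. -/
lemma dynkin {w w' : S → ℝ} {ρ b ρ' b' L C : ℝ} (hw : M.Drift w ρ b) (hρ : ρ < α)
    (hγ : Integrable w γ) (hw' : M.Drift w' ρ' b')
    (hL : ∀ x, (M.qBar x + 1) * w' x ≤ L * w x) {v : S → ℝ} (hv : Measurable v)
    (hle : ∀ x, |v x| ≤ C * w' x) :
    Integrable (fun p : S × A => α * v p.1 - M.qInt p.1 p.2 v) (totalOccupation π γ α) ∧
      ∫ p, (α * v p.1 - M.qInt p.1 p.2 v) ∂(totalOccupation π γ α) = ∫ x, v x ∂γ := by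
  have hα : 0 < α := hw.rho_nonneg.trans_lt hρ
  have hwi := hw.integrable_totalOccupation π γ hρ hγ
  -- For $0\le f\le Cw'$ the domination condition bounds $(\alpha+q_x(a))f$ by a multiple of $w$,
  -- which is integrable for the occupation measure. The general case follows from positive and
  -- negative parts.
  have key : ∀ f : S → ℝ, Measurable f → (∀ x, 0 ≤ f x) → (∀ x, f x ≤ C * w' x) →
      (∀ x a, Integrable f (M.jumpRate x a)) ∧ Integrable f γ ∧
      Integrable (fun p : S × A => α * f p.1 - M.qInt p.1 p.2 f) (totalOccupation π γ α) ∧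
      ∫ p, (α * f p.1 - M.qInt p.1 p.2 f) ∂(totalOccupation π γ α) = ∫ x, f x ∂γ := by
    intro f hf h0 hfC
    have habs (x : S) : |f x| ≤ C * w' x := by rw [abs_of_nonneg (h0 x)]; exact hfC x
    have hi : ∀ x, ∀ a ∈ M.Adm x, Integrable f (M.jumpRate x a) := fun x a ha =>
      integrable_of_le hf (hw'.integrable_jumpRate ha) habs
    have hC (x : S) : 0 ≤ C := by
      have h1 := (h0 x).trans (hfC x)
      have h2 := hw'.one_le x
      by_contra hneg
      nlinarith
    have hbound (x : S) : (M.qBar x + 1) * f x ≤ C * L * w x := by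
      calc (M.qBar x + 1) * f x ≤ (M.qBar x + 1) * (C * w' x) :=
            mul_le_mul_of_nonneg_left (hfC x) (by linarith [M.qBar_nonneg x])
        _ = C * ((M.qBar x + 1) * w' x) := by ring
        _ ≤ C * (L * w x) := mul_le_mul_of_nonneg_left (hL x) (hC x)
        _ = C * L * w x := by ring
    have hfγ : Integrable f γ := by
      refine integrable_of_le (C := C * L) hf hγ fun x => ?_
      rw [abs_of_nonneg (h0 x)]
      nlinarith [hbound x, mul_nonneg (M.qBar_nonneg x) (h0 x)]
    refine ⟨integrable_jumpRate_of_adm hi, hfγ,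
      integral_totalOccupation_of_nonneg π γ hα hf h0 hi ?_⟩
    have hm : Measurable fun p : S × A => (α + (M.jumpRate p.1 p.2).real univ) * f p.1 :=
      ((measurable_jumpRate_univ M).ennreal_toReal.const_add α).mul (hf.comp measurable_fst)
    refine (hwi.const_mul ((α + 1) * (C * L))).mono' hm.aestronglyMeasurable ?_
    filter_upwards [ae_totalOccupation_adm π γ α] with p hp
    have h1 := M.jumpRate_real_le_qBar hp
    have h2 : 0 ≤ (M.jumpRate p.1 p.2).real univ := measureReal_nonneg
    have h3 := h0 p.1
    rw [Real.norm_of_nonneg (mul_nonneg (add_nonneg hα.le h2) h3)]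
    calc (α + (M.jumpRate p.1 p.2).real univ) * f p.1
        ≤ ((α + 1) * (M.qBar p.1 + 1)) * f p.1 := by
          refine mul_le_mul_of_nonneg_right ?_ h3
          nlinarith [M.qBar_nonneg p.1]
      _ = (α + 1) * ((M.qBar p.1 + 1) * f p.1) := by ring
      _ ≤ (α + 1) * (C * L * w p.1) := mul_le_mul_of_nonneg_left (hbound _) (by linarith)
      _ = (α + 1) * (C * L) * w p.1 := by ring
  obtain ⟨p1, p2, p3, p4⟩ := key (fun x => max (v x) 0) (hv.max measurable_const)
    (fun x => le_max_right _ _) (fun x => max_le ((le_abs_self _).trans (hle x))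
      ((abs_nonneg _).trans (hle x)))
  obtain ⟨n1, n2, n3, n4⟩ := key (fun x => max (-v x) 0) (hv.neg.max measurable_const)
    (fun x => le_max_right _ _) (fun x => max_le ((neg_le_abs _).trans (hle x))
      ((abs_nonneg _).trans (hle x)))
  have hsub (x : S) : v x = max (v x) 0 + -1 * max (-v x) 0 := by
    rcases le_total 0 (v x) with h | h
    · rw [max_eq_left h, max_eq_right (by linarith)]; ring
    · rw [max_eq_right h, max_eq_left (by linarith)]; ring
  have heq : (fun p : S × A => α * v p.1 - M.qInt p.1 p.2 v) = fun p =>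
      (α * max (v p.1) 0 - M.qInt p.1 p.2 fun x => max (v x) 0) -
        (α * max (-v p.1) 0 - M.qInt p.1 p.2 fun x => max (-v x) 0) := by
    ext p
    have h1 : M.qInt p.1 p.2 v = M.qInt p.1 p.2 fun x => max (v x) 0 + -1 * max (-v x) 0 := by
      congr 1
      exact funext hsub
    rw [h1, M.qInt_add (p1 _ _) ((n1 _ _).const_mul (-1)), M.qInt_const_mul (-1) (n1 _ _)]
    have h2 := hsub p.1
    linear_combination α * h2
  rw [heq]
  refine ⟨p3.sub n3, ?_⟩
  rw [integral_sub p3 n3, p4, n4, ← integral_sub p2 n2]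
  refine integral_congr_ae (Eventually.of_forall fun x => ?_)
  have := hsub x
  show max (v x) 0 - max (-v x) 0 = v x
  linarith

end Dynkin

end CTMDP

/-! ### Verification: subsolutions and optimal selectors -/

namespace CTMDP

variable {S A : Type*} [MeasurableSpace S] [MeasurableSpace A]
variable [StandardBorelSpace S] {M : CTMDP S A}

lemma memWeighted_iff {w u : S → ℝ} (hw : ∀ x, 1 ≤ w x) :
    MemWeighted w u ↔ Measurable u ∧ ∃ C, 0 ≤ C ∧ ∀ x, |u x| ≤ C * w x := by
  refine and_congr_right fun _ => ⟨?_, ?_⟩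
  · rintro ⟨C, hC⟩
    refine ⟨max C 0, le_max_right _ _, fun x => ?_⟩
    have h1 : |u x| / w x ≤ max C 0 := (hC ⟨x, rfl⟩).trans (le_max_left _ _)
    exact (div_le_iff₀ (zero_lt_one.trans_le (hw x))).1 h1
  · rintro ⟨C, -, hC⟩
    refine ⟨C, ?_⟩
    rintro _ ⟨x, rfl⟩
    exact (div_le_iff₀ (zero_lt_one.trans_le (hw x))).2 (hC x)

section Value

variable (γ : Measure S) [IsProbabilityMeasure γ] (α : ℝ)

lemma value_eq_lintegral (π : M.Policy) : M.value γ α π =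
    ((∫⁻ p, ENNReal.ofReal (M.cost p.1 p.2) ∂(totalOccupation π γ α) : ℝ≥0∞) : EReal) -
      ((∫⁻ p, ENNReal.ofReal (-M.cost p.1 p.2) ∂(totalOccupation π γ α) : ℝ≥0∞) : EReal) := by
  unfold value
  rw [← discounted_eq_lintegral π γ α M.measurable_cost.ennreal_ofReal,
    ← discounted_eq_lintegral π γ α (G := fun p => ENNReal.ofReal (-M.cost p.1 p.2))
      M.measurable_cost.neg.ennreal_ofReal]
  congr 3
  all_goals
    funext z b
    rcases z with x | z <;> rcases b with a | b <;> simp [costExt]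

lemma value_eq_integral {π : M.Policy}
    (hi : Integrable (fun p : S × A => M.cost p.1 p.2) (totalOccupation π γ α)) :
    M.value γ α π = ((∫ p, M.cost p.1 p.2 ∂(totalOccupation π γ α) : ℝ) : EReal) := by
  have h1 : ∫⁻ p, ENNReal.ofReal (M.cost p.1 p.2) ∂(totalOccupation π γ α) ≠ ∞ :=
    hi.lintegral_lt_top.ne
  have h2 : ∫⁻ p, ENNReal.ofReal (-M.cost p.1 p.2) ∂(totalOccupation π γ α) ≠ ∞ :=
    hi.neg.lintegral_lt_top.ne
  rw [value_eq_lintegral, integral_eq_lintegral_pos_part_sub_lintegral_neg_part hi, EReal.coe_sub,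
    EReal.coe_ennreal_toReal h1, EReal.coe_ennreal_toReal h2]

/-- The integrable minorant makes the negative part of the cost integrable. Either the positive part
has infinite integral and the value is $\infty$, or the cost is integrable and the integrals are
compared. -/
lemma le_value_of_ae_le {π : M.Policy} {g : S × A → ℝ}
    (hg : Integrable g (totalOccupation π γ α))
    (hle : ∀ᵐ p ∂(totalOccupation π γ α), g p ≤ M.cost p.1 p.2) :
    ((∫ p, g p ∂(totalOccupation π γ α) : ℝ) : EReal) ≤ M.value γ α π := by
  have h2 : ∫⁻ p, ENNReal.ofReal (-M.cost p.1 p.2) ∂(totalOccupation π γ α) < ∞ := by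
    refine (lintegral_mono_ae ?_).trans_lt hg.neg.lintegral_lt_top
    filter_upwards [hle] with p hp
    exact ENNReal.ofReal_le_ofReal (neg_le_neg hp)
  by_cases h1 : ∫⁻ p, ENNReal.ofReal (M.cost p.1 p.2) ∂(totalOccupation π γ α) = ∞
  · rw [value_eq_lintegral, h1, EReal.coe_ennreal_top, ← EReal.coe_ennreal_toReal h2.ne,
      EReal.top_sub_coe]
    exact le_top
  · have hi : Integrable (fun p : S × A => M.cost p.1 p.2) (totalOccupation π γ α) := by
      refine ⟨M.measurable_cost.aestronglyMeasurable, ?_⟩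
      have h3 : ∀ p : S × A, ‖M.cost p.1 p.2‖ₑ =
          ENNReal.ofReal (M.cost p.1 p.2) + ENNReal.ofReal (-M.cost p.1 p.2) := by
        intro p
        rw [Real.enorm_eq_ofReal_abs]
        rcases le_total 0 (M.cost p.1 p.2) with h | h
        · rw [abs_of_nonneg h, ENNReal.ofReal_of_nonpos (neg_nonpos.2 h), add_zero]
        · rw [abs_of_nonpos h, ENNReal.ofReal_of_nonpos h, zero_add]
      unfold HasFiniteIntegral
      simp only [h3]
      rw [lintegral_add_left M.measurable_cost.ennreal_ofReal]
      exact ENNReal.add_lt_top.2 ⟨lt_top_iff_ne_top.2 h1, h2⟩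
    rw [value_eq_integral γ α hi]
    exact EReal.coe_le_coe_iff.2 (integral_mono_ae hg hi hle)

variable {α} {w w' : S → ℝ} {ρ b L' ρ' b' M' c' : ℝ}

lemma SecondWeight.dynkin (hw' : M.SecondWeight α w w' L' ρ' b' M' c') (hw : M.Drift w ρ b)
    (hρ : ρ < α) (hγ : Integrable w γ) {v : S → ℝ} (hv : MemWeighted w' v) (π : M.Policy) :
    Integrable (fun p : S × A => α * v p.1 - M.qInt p.1 p.2 v) (totalOccupation π γ α) ∧
      ∫ p, (α * v p.1 - M.qInt p.1 p.2 v) ∂(totalOccupation π γ α) = ∫ x, v x ∂γ := by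
  obtain ⟨hvm, C, -, hC⟩ := (memWeighted_iff hw'.one_le).1 hv
  exact CTMDP.dynkin π γ hw hρ hγ hw'.toDrift hw'.dominated hvm hC

/-- A subsolution of the Bellman equation is a lower bound for the value of every policy. -/
lemma SecondWeight.integral_le_value (hw' : M.SecondWeight α w w' L' ρ' b' M' c')
    (hw : M.Drift w ρ b) (hρ : ρ < α) (hγ : Integrable w γ) {v : S → ℝ} (hv : MemWeighted w' v)
    (hsub : ∀ x, ∀ a ∈ M.Adm x, α * v x ≤ M.cost x a + M.qInt x a v) (π : M.Policy) :
    ((∫ x, v x ∂γ : ℝ) : EReal) ≤ M.value γ α π := by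
  obtain ⟨h1, h2⟩ := hw'.dynkin γ hw hρ hγ hv π
  rw [← h2]
  refine le_value_of_ae_le γ α h1 ?_
  filter_upwards [ae_totalOccupation_adm π γ α] with p hp
  have := hsub p.1 p.2 hp
  linarith

/-- The value of a stationary policy for which `v` satisfies the evaluation equation. -/
lemma SecondWeight.value_policy [MeasurableEq A] (hw' : M.SecondWeight α w w' L' ρ' b' M' c')
    (hw : M.Drift w ρ b) (hρ : ρ < α) (hγ : Integrable w γ) {v : S → ℝ} (hv : MemWeighted w' v)
    (φ : M.Selector) (heq : ∀ x, M.cost x (φ.toFun x) + M.qInt x (φ.toFun x) v = α * v x) :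
    M.value γ α φ.policy = ((∫ x, v x ∂γ : ℝ) : EReal) := by
  obtain ⟨h1, h2⟩ := hw'.dynkin γ hw hρ hγ hv φ.policy
  have h3 : (fun p : S × A => α * v p.1 - M.qInt p.1 p.2 v) =ᵐ[totalOccupation φ.policy γ α]
      fun p => M.cost p.1 p.2 := by
    filter_upwards [ae_totalOccupation_selector γ α φ] with p hp
    rw [hp]
    have := heq p.1
    linarith
  rw [value_eq_integral γ α (h1.congr h3), ← integral_congr_ae h3, h2]

end Value

section Optimality

variable {α : ℝ} {w w' : S → ℝ} {ρ b L' ρ' b' M' c' : ℝ}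

lemma SecondWeight.le_mul (hw' : M.SecondWeight α w w' L' ρ' b' M' c') (x : S) :
    w' x ≤ L' * w x := by
  have h1 := hw'.dominated x
  have h2 := M.qBar_nonneg x
  nlinarith [hw'.one_le x]

lemma SecondWeight.exists_abs_le_mul (hw' : M.SecondWeight α w w' L' ρ' b' M' c') {u : S → ℝ}
    (hu : MemWeighted w' u) : ∃ C, ∀ x, |u x| ≤ C * w x := by
  obtain ⟨-, C, hC0, hC⟩ := (memWeighted_iff hw'.one_le).1 hu
  exact ⟨C * L', fun x => (hC x).trans
    ((mul_le_mul_of_nonneg_left (hw'.le_mul x) hC0).trans (mul_assoc _ _ _).ge)⟩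

lemma SecondWeight.integrable_of_memWeighted (hw' : M.SecondWeight α w w' L' ρ' b' M' c') {γ : Measure S}
    (hγ : Integrable w γ) {u : S → ℝ} (hu : MemWeighted w' u) : Integrable u γ := by
  obtain ⟨C, hC⟩ := hw'.exists_abs_le_mul hu
  exact integrable_of_le hu.1 hγ hC

lemma SecondWeight.integrable_jumpRate (hw' : M.SecondWeight α w w' L' ρ' b' M' c') {u : S → ℝ}
    (hu : MemWeighted w' u) (x : S) (a : A) : Integrable u (M.jumpRate x a) := by
  obtain ⟨-, C, -, hC⟩ := (memWeighted_iff hw'.one_le).1 hu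
  exact integrable_jumpRate_of_adm (fun x a ha =>
    integrable_of_le hu.1 (hw'.toDrift.integrable_jumpRate ha) hC) x a

lemma measurable_rhs (hw' : M.SecondWeight α w w' L' ρ' b' M' c') {u : S → ℝ}
    (hu : MemWeighted w' u) : Measurable fun p : S × A => M.cost p.1 p.2 + M.qInt p.1 p.2 u :=
  M.measurable_cost.add (M.measurable_qInt hu.1 fun x a _ => hw'.integrable_jumpRate hu x a)

lemma Bellman.eq_of_forall_le {u : S → ℝ} (hB : M.Bellman α u) {x : S} {a : A} (ha : a ∈ M.Adm x)
    (hmin : ∀ a' ∈ M.Adm x, M.cost x a + M.qInt x a u ≤ M.cost x a' + M.qInt x a' u) :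
    M.cost x a + M.qInt x a u = α * u x := by
  refine (IsLeast.isGLB (s := (fun a => M.cost x a + M.qInt x a u) '' M.Adm x)
    ⟨⟨a, ha, rfl⟩, ?_⟩).unique (hB x)
  rintro _ ⟨a', ha', rfl⟩
  exact hmin a' ha'

variable [TopologicalSpace A]

lemma CompactContinuous.lowerSemicontinuousOn_rhs (hcc : M.CompactContinuous w)
    (hw : M.Drift w ρ b) (hw' : M.SecondWeight α w w' L' ρ' b' M' c') {u : S → ℝ}
    (hu : MemWeighted w' u) (x : S) :
    LowerSemicontinuousOn (fun a => M.cost x a + M.qInt x a u) (M.Adm x) := by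
  obtain ⟨C, hC⟩ := hw'.exists_abs_le_mul hu
  exact (hcc.lsc_cost x).add (hcc.lowerSemicontinuousOn_qInt hw hu.1 hC x)

lemma CompactContinuous.exists_isLeast (hcc : M.CompactContinuous w)
    (hw : M.Drift w ρ b) (hw' : M.SecondWeight α w w' L' ρ' b' M' c') {u : S → ℝ}
    (hu : MemWeighted w' u) (x : S) :
    ∃ a ∈ M.Adm x, ∀ a' ∈ M.Adm x, M.cost x a + M.qInt x a u ≤ M.cost x a' + M.qInt x a' u := by
  obtain ⟨a, ha, hmin⟩ := LowerSemicontinuousOn.exists_isMinOn (M.adm_nonempty x)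
    (hcc.isCompact_adm x) (hcc.lowerSemicontinuousOn_rhs hw hw' hu x)
  exact ⟨a, ha, fun a' ha' => hmin ha'⟩

/-- The pairs with right-hand side at most $\alpha u(x)$ form a Borel set whose sections are
nonempty, because the infimum is attained, and compact, by lower semicontinuity. -/
lemma Bellman.exists_selector [TopologicalSpace.MetrizableSpace A] [SecondCountableTopology A]
    [BorelSpace A] [StandardBorelSpace A] (hcc : M.CompactContinuous w)
    (hw : M.Drift w ρ b) (hw' : M.SecondWeight α w w' L' ρ' b' M' c') {u : S → ℝ}
    (hu : MemWeighted w' u) (hB : M.Bellman α u) :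
    ∃ φ : M.Selector, ∀ x, M.cost x (φ.toFun x) + M.qInt x (φ.toFun x) u = α * u x := by
  obtain ⟨φ, hφm, hφ⟩ := MeasurableSet.exists_measurable_selector
    (G := {p : S × A | p.2 ∈ M.Adm p.1 ∧ M.cost p.1 p.2 + M.qInt p.1 p.2 u ≤ α * u p.1})
    (M.measurableSet_graph.inter (measurableSet_le (measurable_rhs hw' hu)
      ((hu.1.comp measurable_fst).const_mul α)))
    (fun x => (hcc.lowerSemicontinuousOn_rhs hw hw' hu x).isCompact_inter_preimage_Iic
      (hcc.isCompact_adm x) (α * u x))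
    (fun x => by
      obtain ⟨a, ha, hmin⟩ := hcc.exists_isLeast hw hw' hu x
      exact ⟨a, ha, (hB.eq_of_forall_le ha hmin).le⟩)
  exact ⟨⟨φ, hφm, fun x => (hφ x).1⟩, fun x =>
    le_antisymm (hφ x).2 ((hB x).1 ⟨φ x, (hφ x).1, rfl⟩)⟩

variable [TopologicalSpace.MetrizableSpace A] [SecondCountableTopology A]
    [BorelSpace A] [StandardBorelSpace A]

/-- Every subsolution is dominated by every solution. -/
lemma Bellman.le_of_subsolution (hcc : M.CompactContinuous w) (hw : M.Drift w ρ b) (hρ : ρ < α)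
    (hw' : M.SecondWeight α w w' L' ρ' b' M' c') {u v : S → ℝ} (hu : MemWeighted w' u)
    (hB : M.Bellman α u) (hv : MemWeighted w' v)
    (hsub : ∀ x, ∀ a ∈ M.Adm x, α * v x ≤ M.cost x a + M.qInt x a v) (x : S) : v x ≤ u x := by
  obtain ⟨φ, hφ⟩ := hB.exists_selector hcc hw hw' hu
  -- Starting at a fixed point turns the inequality between integrals into a pointwise one: $v(x)$
  -- bounds all values from below, and the selector has the value $u(x)$.
  have hγ : Integrable w (Measure.dirac x) := integrable_dirac enorm_lt_top
  have h1 := hw'.integral_le_value (Measure.dirac x) hw hρ hγ hv hsub φ.policy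
  rw [hw'.value_policy (Measure.dirac x) hw hρ hγ hu φ hφ, integral_dirac, integral_dirac] at h1
  exact EReal.coe_le_coe_iff.1 h1

end Optimality

end CTMDP

/-! ### Value iteration -/

namespace CTMDP

variable {S A : Type*} [MeasurableSpace S] [MeasurableSpace A]
variable [StandardBorelSpace S] {M : CTMDP S A}

section ValueIteration

/-- The expression that is minimized over `a` in one step of the value iteration. -/
noncomputable def iterand (M : CTMDP S A) (α : ℝ) (v : S → ℝ) (x : S) (a : A) : ℝ :=
  M.cost x a / (α + 1 + M.qBar x) + (1 + M.qBar x) / (α + 1 + M.qBar x) *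
    (M.qInt x a v / (1 + M.qBar x) + v x)

lemma iterand_eq {α : ℝ} (v : S → ℝ) (x : S) (a : A) : M.iterand α v x a =
    (M.cost x a + M.qInt x a v + (1 + M.qBar x) * v x) / (α + 1 + M.qBar x) := by
  have h1 : (1 + M.qBar x) ≠ 0 := by have := M.qBar_nonneg x; positivity
  unfold iterand
  rw [div_mul_eq_mul_div, ← add_div, mul_add, mul_div_cancel₀ _ h1, ← add_assoc]

/-- Apart from the positive integral over jumps, $v(x)$ enters with the coefficient $1+\bar
q_x-q_x(a)\ge 1$. Producing this sign is the purpose of the added multiple of $v(x)$. -/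
lemma iterand_mono {α : ℝ} (hα : 0 < α) {u v : S → ℝ} {x : S} {a : A} (ha : a ∈ M.Adm x)
    (hu : Integrable u (M.jumpRate x a)) (hv : Integrable v (M.jumpRate x a))
    (huv : ∀ y, u y ≤ v y) : M.iterand α u x a ≤ M.iterand α v x a := by
  have h1 := M.qBar_nonneg x
  have h2 := M.jumpRate_real_le_qBar ha
  have h3 : ∫ y, u y ∂(M.jumpRate x a) ≤ ∫ y, v y ∂(M.jumpRate x a) := integral_mono hu hv huv
  rw [iterand_eq, iterand_eq, M.qInt_eq hu, M.qInt_eq hv]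
  refine div_le_div_of_nonneg_right ?_ (by positivity)
  nlinarith [mul_le_mul_of_nonneg_left (huv x)
    (by linarith : 0 ≤ 1 + M.qBar x - (M.jumpRate x a).real univ)]

/-- After clearing the denominator, $(1+\bar q_x)v(x)$ cancels on both sides. So fixed points of the
iteration and solutions of the Bellman equation correspond. -/
lemma le_iterand_iff {α : ℝ} (hα : 0 < α) {v : S → ℝ} {x : S} {a : A} :
    v x ≤ M.iterand α v x a ↔ α * v x ≤ M.cost x a + M.qInt x a v := by
  have h1 := M.qBar_nonneg x
  rw [iterand_eq, le_div_iff₀ (by positivity)]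
  constructor <;> intro h <;> nlinarith

lemma iterand_le_iff {α : ℝ} (hα : 0 < α) {v : S → ℝ} {x : S} {a : A} :
    M.iterand α v x a ≤ v x ↔ M.cost x a + M.qInt x a v ≤ α * v x := by
  have h1 := M.qBar_nonneg x
  rw [iterand_eq, div_le_iff₀ (by positivity)]
  constructor <;> intro h <;> nlinarith

variable {α : ℝ} {w w' : S → ℝ} {ρ b L' ρ' b' M' c' : ℝ}

lemma exists_iterate_zero_le_mul (hα : 0 < α) (hw' : M.SecondWeight α w w' L' ρ' b' M' c') :
    ∃ C, ∀ x, M.iterate α w' M' c' ρ' b' 0 x ≤ C * w' x := by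
  refine ⟨M' * (α + b') / (α * (α - ρ')) + c' / α, fun x => ?_⟩
  have h1 := hw'.one_le x
  have h2 : 0 < α - ρ' := sub_pos.2 hw'.rho_lt
  have h3 := hw'.b_nonneg
  have h4 := hw'.M_nonneg
  have h5 := hw'.c_nonneg
  show M' * (α * w' x + b') / (α * (α - ρ')) + c' / α ≤ _
  rw [add_mul, div_mul_eq_mul_div]
  refine add_le_add (div_le_div_of_nonneg_right ?_ (by positivity))
    (le_mul_of_one_le_right (by positivity) h1)
  rw [mul_assoc]
  exact mul_le_mul_of_nonneg_left (by nlinarith) h4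

lemma iterate_zero_nonneg (hα : 0 < α) (hw' : M.SecondWeight α w w' L' ρ' b' M' c') (x : S) :
    0 ≤ M.iterate α w' M' c' ρ' b' 0 x := by
  have h1 := hw'.one_le x
  have h2 : 0 < α - ρ' := sub_pos.2 hw'.rho_lt
  have h3 := hw'.b_nonneg
  have h4 := hw'.M_nonneg
  have h5 := hw'.c_nonneg
  show 0 ≤ M' * (α * w' x + b') / (α * (α - ρ')) + c' / α
  positivity

lemma measurable_iterate_zero (hw' : M.SecondWeight α w w' L' ρ' b' M' c') :
    Measurable (M.iterate α w' M' c' ρ' b' 0) :=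
  ((((hw'.measurable.const_mul α).add_const b').const_mul M').div_const _).add_const _

/-- Every function between `-u⁽⁰⁾` and `u⁽⁰⁾` has finite weighted norm. -/
lemma memWeighted_of_abs_le_iterate_zero (hα : 0 < α)
    (hw' : M.SecondWeight α w w' L' ρ' b' M' c') {u : S → ℝ} (hu : Measurable u)
    (hle : ∀ x, |u x| ≤ M.iterate α w' M' c' ρ' b' 0 x) : MemWeighted w' u := by
  obtain ⟨C, hC⟩ := exists_iterate_zero_le_mul hα hw'
  refine (memWeighted_iff hw'.one_le).2 ⟨hu, max C 0, le_max_right _ _, fun x => ?_⟩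
  refine (hle x).trans ((hC x).trans (mul_le_mul_of_nonneg_right (le_max_left _ _) ?_))
  exact zero_le_one.trans (hw'.one_le x)

lemma memWeighted_iterate_zero (hα : 0 < α) (hw' : M.SecondWeight α w w' L' ρ' b' M' c') :
    MemWeighted w' (M.iterate α w' M' c' ρ' b' 0) :=
  memWeighted_of_abs_le_iterate_zero hα hw' (measurable_iterate_zero hw')
    fun x => (abs_of_nonneg (iterate_zero_nonneg hα hw' x)).le

/-- $u^{(0)}$ is affine in $w'$ with slope $M'/(\alpha-\rho')$. Its constants are chosen so that
inserting the drift bound for $w'$ gives equality, making it a supersolution for the cost $M'w'+c'$.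
-/
lemma cost_add_qInt_iterate_zero_le (hα : 0 < α) (hw' : M.SecondWeight α w w' L' ρ' b' M' c')
    {x : S} {a : A} (ha : a ∈ M.Adm x) : M' * w' x + c' +
      M.qInt x a (M.iterate α w' M' c' ρ' b' 0) ≤ α * M.iterate α w' M' c' ρ' b' 0 x := by
  have h2 : 0 < α - ρ' := sub_pos.2 hw'.rho_lt
  have hi := hw'.toDrift.integrable_jumpRate ha
  have h1 : M.iterate α w' M' c' ρ' b' 0 = fun y => M' / (α - ρ') * w' y +
      (M' * b' / (α * (α - ρ')) + c' / α) := by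
    funext y
    show M' * (α * w' y + b') / (α * (α - ρ')) + c' / α = _
    field_simp
    ring
  have h3 : M.qInt x a (M.iterate α w' M' c' ρ' b' 0) = M' / (α - ρ') * M.qInt x a w' := by
    rw [h1, M.qInt_add (hi.const_mul _) (integrable_const _), M.qInt_const_mul _ hi,
      M.qInt_const, add_zero]
  have h4 : M' / (α - ρ') * M.qInt x a w' ≤ M' / (α - ρ') * (ρ' * w' x + b') :=
    mul_le_mul_of_nonneg_left (hw'.drift x a ha) (div_nonneg hw'.M_nonneg h2.le)
  have h5 : α * M.iterate α w' M' c' ρ' b' 0 x =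
      M' * w' x + c' + M' / (α - ρ') * (ρ' * w' x + b') := by
    show α * (M' * (α * w' x + b') / (α * (α - ρ')) + c' / α) = _
    field_simp
    ring
  rw [h3, h5]
  linarith

/-- Every admissible cost is at least $-(M'w'+c')$, so the negative of the supersolution is a
subsolution at every action. -/
lemma neg_iterate_zero_le_iterand (hα : 0 < α) (hw' : M.SecondWeight α w w' L' ρ' b' M' c')
    {x : S} {a : A} (ha : a ∈ M.Adm x) : -M.iterate α w' M' c' ρ' b' 0 x ≤
      M.iterand α (fun y => -M.iterate α w' M' c' ρ' b' 0 y) x a := by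
  have h0 := memWeighted_iterate_zero hα hw'
  have h1 : M.qInt x a (fun y => -M.iterate α w' M' c' ρ' b' 0 y) =
      -M.qInt x a (M.iterate α w' M' c' ρ' b' 0) := by
    have := M.qInt_const_mul (-1) (hw'.integrable_jumpRate h0 x a)
    simpa only [neg_one_mul] using this
  have h2 := cost_add_qInt_iterate_zero_le hα hw' ha
  have h3 := (abs_le.1 (hw'.abs_sInf_cost_le x)).1
  have h4 := csInf_le (hw'.cost_bddBelow x) ⟨a, ha, rfl⟩
  refine (le_iterand_iff (v := fun y => -M.iterate α w' M' c' ρ' b' 0 y) hα).2 ?_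
  rw [h1]
  linarith

variable [TopologicalSpace A]

/-- The upper bound is assumed for the infimum of the cost only, so the action has to be one that
minimizes the cost. -/
lemma CompactContinuous.exists_iterand_zero_le (hα : 0 < α) (hcc : M.CompactContinuous w)
    (hw' : M.SecondWeight α w w' L' ρ' b' M' c') (x : S) : ∃ a ∈ M.Adm x,
      M.iterand α (M.iterate α w' M' c' ρ' b' 0) x a ≤ M.iterate α w' M' c' ρ' b' 0 x := by
  obtain ⟨a, ha, hmin⟩ := (hcc.lsc_cost x).exists_isMinOn (M.adm_nonempty x) (hcc.isCompact_adm x)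
  refine ⟨a, ha, (iterand_le_iff hα).2 ?_⟩
  have h1 : sInf (M.cost x '' M.Adm x) = M.cost x a :=
    (show IsLeast (M.cost x '' M.Adm x) (M.cost x a) from
      ⟨⟨a, ha, rfl⟩, by rintro _ ⟨a', ha', rfl⟩; exact hmin ha'⟩).csInf_eq
  have h2 := (abs_le.1 (hw'.abs_sInf_cost_le x)).2
  have h3 := cost_add_qInt_iterate_zero_le hα hw' ha
  linarith

lemma CompactContinuous.lowerSemicontinuousOn_iterand (hα : 0 < α) (hcc : M.CompactContinuous w)
    (hw : M.Drift w ρ b) (hw' : M.SecondWeight α w w' L' ρ' b' M' c') {u : S → ℝ}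
    (hu : MemWeighted w' u) (x : S) :
    LowerSemicontinuousOn (M.iterand α u x) (M.Adm x) := by
  have h1 := M.qBar_nonneg x
  -- For fixed $x$ the iteration expression is an increasing affine function of the Bellman
  -- expression, so it inherits lower semicontinuity.
  have h2 : Monotone fun t : ℝ => (t + (1 + M.qBar x) * u x) / (α + 1 + M.qBar x) :=
    fun s t hst => div_le_div_of_nonneg_right (by linarith) (by positivity)
  have h3 : Continuous fun t : ℝ => (t + (1 + M.qBar x) * u x) / (α + 1 + M.qBar x) := by
    fun_prop
  have h4 := h3.comp_lowerSemicontinuousOn (hcc.lowerSemicontinuousOn_rhs hw hw' hu x) h2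
  have h5 : M.iterand α u x = (fun t : ℝ => (t + (1 + M.qBar x) * u x) / (α + 1 + M.qBar x)) ∘
      fun a => M.cost x a + M.qInt x a u := funext fun a => iterand_eq u x a
  rw [h5]
  exact h4

lemma CompactContinuous.exists_isLeast_iterand (hα : 0 < α) (hcc : M.CompactContinuous w)
    (hw : M.Drift w ρ b) (hw' : M.SecondWeight α w w' L' ρ' b' M' c') {u : S → ℝ}
    (hu : MemWeighted w' u) (x : S) :
    ∃ a ∈ M.Adm x, IsLeast (M.iterand α u x '' M.Adm x) (M.iterand α u x a) := by
  obtain ⟨a, ha, hmin⟩ := LowerSemicontinuousOn.exists_isMinOn (M.adm_nonempty x)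
    (hcc.isCompact_adm x) (hcc.lowerSemicontinuousOn_iterand hα hw hw' hu x)
  exact ⟨a, ha, ⟨a, ha, rfl⟩, by rintro _ ⟨a', ha', rfl⟩; exact hmin ha'⟩

lemma CompactContinuous.isGLB_iterand (hα : 0 < α) (hcc : M.CompactContinuous w)
    (hw : M.Drift w ρ b) (hw' : M.SecondWeight α w w' L' ρ' b' M' c') {u : S → ℝ}
    (hu : MemWeighted w' u) (x : S) :
    IsGLB (M.iterand α u x '' M.Adm x) (sInf (M.iterand α u x '' M.Adm x)) := by
  obtain ⟨a, -, h⟩ := hcc.exists_isLeast_iterand hα hw hw' hu x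
  exact isGLB_csInf h.nonempty ⟨_, h.2⟩

variable [TopologicalSpace.MetrizableSpace A] [SecondCountableTopology A]
    [BorelSpace A] [StandardBorelSpace A]

/-- The atom $q(\{x\}|x,a)$ is the integral of the indicator of $\{x\}$, hence lower semicontinuous
in $a$. Its minimum over the compact set $A(x)$ is $-\bar q_x$, so the measurability of minima
applies. -/
lemma CompactContinuous.measurable_qBar (hcc : M.CompactContinuous w) : Measurable M.qBar := by
  have h1 (x : S) (a : A) : M.qInt x a (indicator {x} 1) = M.q x a {x} := by
    have hm : MeasurableSet {x} := measurableSet_singleton x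
    rw [M.qInt_eq (f := indicator {x} 1) ((integrable_const (1 : ℝ)).indicator hm), integral_indicator_one hm,
      M.jumpRate_real x a hm, M.jumpRate_real_univ]
    simp
  have h2 (x : S) : LowerSemicontinuousOn (fun a => M.q x a {x}) (M.Adm x) := by
    have := hcc.lsc_qInt (indicator {x} 1) (measurable_one.indicator (measurableSet_singleton x))
      (indicator_nonneg fun _ _ => zero_le_one)
      ⟨1, by
        rintro _ ⟨y, rfl⟩
        exact indicator_le_self' (fun _ _ => zero_le_one) y⟩ x
    simpa only [h1] using this
  have h3 : Measurable fun p : S × A => M.q p.1 p.2 {p.1} := by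
    have h4 : (fun p : S × A => M.q p.1 p.2 {p.1}) = fun p =>
        -(M.jumpRate p.1 p.2 univ).toReal := by
      funext p
      have := M.jumpRate_real_univ p.1 p.2
      rw [measureReal_def] at this
      rw [this, neg_neg]
    rw [h4]
    exact (measurable_jumpRate_univ M).ennreal_toReal.neg
  have h4 : Measurable fun x => -M.qBar x := by
    refine measurable_of_isLeast_image (f := fun x a => M.q x a {x}) M.measurableSet_graph
      hcc.isCompact_adm M.adm_nonempty h3 h2 fun x => ?_
    have h5 : IsLUB ((fun a => -(M.q x a {x})) '' M.Adm x) (M.qBar x) :=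
      isLUB_csSup ((M.adm_nonempty x).image _) (M.q_stable x)
    constructor
    · rintro _ ⟨a, ha, rfl⟩
      exact neg_le.1 (h5.1 ⟨a, ha, rfl⟩)
    · intro c hc
      refine le_neg.1 (h5.2 ?_)
      rintro _ ⟨a, ha, rfl⟩
      exact neg_le_neg (hc ⟨a, ha, rfl⟩)
  exact measurable_neg_iff.1 h4

lemma CompactContinuous.measurable_sInf_iterand (hα : 0 < α) (hcc : M.CompactContinuous w)
    (hw : M.Drift w ρ b) (hw' : M.SecondWeight α w w' L' ρ' b' M' c') {u : S → ℝ}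
    (hu : MemWeighted w' u) : Measurable fun x => sInf (M.iterand α u x '' M.Adm x) := by
  refine measurable_of_isLeast_image (f := M.iterand α u) M.measurableSet_graph
    hcc.isCompact_adm M.adm_nonempty ?_ (hcc.lowerSemicontinuousOn_iterand hα hw hw' hu)
    (hcc.isGLB_iterand hα hw hw' hu)
  simp only [iterand_eq]
  have h1 : Measurable fun p : S × A => M.qBar p.1 := hcc.measurable_qBar.comp measurable_fst
  exact ((measurable_rhs hw' hu).add ((h1.const_add 1).mul (hu.1.comp measurable_fst))).div
    (h1.const_add (α + 1))

/-- The value iteration decreases and stays between `-u⁽⁰⁾` and `u⁽⁰⁾`. -/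
lemma CompactContinuous.iterate_bounds (hα : 0 < α) (hcc : M.CompactContinuous w)
    (hw : M.Drift w ρ b) (hw' : M.SecondWeight α w w' L' ρ' b' M' c') (n : ℕ) :
    Measurable (M.iterate α w' M' c' ρ' b' n) ∧
      (∀ x, |M.iterate α w' M' c' ρ' b' n x| ≤ M.iterate α w' M' c' ρ' b' 0 x) ∧
      ∀ x, M.iterate α w' M' c' ρ' b' (n + 1) x ≤ M.iterate α w' M' c' ρ' b' n x := by
  induction n with
  | zero =>
    refine ⟨measurable_iterate_zero hw', fun x =>
      (abs_of_nonneg (iterate_zero_nonneg hα hw' x)).le, fun x => ?_⟩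
    obtain ⟨a, ha, hle⟩ := hcc.exists_iterand_zero_le hα hw' x
    exact ((hcc.isGLB_iterand hα hw hw' (memWeighted_iterate_zero hα hw') x).1
      ⟨a, ha, rfl⟩).trans hle
  | succ n ih =>
    obtain ⟨h1, h2, h3⟩ := ih
    have h0 := memWeighted_iterate_zero hα hw'
    have hn := memWeighted_of_abs_le_iterate_zero hα hw' h1 h2
    have hm : Measurable (M.iterate α w' M' c' ρ' b' (n + 1)) :=
      hcc.measurable_sInf_iterand hα hw hw' hn
    have hb : ∀ x, |M.iterate α w' M' c' ρ' b' (n + 1) x| ≤ M.iterate α w' M' c' ρ' b' 0 x := by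
      refine fun x => abs_le.2 ⟨(hcc.isGLB_iterand hα hw hw' hn x).2 ?_,
        (h3 x).trans ((le_abs_self _).trans (h2 x))⟩
      rintro _ ⟨a, ha, rfl⟩
      -- The subsolution $-u^{(0)}$ lies below $u^{(n)}$, and monotonicity keeps it below the next
      -- iterate.
      exact (neg_iterate_zero_le_iterand hα hw' ha).trans (iterand_mono hα ha
        (hw'.integrable_jumpRate h0 x a).neg (hw'.integrable_jumpRate hn x a)
        fun y => (abs_le.1 (h2 y)).1)
    have hn1 := memWeighted_of_abs_le_iterate_zero hα hw' hm hb
    refine ⟨hm, hb, fun x => (hcc.isGLB_iterand hα hw hw' hn x).2 ?_⟩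
    rintro _ ⟨a, ha, rfl⟩
    exact ((hcc.isGLB_iterand hα hw hw' hn1 x).1 ⟨a, ha, rfl⟩).trans (iterand_mono hα ha
      (hw'.integrable_jumpRate hn1 x a) (hw'.integrable_jumpRate hn x a) h3)

/-- The value iteration converges to a solution of the Bellman equation. -/
lemma CompactContinuous.exists_tendsto_iterate (hα : 0 < α) (hcc : M.CompactContinuous w)
    (hw : M.Drift w ρ b) (hw' : M.SecondWeight α w w' L' ρ' b' M' c') :
    ∃ u : S → ℝ, MemWeighted w' u ∧ M.Bellman α u ∧
      ∀ x, Tendsto (fun n => M.iterate α w' M' c' ρ' b' n x) atTop (𝓝 (u x)) := by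
  have hbd := hcc.iterate_bounds hα hw hw'
  have hanti (x : S) : Antitone fun n => M.iterate α w' M' c' ρ' b' n x :=
    antitone_nat_of_succ_le fun n => (hbd n).2.2 x
  have hbb (x : S) : BddBelow (range fun n => M.iterate α w' M' c' ρ' b' n x) := by
    refine ⟨-M.iterate α w' M' c' ρ' b' 0 x, ?_⟩
    rintro _ ⟨n, rfl⟩
    exact (abs_le.1 ((hbd n).2.1 x)).1
  let u : S → ℝ := fun x => ⨅ n, M.iterate α w' M' c' ρ' b' n x
  have hlim (x : S) : Tendsto (fun n => M.iterate α w' M' c' ρ' b' n x) atTop (𝓝 (u x)) :=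
    tendsto_atTop_ciInf (hanti x) (hbb x)
  have hle (n : ℕ) (x : S) : u x ≤ M.iterate α w' M' c' ρ' b' n x := ciInf_le (hbb x) n
  have hum : Measurable u :=
    measurable_of_tendsto_metrizable (fun n => (hbd n).1) (tendsto_pi_nhds.2 hlim)
  have hu0 (x : S) : |u x| ≤ M.iterate α w' M' c' ρ' b' 0 x :=
    le_of_tendsto (hlim x).abs (Eventually.of_forall fun n => (hbd n).2.1 x)
  have hu := memWeighted_of_abs_le_iterate_zero hα hw' hum hu0
  have hn (n : ℕ) := memWeighted_of_abs_le_iterate_zero hα hw' (hbd n).1 (hbd n).2.1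
  have h0 := memWeighted_iterate_zero hα hw'
  -- All iterates are dominated by $u^{(0)}$, which is integrable for the jump rates.
  have hiter (x : S) (a : A) : Tendsto (fun n => M.iterand α (M.iterate α w' M' c' ρ' b' n) x a)
      atTop (𝓝 (M.iterand α u x a)) := by
    have h1 : Tendsto (fun n => ∫ y, M.iterate α w' M' c' ρ' b' n y ∂(M.jumpRate x a)) atTop
        (𝓝 (∫ y, u y ∂(M.jumpRate x a))) :=
      tendsto_integral_of_dominated_convergence _ (fun n => (hbd n).1.aestronglyMeasurable)
        (hw'.integrable_jumpRate h0 x a) (fun n => Eventually.of_forall fun y => (hbd n).2.1 y)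
        (Eventually.of_forall hlim)
    simp only [iterand_eq, M.qInt_eq (hw'.integrable_jumpRate hu x a),
      fun n => M.qInt_eq (hw'.integrable_jumpRate (hn n) x a)]
    exact (((h1.sub ((hlim x).const_mul _)).const_add _).add ((hlim x).const_mul _)).div_const _
  refine ⟨u, hu, fun x => ?_, hlim⟩
  have hlow : ∀ a ∈ M.Adm x, u x ≤ M.iterand α u x a := fun a ha =>
    ge_of_tendsto (hiter x a) (Eventually.of_forall fun n =>
      (hle (n + 1) x).trans ((hcc.isGLB_iterand hα hw hw' (hn n) x).1 ⟨a, ha, rfl⟩))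
  obtain ⟨a, ha, hmin⟩ := hcc.exists_isLeast_iterand hα hw hw' hu x
  -- Since $u\le u^{(n)}$, the minimum for $u$ is at most the infimum for $u^{(n)}$, which is
  -- $u^{(n+1)}(x)$. Letting $n\to\infty$ finishes the exchange of limit and infimum; only the
  -- monotone direction is needed.
  have hup : M.iterand α u x a ≤ u x := by
    refine ge_of_tendsto ((tendsto_add_atTop_iff_nat 1).2 (hlim x)) (Eventually.of_forall
      fun n => (hcc.isGLB_iterand hα hw hw' (hn n) x).2 ?_)
    rintro _ ⟨a', ha', rfl⟩
    exact (hmin.2 ⟨a', ha', rfl⟩).trans (iterand_mono hα ha'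
      (hw'.integrable_jumpRate hu x a') (hw'.integrable_jumpRate (hn n) x a') (hle n))
  constructor
  · rintro _ ⟨a', ha', rfl⟩
    exact (le_iterand_iff hα).1 (hlow a' ha')
  · intro r hr
    exact (hr ⟨a, ha, rfl⟩).trans ((iterand_le_iff hα).1 hup)

end ValueIteration

/-! ### The dual program and the main theorem -/

section DualProgram

variable {α : ℝ} {w w' : S → ℝ} {ρ b L' ρ' b' M' c' : ℝ}

lemma dual_constraint_iff (hα : 0 < α) {v : S → ℝ} {x : S} {a : A} :
    0 ≤ 1 / α * M.cost x a - v x + 1 / α * M.qInt x a v ↔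
      α * v x ≤ M.cost x a + M.qInt x a v := by
  have h : 1 / α * M.cost x a - v x + 1 / α * M.qInt x a v =
      (M.cost x a + M.qInt x a v - α * v x) / α := by
    field_simp
    ring
  rw [h, le_div_iff₀ hα, zero_mul, sub_nonneg]

lemma Bellman.dualFeasible (hα : 0 < α) {u : S → ℝ} (hB : M.Bellman α u)
    (hu : MemWeighted w' u) : M.DualFeasible α w' u :=
  ⟨hu, fun x a ha => (dual_constraint_iff hα).2 ((hB x).1 ⟨a, ha, rfl⟩)⟩

end DualProgram

end CTMDP

theorem theorem3 {S A : Type*} [MeasurableSpace S] [StandardBorelSpace S]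
    [TopologicalSpace A] [TopologicalSpace.MetrizableSpace A] [SecondCountableTopology A]
    [MeasurableSpace A] [BorelSpace A] [StandardBorelSpace A]
    (M : CTMDP S A) (γ : Measure S) [IsProbabilityMeasure γ] (α : ℝ)
    (w w' : S → ℝ) (ρ b L' ρ' b' M' c' : ℝ)
    (hreg : M.Regular w ρ b) (hγ : Integrable w γ) (hα : ρ < α)
    (hw' : M.SecondWeight α w w' L' ρ' b' M' c') (hcc : M.CompactContinuous w) :
    -- (a)
    (∀ u : S → ℝ, CTMDP.MemWeighted w' u → M.Bellman α u →
      Integrable u γ ∧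
      (∃ φ : M.Selector, M.optimalValue γ α = ((∫ y, u y ∂γ : ℝ) : EReal) ∧
        M.value γ α φ.policy = ((∫ y, u y ∂γ : ℝ) : EReal)) ∧
      ∀ φ : M.Selector,
        (∀ x, IsMinOn (fun a => M.cost x a + M.qInt x a u) (M.Adm x) (φ.toFun x)) →
        M.value γ α φ.policy = M.optimalValue γ α) ∧
    -- (b)
    (∃ u : S → ℝ, (CTMDP.MemWeighted w' u ∧ M.Bellman α u) ∧
      (∀ v : S → ℝ, CTMDP.MemWeighted w' v → M.Bellman α v → v = u) ∧
      (∀ n, CTMDP.MemWeighted w' (M.iterate α w' M' c' ρ' b' n)) ∧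
      (∀ x, Antitone fun n => M.iterate α w' M' c' ρ' b' n x) ∧
      ∀ x, Tendsto (fun n => M.iterate α w' M' c' ρ' b' n x) atTop (𝓝 (u x))) ∧
    -- (c)
    (∀ u : S → ℝ, CTMDP.MemWeighted w' u → M.Bellman α u → M.DualOptimal γ α w' u) ∧
    -- (d)
    (∀ u : S → ℝ, CTMDP.MemWeighted w' u → M.Bellman α u →
      ∀ v : S → ℝ, M.DualFeasible α w' v → (M.DualOptimal γ α w' v ↔ v =ᵐ[γ] u)) := by
  have hw : M.Drift w ρ b := hreg.toDrift
  have h0 : 0 < α := hw.rho_nonneg.trans_lt hα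
  -- Multiplied by $\alpha$, dual feasibility is the subsolution inequality, so a Bellman solution
  -- dominates all feasible functions at every point, not just in the mean.
  have hdom {u v : S → ℝ} (hu : CTMDP.MemWeighted w' u) (hB : M.Bellman α u)
      (hv : M.DualFeasible α w' v) (x : S) : v x ≤ u x :=
    hB.le_of_subsolution hcc hw hα hw' hu hv.1
      (fun x a ha => (CTMDP.dual_constraint_iff h0).1 (hv.2 x a ha)) x
  have hint {u : S → ℝ} (hu : CTMDP.MemWeighted w' u) : Integrable u γ :=
    hw'.integrable_of_memWeighted hγ hu
  have hopt (u : S → ℝ) (hu : CTMDP.MemWeighted w' u) (hB : M.Bellman α u) :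
      M.DualOptimal γ α w' u :=
    ⟨hB.dualFeasible h0 hu, fun v hv => integral_mono (hint hv.1) (hint hu) (hdom hu hB hv)⟩
  refine ⟨fun u hu hB => ?_, ?_, hopt, fun u hu hB v hv => ⟨fun hv' => ?_, fun hvu => ⟨hv, ?_⟩⟩⟩
  · obtain ⟨φ, hφ⟩ := hB.exists_selector hcc hw hw' hu
    have hval : M.optimalValue γ α = ((∫ y, u y ∂γ : ℝ) : EReal) :=
      le_antisymm (iInf_le_of_le φ.policy (hw'.value_policy γ hw hα hγ hu φ hφ).le)
        (le_iInf fun π => hw'.integral_le_value γ hw hα hγ hu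
          (fun x a ha => (hB x).1 ⟨a, ha, rfl⟩) π)
    refine ⟨hint hu, ⟨φ, hval, hw'.value_policy γ hw hα hγ hu φ hφ⟩, fun ψ hψ => ?_⟩
    rw [hval]
    exact hw'.value_policy γ hw hα hγ hu ψ fun x =>
      hB.eq_of_forall_le (ψ.mem x) fun a ha => hψ x ha
  · obtain ⟨u, hu, hB, hlim⟩ := hcc.exists_tendsto_iterate h0 hw hw'
    have hbd := hcc.iterate_bounds h0 hw hw'
    refine ⟨u, ⟨hu, hB⟩, fun v hv hBv => funext fun x => ?_, fun n => ?_, fun x => ?_, hlim⟩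
    -- Each of two solutions is feasible, so each dominates the other.
    · exact le_antisymm (hdom hu hB (hBv.dualFeasible h0 hv) x)
        (hdom hv hBv (hB.dualFeasible h0 hu) x)
    · exact CTMDP.memWeighted_of_abs_le_iterate_zero h0 hw' (hbd n).1 (hbd n).2.1
    · exact antitone_nat_of_succ_le fun n => (hbd n).2.2 x
  -- Two optimal functions have the same integral. As $u-v\ge 0$ everywhere, it vanishes almost
  -- surely.
  · have h1 : ∫ x, (u x - v x) ∂γ = 0 := by
      rw [integral_sub (hint hu) (hint hv.1)]
      exact sub_eq_zero.2 (le_antisymm (hv'.2 u (hB.dualFeasible h0 hu)) ((hopt u hu hB).2 v hv))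
    have h2 := (integral_eq_zero_iff_of_nonneg (fun x => sub_nonneg.2 (hdom hu hB hv x))
      ((hint hu).sub (hint hv.1))).1 h1
    filter_upwards [h2] with x hx
    exact (sub_eq_zero.1 hx).symm
  · intro v' hv'
    rw [integral_congr_ae hvu]
    exact (hopt u hu hB).2 v' hv'
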